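/- **Theorem.** A *game arena* consists of a finite directed graph $(V,E)$ in which every vertex has at least one successor, a partition $(V_0,V_1)$ of $V$ into the vertices of Player 0 and of Player 1, and an initial vertex $v_0$. A *play* is an infinite path $\rho=\rho_0\rho_1\ldots$ with $\rho_0=v_0$. A *strategy* $\sigma_i$ of Player $i$ assigns to every finite path $hv$ from $v_0$ that ends in a vertex $v\in V_i$ a successor $\sigma_i(hv)$ of $v$; a play $\rho$ is *consistent* with $\sigma_i$ if $\rho_{j+1}=\sigma_i(\rho_0\ldots\rho_j)$ whenever $\rho_j\in V_i$. A *reachability Stackelberg-Pareto game* is a game arena together with target sets $T_0,T_1,\dots,T_t\subseteq V$, where $t\ge 1$: Player 0 wants to visit $T_0$, and Player 1 has the $t$ objectives to visit $T_1,\dots,T_t$. The *payoff* of a play $\rho$ is the vector $\mathrm{pay}(\rho)\in\{0,1\}^t$ with $\mathrm{pay}_i(\rho)=1$ iff $\rho$ visits $T_i$; payoffs are ordered componentwise. For a strategy $\sigma_0$ of Player 0, let $P_{\sigma_0}$ be the set of maximal elements of $\{\mathrm{pay}(\rho)\mid \rho \text{ a play consistent with }\sigma_0\}$. The *Stackelberg-Pareto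 Synthesis (SPS) problem* asks, given such a game, whether there is a strategy $\sigma_0$ of Player 0 such that for every strategy $\sigma_1$ of Player 1, if the payoff of the unique play $\rho$ consistent with $\sigma_0$ and $\sigma_1$ lies in $P_{\sigma_0}$, then $\rho$ visits $T_0$. The SPS problem for reachability Stackelberg-Pareto games is fixed-parameter tractable for the parameter $t$, the number of objectives of Player 1: there are a computable function $f:\mathbb N\to\mathbb N$, a constant $c$ and a single (deterministic) Turing machine that, given any such game encoded as a binary word $x$ (with $|V|$ and $t$ in unary, the bit vectors of the owners of the vertices, of the initial vertex and of the target sets, and the adjacency matrix), decides the SPS problem for it in at most $f(t)\cdot|x|^{c}$ steps. -/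

import Mathlib

/-! ### Game arenas, plays, strategies -/

/-- A game arena on the vertex set `V`. The partition `(V₀, V₁)` is given by the function `owner`:
`V_i` is the set of the vertices `v` with `owner v = i`. -/
structure GameArena (V : Type*) where
  owner : V → Fin 2
  E : Finset (V × V)
  exists_succ : ∀ v, ∃ v', (v, v') ∈ E
  init : V

namespace GameArena

variable {V : Type*} (G : GameArena V)

def IsPlay (ρ : ℕ → V) : Prop :=
  ρ 0 = G.init ∧ ∀ j, (ρ j, ρ (j + 1)) ∈ G.E

def Plays : Set (ℕ → V) := {ρ | G.IsPlay ρ}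

/-- Histories: nonempty finite paths that start in the initial vertex. -/
def IsHistory (h : List V) : Prop :=
  h.head? = some G.init ∧ h.IsChain (fun v v' => (v, v') ∈ G.E)

/-- A strategy of Player `i`: it assigns to every history `hv` that ends in a vertex `v` of Player
`i` a successor of `v`. The values of `move` on the other lists play no role. -/
structure Strategy (i : Fin 2) where
  move : List V → V
  legal : ∀ (h : List V) (v : V), G.IsHistory (h ++ [v]) → G.owner v = i →
    (v, move (h ++ [v])) ∈ G.E

/-- The finite prefix `ρ 0, …, ρ j` of an infinite sequence. -/
def pref (ρ : ℕ → V) (j : ℕ) : List V := (List.range (j + 1)).map ρ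

variable {G}

/-- `ρ` follows the strategy `σ` at every vertex of Player `i`. -/
def Strategy.Consistent {i : Fin 2} (σ : G.Strategy i) (ρ : ℕ → V) : Prop :=
  ∀ j, G.owner (ρ j) = i → ρ (j + 1) = σ.move (pref ρ j)

/-- The set of plays consistent with `σ`. -/
def Strategy.plays {i : Fin 2} (σ : G.Strategy i) : Set (ℕ → V) :=
  {ρ | G.IsPlay ρ ∧ σ.Consistent ρ}

/-- `ρ` is the outcome of the strategy profile `(σ₀, σ₁)`: the play consistent with both
strategies (see `existsUnique_isOutcome`). -/
def IsOutcome (σ₀ : G.Strategy 0) (σ₁ : G.Strategy 1) (ρ : ℕ → V) : Prop :=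
  G.IsPlay ρ ∧ σ₀.Consistent ρ ∧ σ₁.Consistent ρ

theorem pref_succ (ρ : ℕ → V) (j : ℕ) : pref ρ (j + 1) = pref ρ j ++ [ρ (j + 1)] := by
  simp [pref, List.range_succ]

theorem existsUnique_isOutcome (σ₀ : G.Strategy 0) (σ₁ : G.Strategy 1) :
    ∃! ρ, IsOutcome σ₀ σ₁ ρ := by
  classical
  let next : List V → V → V := fun h v =>
    if G.owner v = 0 then σ₀.move (h ++ [v]) else σ₁.move (h ++ [v])
  let st : ℕ → List V × V := fun k =>
    Nat.rec ([], G.init) (fun _ s => (s.1 ++ [s.2], next s.1 s.2)) k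
  let ρ : ℕ → V := fun k => (st k).2
  have hpref : ∀ k, pref ρ k = (st k).1 ++ [(st k).2] := by
    intro k
    induction k with
    | zero => rfl
    | succ k ih => rw [pref_succ, ih]
  have hown : ∀ v, G.owner v ≠ 0 → G.owner v = 1 := fun v h => by omega
  have hnext : ∀ k, G.IsHistory (pref ρ k) → (ρ k, ρ (k + 1)) ∈ G.E := by
    intro k hk
    rw [hpref] at hk
    change ((st k).2, next (st k).1 (st k).2) ∈ G.E
    by_cases h : G.owner (st k).2 = 0
    · simpa [next, h] using σ₀.legal _ _ hk h
    · simpa [next, h] using σ₁.legal _ _ hk (hown _ h)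
  have hhist : ∀ k, G.IsHistory (pref ρ k) := by
    intro k
    induction k with
    | zero => exact ⟨rfl, by simp [pref]⟩
    | succ k ih =>
      have hE := hnext k ih
      rw [pref_succ]
      refine ⟨by simp [ih.1], ?_⟩
      rw [List.isChain_append]
      refine ⟨ih.2, by simp, ?_⟩
      intro x hx y hy
      rw [hpref] at hx
      simp at hx hy
      subst hx hy
      exact hE
  refine ⟨ρ, ⟨⟨rfl, fun j => hnext j (hhist j)⟩, ?_, ?_⟩, ?_⟩
  · intro j hj
    rw [hpref]
    change next (st j).1 (st j).2 = _
    simp only [next]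
    rw [if_pos hj]
  · intro j hj
    rw [hpref]
    change next (st j).1 (st j).2 = _
    have : G.owner (st j).2 ≠ 0 := by
      have : G.owner (st j).2 = 1 := hj
      simp [this]
    simp only [next]
    rw [if_neg this]
  · rintro τ ⟨hτ, h0, h1⟩
    have key : ∀ k, pref τ k = pref ρ k ∧ τ k = ρ k := by
      intro k
      induction k with
      | zero =>
        have : τ 0 = ρ 0 := hτ.1
        exact ⟨by simp [pref, this], this⟩
      | succ k ih =>
        have hs : τ (k + 1) = ρ (k + 1) := by
          change _ = next (st k).1 (st k).2
          have e : τ k = (st k).2 := ih.2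
          by_cases h : G.owner (st k).2 = 0
          · rw [h0 k (by rw [e]; exact h), ih.1, hpref]
            simp [next, h]
          · rw [h1 k (by rw [e]; exact hown _ h), ih.1, hpref]
            simp [next, h]
        exact ⟨by rw [pref_succ, pref_succ, ih.1, hs], hs⟩
    funext k
    exact (key k).2

/-- The reachability objective of a target set. -/
def reach (G : GameArena V) (T : Finset V) : Set (ℕ → V) :=
  {ρ | G.IsPlay ρ ∧ ∃ j, ρ j ∈ T}

end GameArena

/-! ### Stackelberg-Pareto games and the synthesis problem -/

/-- A Stackelberg-Pareto game in which Player 1 has the objectives `obj 0, …, obj (t - 1)`. -/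
structure SPGame (V : Type*) (t : ℕ) where
  arena : GameArena V
  obj₀ : Set (ℕ → V)
  obj : Fin t → Set (ℕ → V)
  obj₀_subset : obj₀ ⊆ arena.Plays
  obj_subset : ∀ i, obj i ⊆ arena.Plays

namespace SPGame

variable {V : Type*} {t : ℕ} (𝒢 : SPGame V t)

open Classical in
/-- The payoff of a play. Payoffs are ordered componentwise, with `false < true`. -/
noncomputable def payoff (ρ : ℕ → V) : Fin t → Bool := fun i => decide (ρ ∈ 𝒢.obj i)

/-- The set of Pareto-optimal payoffs for the strategy `σ₀`. -/
def paretoSet (σ₀ : 𝒢.arena.Strategy 0) : Set (Fin t → Bool) :=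
  {p | Maximal (fun q => ∃ ρ ∈ σ₀.plays, 𝒢.payoff ρ = q) p}

/-- `σ₀` is a solution to the Stackelberg-Pareto synthesis problem. -/
def IsSolution (σ₀ : 𝒢.arena.Strategy 0) : Prop :=
  ∀ (σ₁ : 𝒢.arena.Strategy 1) (ρ : ℕ → V), GameArena.IsOutcome σ₀ σ₁ ρ →
    𝒢.payoff ρ ∈ 𝒢.paretoSet σ₀ → ρ ∈ 𝒢.obj₀

/-- The Stackelberg-Pareto synthesis problem asks whether there is a solution. -/
def HasSolution : Prop := ∃ σ₀ : 𝒢.arena.Strategy 0, 𝒢.IsSolution σ₀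

end SPGame

/-- A reachability Stackelberg-Pareto game, given by its arena and the target sets. -/
structure ReachSPGame (V : Type*) (t : ℕ) where
  arena : GameArena V
  target₀ : Finset V
  target : Fin t → Finset V

/-- The Stackelberg-Pareto game with the reachability objectives of the target sets. -/
def ReachSPGame.toSPGame {V : Type*} {t : ℕ} (g : ReachSPGame V t) : SPGame V t where
  arena := g.arena
  obj₀ := g.arena.reach g.target₀
  obj i := g.arena.reach (g.target i)
  obj₀_subset _ h := h.1
  obj_subset _ _ h := h.1

/-! ### Instances of the decision problem and their encoding as binary words -/

/-- An instance: a reachability Stackelberg-Pareto game with vertices `0, …, n - 1`, in which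
Player 1 has `t ≥ 1` objectives. -/
structure ReachSPInstance where
  n : ℕ
  t : ℕ
  one_le_t : 1 ≤ t
  game : ReachSPGame (Fin n) t

namespace ReachSPInstance

/-- The characteristic vector of a set of vertices. -/
def bits {n : ℕ} (S : Finset (Fin n)) : List Bool := List.ofFn fun v => decide (v ∈ S)

/-- The binary encoding of an instance: `n` and `t` in unary, each ended by a `0`, followed by the
bits that tell, in this order, for every vertex its owner, for every vertex whether it is the
initial one, the target set of Player 0, the target sets of Player 1 and the rows of the adjacency
matrix. -/
def encode (I : ReachSPInstance) : List Bool :=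
  List.replicate I.n true ++ [false] ++ List.replicate I.t true ++ [false] ++
    (List.ofFn fun v => decide (I.game.arena.owner v = 1)) ++
    bits {I.game.arena.init} ++
    bits I.game.target₀ ++
    (List.ofFn fun i => bits (I.game.target i)).flatten ++
    (List.ofFn fun v => List.ofFn fun v' => decide ((v, v') ∈ I.game.arena.E)).flatten

theorem encode_injective : Function.Injective encode := by
  have rep : ∀ (a b : ℕ) (l l' : List Bool),
      List.replicate a true ++ false :: l = List.replicate b true ++ false :: l' →
      a = b ∧ l = l' := by
    intro a
    induction a with
    | zero => intro b l l' h; cases b <;> simp_all [List.replicate_succ]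
    | succ a ih => intro b l l' h; cases b with
      | zero => simp_all [List.replicate_succ]
      | succ b => simp [List.replicate_succ] at h; have := ih _ _ _ h; simp_all
  rintro ⟨n,t,h,⟨o,E,hE,i⟩,T0,T⟩ ⟨n',t',h',⟨o',E',hE',i'⟩,T0',T'⟩ e
  simp only [encode, List.append_assoc, List.singleton_append] at e
  obtain ⟨rfl, e⟩ := rep _ _ _ _ e
  obtain ⟨rfl, e⟩ := rep _ _ _ _ e
  obtain ⟨e1, e⟩ := List.append_inj e (by simp)
  obtain ⟨e2, e⟩ := List.append_inj e (by simp [bits])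
  obtain ⟨e3, e⟩ := List.append_inj e (by simp [bits])
  obtain ⟨e4, e5⟩ := List.append_inj e (by simp [bits, Function.comp_def, List.map_ofFn])
  have fl : ∀ {m k : ℕ} (F F' : Fin m → Fin k → Bool),
      (List.ofFn fun x => List.ofFn (F x)).flatten =
        (List.ofFn fun x => List.ofFn (F' x)).flatten →
      F = F' := by
    intro m k F F' hh
    have := (List.eq_iff_flatten_eq (L := List.ofFn fun x => List.ofFn (F x))
      (L' := List.ofFn fun x => List.ofFn (F' x))).2
      ⟨hh, by simp [List.map_ofFn, Function.comp_def]⟩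
    have := List.ofFn_injective this
    funext x
    exact List.ofFn_injective (congrFun this x)
  have e4 := fl _ _ e4
  have e5 := fl _ _ e5
  have b : ∀ {S S' : Finset (Fin n)}, bits S = bits S' → S = S' := by
    intro S S' hh; ext v; have := congrFun (List.ofFn_injective hh) v; simpa using this
  have e1 : o = o' := by
    funext v; have := congrFun (List.ofFn_injective e1) v; simp at this; omega
  have e2 := b e2
  have e3 := b e3
  simp at e2 e3
  have : T = T' := by
    funext x; ext v; have := congrFun (congrFun e4 x) v; simpa using this
  have : E = E' := by
    ext ⟨x, v⟩; have := congrFun (congrFun e5 x) v; simpa using this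
  subst_vars; rfl

/-- The instances with a positive answer. -/
def SPS : Set ReachSPInstance := {I | I.game.toSPGame.HasSolution}

end ReachSPInstance

/-! ### Fixed-parameter tractability -/

/-- The decision problem `L`, for inputs `a : α` that are given as the words `enc a` and with the
parameter `κ a`, is fixed-parameter tractable: for some computable function `f` and some constant
`c`, a Turing machine (in the multi-stack form of Mathlib) decides whether `a ∈ L` in at most
`f (κ a) * |enc a| ^ c` steps. The machine, `f` and `c` do not depend on `a` or on `κ a`. -/
def InFPT {α Γ : Type} [Fintype Γ] (enc : α → List Γ) (κ : α → ℕ) (L : Set α) : Prop :=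
  ∃ (M : Turing.TM2ComputableAux Γ Bool) (f : ℕ → ℕ) (c : ℕ), Computable f ∧
    ∀ a : α, ∃ b : Bool, (b = true ↔ a ∈ L) ∧
      Nonempty (Turing.TM2OutputsInTime M.tm
        ((enc a).map M.inputAlphabet.symm)
        (some ((Computability.encodeBool b).map M.outputAlphabet.symm))
        (f (κ a) * (enc a).length ^ c))

/-! The proof combines a combinatorial description of the solvable games with a machine model in
which this description is evaluated fast.

Combinatorics. During a play only the current vertex v and the set c of the colours seen so far
matter, where colour 0 stands for the target of Player 0 and colour i + 1 for `target i`. Let W be a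
set of colour sets, a guess of the payoffs that Player 0 makes available. A strategy is a solution
if every p in W is matched by a consistent play with at least that payoff, and every consistent play
visits T₀ or has a payoff strictly below an element of W: plays of the latter kind are strictly
dominated, hence not Pareto-optimal. Conversely, for a solution σ₀ the colour sets of all consistent
plays form a suitable W. The second condition is a game on the states (v, c): in `Attr` Player 0
forces a visit to T₀, and in `Lose` Player 1 can reach, without entering `Attr`, a state whose
payoff is not below W. `Good` adds the first condition: a set S of obligations, initially W, is
carried along, is split among the successors at vertices of Player 1, and is discharged when c
covers all of it. This gives `hasSolution_iff`, from `hasSolution_of_good` and `good_outcomes`.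

Complexity. Colour sets are subsets of {0, …, t}, coded by numbers below 2^(t+1); sets of colour
sets are coded by numbers below 2^2^(t+1). With N = |x| * 2^2^(t+1), vertices, input positions and
both kinds of sets are all elements of {0, …, N - 1}. Over this domain the three regions are fixed
points of first-order formulas that do not depend on the instance. Only the distribution of
obligations among up to n successors is not a single element; `goodF` treats the successors one at a
time and splits a set in two at each of them.

A fixed formula is evaluated in time polynomial in N, and an iteration over k-tuples is stable
within N^k stages. So `exec_decider` has a bound N^e = (2^2^(t+1))^e * |x|^e in which e depends on
the formulas only. The evaluation is written as a stack program, and `Exec.simulate` carries it over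
to a machine without loss of time. `solved_foldl_apply` reduces correctness to the defining
properties of the relations, from which `resR_iff` follows. -/

open Function

/-! ### Structured programs over finitely many stacks of bits -/

/-- Stores: a stack of bits for every index. -/
abbrev StackStore := ℕ → List Bool

/-- Structured stack programs. Tests look at the top of a stack. -/
inductive StackProg where
  | skip : StackProg
  | push (k : ℕ) (b : Bool) : StackProg
  | pop (k : ℕ) : StackProg
  | mv (k k' : ℕ) : StackProg
  | seq (a b : StackProg) : StackProg
  | ite (p : Option Bool → Bool) (k : ℕ) (a b : StackProg) : StackProg
  | loop (p : Option Bool → Bool) (k : ℕ) (a : StackProg) : StackProg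

namespace StackProg

/-- `Exec c S S' T`: the program `c` takes the store `S` to `S'` in at most `T` steps. -/
inductive Exec : StackProg → StackStore → StackStore → ℕ → Prop where
  | skip (S) : Exec .skip S S 1
  | push (k b S) : Exec (.push k b) S (update S k (b :: S k)) 1
  | pop (k S) : Exec (.pop k) S (update S k (S k).tail) 1
  | mv {k k' S b l} : S k = b :: l →
      Exec (.mv k k') S (update (update S k l) k' (b :: update S k l k')) 1
  | mvNil {k k' S} : S k = [] → Exec (.mv k k') S S 1
  | seq {a b S S' S'' T T'} : Exec a S S' T → Exec b S' S'' T' → Exec (.seq a b) S S'' (T + T')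
  | iteTrue {p k a b S S' T} : p (S k).head? = true → Exec a S S' T →
      Exec (.ite p k a b) S S' (T + 1)
  | iteFalse {p k a b S S' T} : p (S k).head? = false → Exec b S S' T →
      Exec (.ite p k a b) S S' (T + 1)
  | loopFalse {p k a S} : p (S k).head? = false → Exec (.loop p k a) S S 1
  | loopTrue {p k a S S' S'' T T'} : p (S k).head? = true → Exec a S S' T →
      Exec (.loop p k a) S' S'' T' → Exec (.loop p k a) S S'' (T + T' + 1)
  | weaken {c S S' T T₁} : Exec c S S' T → T ≤ T₁ → Exec c S S' T₁

/-- A strict bound for the indices of the stacks used by a program. -/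
def bound : StackProg → ℕ
  | skip => 0
  | push k _ => k + 1
  | pop k => k + 1
  | mv k k' => max (k + 1) (k' + 1)
  | seq a b => max a.bound b.bound
  | ite _ k a b => max (k + 1) (max a.bound b.bound)
  | loop _ k a => max (k + 1) a.bound

/-- The labels of the compiled program. -/
def Lab : StackProg → Type
  | skip => Unit
  | push _ _ => Unit
  | pop _ => Unit
  | mv _ _ => Unit
  | seq a b => a.Lab ⊕ b.Lab
  | ite _ _ a b => Option (a.Lab ⊕ b.Lab)
  | loop _ _ a => Option a.Lab

/-- The labels of a program form a finite type. -/
@[reducible]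
def labFintype : (c : StackProg) → Fintype c.Lab
  | skip => inferInstanceAs (Fintype Unit)
  | push _ _ => inferInstanceAs (Fintype Unit)
  | pop _ => inferInstanceAs (Fintype Unit)
  | mv _ _ => inferInstanceAs (Fintype Unit)
  | seq a b =>
    letI := a.labFintype
    letI := b.labFintype
    inferInstanceAs (Fintype (a.Lab ⊕ b.Lab))
  | ite _ _ a b =>
    letI := a.labFintype
    letI := b.labFintype
    inferInstanceAs (Fintype (Option (a.Lab ⊕ b.Lab)))
  | loop _ _ a =>
    letI := a.labFintype
    inferInstanceAs (Fintype (Option a.Lab))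

/-- The label at which the compiled program starts. -/
def entry : (c : StackProg) → c.Lab
  | skip => ()
  | push _ _ => ()
  | pop _ => ()
  | mv _ _ => ()
  | seq a _ => Sum.inl a.entry
  | ite _ _ _ _ => none
  | loop _ _ _ => none

/-- Statements of machines with `B + 1` stacks of bits and a register for the symbol read last. -/
abbrev MStmt (B : ℕ) (L : Type) := Turing.TM2.Stmt (fun _ : Fin (B + 1) => Bool) L (Option Bool)

open Turing.TM2.Stmt in
/-- The code of a program, embedded by `emb` into a larger machine and left through `dest`. -/
def code (B : ℕ) {L : Type} : (c : StackProg) → (c.Lab → L) → L → c.Lab → MStmt B L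
  | skip, _, dest => fun _ => goto fun _ => dest
  | push k b, _, dest => fun _ =>
    Turing.TM2.Stmt.push (Fin.ofNat (B + 1) k) (fun _ => b) (goto fun _ => dest)
  | pop k, _, dest => fun _ =>
    Turing.TM2.Stmt.pop (Fin.ofNat (B + 1) k) (fun _ o => o) (goto fun _ => dest)
  | mv k k', _, dest => fun _ =>
    Turing.TM2.Stmt.pop (Fin.ofNat (B + 1) k) (fun _ o => o)
      (branch Option.isSome
        (Turing.TM2.Stmt.push (Fin.ofNat (B + 1) k') (fun o => o.getD false) (goto fun _ => dest))
        (goto fun _ => dest))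
  | seq a b, emb, dest => fun l => match l with
    | Sum.inl l => a.code B (fun x => emb (Sum.inl x)) (emb (Sum.inr b.entry)) l
    | Sum.inr l => b.code B (fun x => emb (Sum.inr x)) dest l
  | ite p k a b, emb, dest => fun l => match l with
    | none => peek (Fin.ofNat (B + 1) k) (fun _ o => o) (branch p
        (goto fun _ => emb (some (Sum.inl a.entry))) (goto fun _ => emb (some (Sum.inr b.entry))))
    | some (Sum.inl l) => a.code B (fun x => emb (some (Sum.inl x))) dest l
    | some (Sum.inr l) => b.code B (fun x => emb (some (Sum.inr x))) dest l
  | loop p k a, emb, dest => fun l => match l with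
    | none => peek (Fin.ofNat (B + 1) k) (fun _ o => o) (branch p
        (goto fun _ => emb (some a.entry)) (goto fun _ => dest))
    | some l => a.code B (fun x => emb (some x)) (emb none) l

/-- The stacks of the machine. -/
def restrict (B : ℕ) (S : StackStore) : Fin (B + 1) → List Bool := fun i => S i

theorem restrict_update {B k : ℕ} (hk : k < B + 1) (S : StackStore) (l : List Bool) :
    restrict B (update S k l) = update (restrict B S) (Fin.ofNat (B + 1) k) l := by
  funext i
  by_cases h : i = Fin.ofNat (B + 1) k
  · subst h
    simp [restrict, Nat.mod_eq_of_lt hk]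
  · have : (i : ℕ) ≠ k := fun h' => h (by ext; simp [h', Nat.mod_eq_of_lt hk])
    rw [update_of_ne h]
    simp [restrict, this]

theorem restrict_apply {B k : ℕ} (hk : k < B + 1) (S : StackStore) :
    restrict B S (Fin.ofNat (B + 1) k) = S k := by
  simp [restrict, Nat.mod_eq_of_lt hk]

open StateTransition

theorem evalsToInTime_one {σ : Type*} (f : σ → Option σ) {a b : σ} (h : f a = some b) :
    Nonempty (EvalsToInTime f a (some b) 1) :=
  ⟨⟨⟨1, by simpa [flip] using h⟩, le_rfl⟩⟩

theorem evalsToInTime_trans {σ : Type*} {f : σ → Option σ} {a b : σ} {c : Option σ} {m m' : ℕ}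
    (h : Nonempty (EvalsToInTime f a (some b) m)) (h' : Nonempty (EvalsToInTime f b c m')) :
    Nonempty (EvalsToInTime f a c (m + m')) := by
  obtain ⟨h⟩ := h
  obtain ⟨h'⟩ := h'
  have := EvalsToInTime.trans f m m' a b c h h'
  rw [add_comm m' m] at this
  exact ⟨this⟩

theorem evalsToInTime_mono {σ : Type*} {f : σ → Option σ} {a : σ} {c : Option σ} {m m' : ℕ}
    (h : Nonempty (EvalsToInTime f a c m)) (hm : m ≤ m') :
    Nonempty (EvalsToInTime f a c m') := by
  obtain ⟨h⟩ := h
  exact ⟨⟨h.toEvalsTo, h.steps_le_m.trans hm⟩⟩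

/-- The embedding of the labels and the exit label are arbitrary because subprograms run inside the
code of larger programs. The register can be left unspecified: every test reads a stack before it
branches, so old contents never matter. -/
theorem Exec.simulate {B : ℕ} {L : Type} (M : L → MStmt B L) {c : StackProg} {S S' : StackStore}
    {T : ℕ} (h : Exec c S S' T) : ∀ (emb : c.Lab → L) (dest : L),
      (∀ l, M (emb l) = c.code B emb dest l) → c.bound ≤ B + 1 → ∀ r : Option Bool,
      ∃ r', Nonempty (EvalsToInTime (Turing.TM2.step M)
        ⟨some (emb c.entry), r, restrict B S⟩ (some ⟨some dest, r', restrict B S'⟩) T) := by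
  induction h with
  | skip S =>
    intro emb dest hM hB r
    exact ⟨r, evalsToInTime_one _ (by simp [hM, code])⟩
  | push k b S =>
    intro emb dest hM hB r
    have hk : k < B + 1 := hB
    exact ⟨r, evalsToInTime_one _ (by
      simp only [Turing.TM2.step, hM, code, Turing.TM2.stepAux, restrict_update hk,
        restrict_apply hk])⟩
  | pop k S =>
    intro emb dest hM hB r
    have hk : k < B + 1 := hB
    exact ⟨(S k).head?, evalsToInTime_one _ (by
      simp only [Turing.TM2.step, hM, code, Turing.TM2.stepAux, restrict_update hk,
        restrict_apply hk])⟩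
  | @mv k k' S b l hS =>
    intro emb dest hM hB r
    have hk : k < B + 1 := (le_max_left _ _).trans hB
    have hk' : k' < B + 1 := (le_max_right _ _).trans hB
    exact ⟨some b, evalsToInTime_one _ (by
      simp only [Turing.TM2.step, hM, code, Turing.TM2.stepAux]
      simp only [restrict_apply hk, hS, List.head?_cons, List.tail_cons, Option.getD_some,
        Option.isSome_some, cond_true, ← restrict_update hk, ← restrict_update hk', restrict_apply hk'])⟩
  | @mvNil k k' S hS =>
    intro emb dest hM hB r
    have hk : k < B + 1 := (le_max_left _ _).trans hB
    have hu : update S k [] = S := by rw [← hS, update_eq_self]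
    exact ⟨none, evalsToInTime_one _ (by
      simp only [Turing.TM2.step, hM, code, Turing.TM2.stepAux]
      simp only [restrict_apply hk, hS, List.head?_nil, List.tail_nil, Option.isSome_none,
        cond_false, ← restrict_update hk, hu])⟩
  | @seq a b S S' S'' T T' _ _ iha ihb =>
    intro emb dest hM hB r
    obtain ⟨r₁, h₁⟩ := iha (fun x => emb (Sum.inl x)) (emb (Sum.inr b.entry))
      (fun l => hM (Sum.inl l)) ((le_max_left _ _).trans hB) r
    obtain ⟨r₂, h₂⟩ := ihb (fun x => emb (Sum.inr x)) dest
      (fun l => hM (Sum.inr l)) ((le_max_right _ _).trans hB) r₁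
    exact ⟨r₂, evalsToInTime_trans h₁ h₂⟩
  | @iteTrue p k a b S S' T hp _ ih =>
    intro emb dest hM hB r
    have hk : k < B + 1 := (le_max_left _ _).trans hB
    obtain ⟨r₁, h₁⟩ := ih (fun x => emb (some (Sum.inl x))) dest
      (fun l => hM (some (Sum.inl l))) ((le_max_left _ _).trans ((le_max_right _ _).trans hB))
      (S k).head?
    refine ⟨r₁, evalsToInTime_mono (evalsToInTime_trans (evalsToInTime_one _ ?_) h₁)
      (add_comm _ _).le⟩
    rw [Turing.TM2.step, hM]
    simp only [code, entry, Turing.TM2.stepAux, restrict_apply hk, hp, cond_true]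
  | @iteFalse p k a b S S' T hp _ ih =>
    intro emb dest hM hB r
    have hk : k < B + 1 := (le_max_left _ _).trans hB
    obtain ⟨r₁, h₁⟩ := ih (fun x => emb (some (Sum.inr x))) dest
      (fun l => hM (some (Sum.inr l))) ((le_max_right _ _).trans ((le_max_right _ _).trans hB))
      (S k).head?
    refine ⟨r₁, evalsToInTime_mono (evalsToInTime_trans (evalsToInTime_one _ ?_) h₁)
      (add_comm _ _).le⟩
    rw [Turing.TM2.step, hM]
    simp only [code, entry, Turing.TM2.stepAux, restrict_apply hk, hp, cond_false]
  | @loopFalse p k a S hp =>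
    intro emb dest hM hB r
    have hk : k < B + 1 := (le_max_left _ _).trans hB
    refine ⟨(S k).head?, evalsToInTime_one _ ?_⟩
    rw [Turing.TM2.step, hM]
    simp only [code, entry, Turing.TM2.stepAux, restrict_apply hk, hp, cond_false]
  | @loopTrue p k a S S' S'' T T' hp _ _ iha ihb =>
    intro emb dest hM hB r
    have hk : k < B + 1 := (le_max_left _ _).trans hB
    obtain ⟨r₁, h₁⟩ := iha (fun x => emb (some x)) (emb none)
      (fun l => hM (some l)) ((le_max_right _ _).trans hB) (S k).head?
    obtain ⟨r₂, h₂⟩ := ihb emb dest hM hB r₁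
    refine ⟨r₂, evalsToInTime_mono (evalsToInTime_trans
      (evalsToInTime_trans (evalsToInTime_one _ ?_) h₁) h₂) (by omega)⟩
    rw [Turing.TM2.step, hM]
    simp only [code, entry, Turing.TM2.stepAux, restrict_apply hk, hp, cond_true]
  | weaken _ hT ih =>
    intro emb dest hM hB r
    obtain ⟨r₁, h₁⟩ := ih emb dest hM hB r
    exact ⟨r₁, evalsToInTime_mono h₁ hT⟩

/-- The machine that runs a program, with stack `0` for the input and for the output. -/
def machine (c : StackProg) : Turing.FinTM2 :=
  letI := c.labFintype
  { K := Fin (c.bound + 1)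
    k₀ := 0
    k₁ := 0
    Γ := fun _ => Bool
    Λ := Option c.Lab
    main := some c.entry
    σ := Option Bool
    initialState := none
    Γk₀Fin := inferInstanceAs (Fintype Bool)
    m := fun l => match l with
      | none => Turing.TM2.Stmt.load (fun _ => none) Turing.TM2.Stmt.halt
      | some l => c.code c.bound some none l }

/-- The machine of a program, with its input and output alphabets. -/
def machineAux (c : StackProg) : Turing.TM2ComputableAux Bool Bool where
  tm := c.machine
  inputAlphabet := Equiv.refl Bool
  outputAlphabet := Equiv.refl Bool

theorem dite_eq_restrict (c : StackProg) (k : Fin (c.bound + 1)) (x : List Bool) :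
    (if _ : k = 0 then x.map (Equiv.refl Bool).symm else []) =
      restrict c.bound (update (fun _ => []) 0 x) k := by
  by_cases hk : k = 0
  · subst hk
    simp [restrict]
  · have : (k : ℕ) ≠ 0 := fun h => hk (Fin.ext h)
    simp [restrict, hk, this]

theorem Exec.outputs {c : StackProg} {x y : List Bool} {T : ℕ}
    (h : Exec c (update (fun _ => []) 0 x) (update (fun _ => []) 0 y) T) :
    Nonempty (Turing.TM2OutputsInTime c.machineAux.tm (x.map c.machineAux.inputAlphabet.symm)
      (some (y.map c.machineAux.outputAlphabet.symm)) (T + 1)) := by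
  obtain ⟨r, h₁⟩ := h.simulate (B := c.bound) c.machine.m some none (fun _ => rfl)
    (Nat.le_succ _) none
  -- The additional step is taken at the label `none`: it resets the register, as the halting
  -- configuration demands, and halts.
  have h₂ := evalsToInTime_trans h₁ (evalsToInTime_one (Turing.TM2.step c.machine.m)
    (b := ⟨none, none, restrict c.bound (update (fun _ => []) 0 y)⟩) rfl)
  have e₁ : Turing.initList c.machineAux.tm (x.map c.machineAux.inputAlphabet.symm) =
      ⟨some (some c.entry), none, restrict c.bound (update (fun _ => []) 0 x)⟩ := by
    unfold Turing.initList
    congr 1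
    funext k
    exact dite_eq_restrict c k x
  have e₂ : Turing.haltList c.machineAux.tm (y.map c.machineAux.outputAlphabet.symm) =
      ⟨none, none, restrict c.bound (update (fun _ => []) 0 y)⟩ := by
    unfold Turing.haltList
    congr 1
    funext k
    exact dite_eq_restrict c k y
  unfold Turing.TM2OutputsInTime
  rw [e₁, Option.map_some, e₂]
  exact h₂

end StackProg

/-! ### Basic stack programs: clearing, moving and copying. -/

namespace StackProg

theorem Exec.of_eq {c : StackProg} {S S₁ S' : StackStore} {T T' : ℕ} (h : Exec c S S₁ T)
    (hS : S₁ = S') (hT : T ≤ T') : Exec c S S' T' :=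
  hS ▸ h.weaken hT

/-- The common form of the loop arguments below: `F j` is the store when j rounds are left, so
invariants count downwards. Each round pays one step for its test, and the last test pays one more.
-/
theorem Exec.loop_family {p : Option Bool → Bool} {k : ℕ} {c : StackProg} {m T : ℕ}
    (F : ℕ → StackStore)
    (h : ∀ j < m, p (F (j + 1) k).head? = true ∧ Exec c (F (j + 1)) (F j) T)
    (h₀ : p (F 0 k).head? = false) : Exec (.loop p k c) (F m) (F 0) (m * (T + 1) + 1) := by
  induction m with
  | zero => simpa using Exec.loopFalse h₀
  | succ m ih =>
    obtain ⟨hp, hc⟩ := h m (Nat.lt_succ_self m)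
    exact (Exec.loopTrue hp hc (ih fun j hj => h j (by omega))).weaken (by ring_nf; omega)

/-- Empty a stack. -/
def clear (k : ℕ) : StackProg := .loop Option.isSome k (.pop k)

theorem exec_clear (k : ℕ) (S : StackStore) :
    Exec (clear k) S (update S k []) (2 * (S k).length + 1) := by
  generalize hl : S k = l
  induction l generalizing S with
  | nil => exact (Exec.loopFalse (by simp [hl])).of_eq (by rw [← hl, update_eq_self]) (by simp)
  | cons b l ih =>
    exact (Exec.loopTrue (by simp [hl]) (Exec.pop k S)
      (ih (update S k (S k).tail) (by simp [hl]))).of_eq (by simp)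
      (by simp only [List.length_cons]; omega)

/-- Move the stack `a` onto the stack `b`, which reverses it. -/
def transfer (a b : ℕ) : StackProg := .loop Option.isSome a (.mv a b)

theorem exec_transfer {a b : ℕ} (hab : a ≠ b) (S : StackStore) :
    Exec (transfer a b) S (update (update S a []) b ((S a).reverse ++ S b))
      (2 * (S a).length + 1) := by
  generalize hl : S a = l
  induction l generalizing S with
  | nil => exact (Exec.loopFalse (by simp [hl])).of_eq (by funext i; grind [update_apply]) (by simp)
  | cons x l ih =>
    refine (Exec.loopTrue (by simp [hl]) (Exec.mv hl)
      (ih _ (by simp [hab]))).of_eq ?_ (by simp only [List.length_cons]; omega)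
    funext i
    grind [update_apply]

/-- Push `true` onto `a` once for every element of `x`; `tmp` is used as an empty buffer. -/
def copyTo (x tmp a : ℕ) : StackProg :=
  .seq (.loop Option.isSome x (.seq (.mv x tmp) (.push a true))) (transfer tmp x)

/-- The stack `x` is reversed onto the buffer and then reversed back, so it survives; only its
length is copied. -/
theorem exec_copyTo {x tmp a : ℕ} (h₁ : x ≠ tmp) (h₂ : x ≠ a) (h₃ : tmp ≠ a) (S : StackStore)
    (ht : S tmp = []) :
    Exec (copyTo x tmp a) S (update S a (List.replicate (S x).length true ++ S a))
      (5 * (S x).length + 2) := by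
  have key : ∀ (l : List Bool) (S : StackStore), S x = l →
      Exec (.loop Option.isSome x (.seq (.mv x tmp) (.push a true))) S
        (update (update (update S x []) tmp (l.reverse ++ S tmp)) a
          (List.replicate l.length true ++ S a)) (3 * l.length + 1) := by
    intro l
    induction l with
    | nil =>
      intro S hl
      exact (Exec.loopFalse (by simp [hl])).of_eq (by funext i; grind [update_apply]) (by simp)
    | cons b l ih =>
      intro S hl
      refine (Exec.loopTrue (by simp [hl]) ((Exec.mv hl).seq (Exec.push a true _))
        (ih _ (by simp [h₁, h₂]))).of_eq ?_ (by simp only [List.length_cons]; omega)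
      have : List.replicate (l.length + 1) true = List.replicate l.length true ++ [true] :=
        List.replicate_succ'
      funext i
      grind [update_apply]
  refine ((key _ S rfl).seq (exec_transfer h₁.symm _)).of_eq ?_ ?_
  · funext i
    grind [update_apply]
  · simp [h₃, ht]
    omega

end StackProg

/-! ### Polynomially bounded functions -/

/-- The function `f` is bounded by a power of its argument. -/
def PolyBounded (f : ℕ → ℕ) : Prop := ∃ e, ∀ N, 2 ≤ N → f N ≤ N ^ e

namespace PolyBounded

theorem const (c : ℕ) : PolyBounded fun _ => c :=
  ⟨c, fun _ hN => (Nat.lt_pow_self hN).le⟩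

theorem id : PolyBounded fun N => N := ⟨1, fun N _ => by simp⟩

theorem mul {f g : ℕ → ℕ} (hf : PolyBounded f) (hg : PolyBounded g) :
    PolyBounded fun N => f N * g N := by
  obtain ⟨a, ha⟩ := hf
  obtain ⟨b, hb⟩ := hg
  exact ⟨a + b, fun N hN => by rw [pow_add]; exact Nat.mul_le_mul (ha N hN) (hb N hN)⟩

/-- The factor 2 is absorbed by the base, N^a + N^b ≤ 2 * N^(a+b) ≤ N^(a+b+1), which is why bounds
are required only from N = 2 on. -/
theorem add {f g : ℕ → ℕ} (hf : PolyBounded f) (hg : PolyBounded g) :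
    PolyBounded fun N => f N + g N := by
  obtain ⟨a, ha⟩ := hf
  obtain ⟨b, hb⟩ := hg
  refine ⟨a + b + 1, fun N hN => ?_⟩
  have h₁ : N ^ a ≤ N ^ (a + b) := Nat.pow_le_pow_right (by omega) (by omega)
  have h₂ : N ^ b ≤ N ^ (a + b) := Nat.pow_le_pow_right (by omega) (by omega)
  have h₃ : N ^ (a + b) * 2 ≤ N ^ (a + b) * N := Nat.mul_le_mul_left _ hN
  have := ha N hN
  have := hb N hN
  rw [pow_succ]
  change f N + g N ≤ _
  omega

theorem pow (k : ℕ) : PolyBounded fun N => N ^ k := ⟨k, fun _ _ => le_rfl⟩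

end PolyBounded

/-! ### First-order formulas over an initial segment of the natural numbers -/

/-- First-order formulas; variables are de Bruijn levels. -/
inductive FOFormula where
  | lt (i j : ℕ) : FOFormula
  | rel (r : ℕ) (args : List ℕ) : FOFormula
  | neg (φ : FOFormula) : FOFormula
  | and (φ ψ : FOFormula) : FOFormula
  | ex (φ : FOFormula) : FOFormula

/-- The interpretation of the relation symbols. -/
abbrev RelStore := ℕ → List ℕ → Prop

namespace FOFormula

/-- Truth in the structure with the elements `0, …, N - 1`. -/
def Holds (N : ℕ) (ρ : RelStore) : List ℕ → FOFormula → Prop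
  | env, lt i j => env.getD i 0 < env.getD j 0
  | env, rel r args => ρ r (args.map fun i => env.getD i 0)
  | env, neg φ => ¬ φ.Holds N ρ env
  | env, and φ ψ => φ.Holds N ρ env ∧ ψ.Holds N ρ env
  | env, ex φ => ∃ x < N, φ.Holds N ρ (env ++ [x])

/-- The relation symbols are used with their arities. -/
def WF (ar : ℕ → ℕ) : FOFormula → Prop
  | lt _ _ => True
  | rel r args => args.length = ar r
  | neg φ => φ.WF ar
  | and φ ψ => φ.WF ar ∧ ψ.WF ar
  | ex φ => φ.WF ar

end FOFormula

/-- The position of a tuple in the table of a relation on `0, …, N - 1`. -/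
def tuplePos (N : ℕ) (args : List ℕ) : ℕ := args.foldl (fun a x => a * N + x) 0

/-! ### Stores that represent relational structures. -/

namespace StackProg

notation "inputStack" => (0 : ℕ)
notation "sizeStack" => (1 : ℕ)
notation "accStack" => (2 : ℕ)
notation "auxStack" => (3 : ℕ)
notation "tmpStack" => (4 : ℕ)
notation "resStack" => (5 : ℕ)
notation "outStack" => (6 : ℕ)
notation:max "varStack" i:max => ((7 : ℕ) + 3 * i)
notation:max "relStack" r:max => ((8 : ℕ) + 3 * r)
notation:max "cntStack" j:max => ((9 : ℕ) + 3 * j)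

/-- Test for the symbol `true` on the top of a stack. -/
def topTrue (o : Option Bool) : Bool := o == some true

open Classical in
/-- The store represents the interpretation `ρ` of the relations by tables, and the values of the
variables by unary numbers. -/
structure Represents (ar : ℕ → ℕ) (N : ℕ) (ρ : RelStore) (env : List ℕ) (S : StackStore) :
    Prop where
  size : S sizeStack = List.replicate N true
  acc : S accStack = []
  aux : S auxStack = []
  tmp : S tmpStack = []
  var : ∀ i, S (varStack i) = List.replicate (env.getD i 0) true
  env_lt : ∀ x ∈ env, x < N
  table : ∀ r args, args.length = ar r → (∀ x ∈ args, x < N) →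
    (S (relStack r)).getD (tuplePos N args) false = decide (ρ r args)
  length_le : ∀ r, (S (relStack r)).length ≤ N ^ ar r

theorem Represents.getD_lt {ar N ρ env S} (h : Represents ar N ρ env S) (hN : 2 ≤ N) (i : ℕ) :
    env.getD i 0 < N := by
  rw [List.getD_eq_getElem?_getD]
  cases hi : env[i]? with
  | none => simp; omega
  | some x => exact h.env_lt x (List.mem_of_getElem? hi)

theorem Represents.update_res {ar N ρ env S} (h : Represents ar N ρ env S) (l : List Bool) :
    Represents ar N ρ env (update S resStack l) where
  size := by simpa using h.size
  acc := by simpa using h.acc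
  aux := by simpa using h.aux
  tmp := by simpa using h.tmp
  var i := by rw [update_of_ne (by omega)]; exact h.var i
  env_lt := h.env_lt
  table r args := by rw [update_of_ne (by omega)]; exact h.table r args
  length_le r := by rw [update_of_ne (by omega)]; exact h.length_le r

/-- With de Bruijn levels the new variable has the number `env.length`, and the older ones keep
their stacks. Variables beyond the environment have the default value 0, an empty stack, so the
stack of the new variable is initially empty. -/
theorem Represents.update_var {ar N ρ env S} (h : Represents ar N ρ env S) {x : ℕ} (hx : x < N) :
    Represents ar N ρ (env ++ [x])
      (update S (varStack env.length) (List.replicate x true)) where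
  size := by rw [update_of_ne (by omega)]; exact h.size
  acc := by rw [update_of_ne (by omega)]; exact h.acc
  aux := by rw [update_of_ne (by omega)]; exact h.aux
  tmp := by rw [update_of_ne (by omega)]; exact h.tmp
  var i := by
    rcases lt_trichotomy i env.length with hi | hi | hi
    · rw [update_of_ne (by omega), h.var i, List.getD_append _ _ _ _ hi]
    · subst hi
      simp [List.getD_eq_getElem?_getD]
    · rw [update_of_ne (by omega), h.var i]
      simp [List.getD_eq_getElem?_getD, List.getElem?_eq_none, hi.le, Nat.succ_le_of_lt hi]
  env_lt y hy := by
    rcases List.mem_append.1 hy with hy | hy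
    · exact h.env_lt y hy
    · simp at hy; omega
  table r args := by rw [update_of_ne (by omega)]; exact h.table r args
  length_le r := by rw [update_of_ne (by omega)]; exact h.length_le r

/-! ### Evaluation of formulas -/

/-- Replace the number `a` in the accumulator by `a * N`. -/
def mulSize : StackProg :=
  .seq (.loop Option.isSome accStack
    (.seq (.pop accStack) (copyTo sizeStack tmpStack auxStack))) (transfer auxStack accStack)

theorem exec_mulSize {S : StackStore} {N a : ℕ} (hs : S sizeStack = List.replicate N true)
    (ha : S accStack = List.replicate a true) (haux : S auxStack = []) (ht : S tmpStack = []) :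
    Exec mulSize S (update S accStack (List.replicate (a * N) true))
      (a * (5 * N + 4) + 1 + (2 * (a * N) + 1)) := by
  -- With j rounds left, each of the a - j finished rounds has contributed N symbols.
  let F : ℕ → StackStore := fun j => update (update S accStack (List.replicate j true)) auxStack
    (List.replicate ((a - j) * N) true)
  have hF : Exec (.loop Option.isSome accStack
      (.seq (.pop accStack) (copyTo sizeStack tmpStack auxStack))) (F a) (F 0)
      (a * (5 * N + 4) + 1) := by
    refine (Exec.loop_family (T := 1 + (5 * N + 2)) F (fun j hj => ⟨?_, ?_⟩) ?_).weaken
      (by ring_nf; omega)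
    · simp [F, List.replicate_succ]
    · refine ((Exec.pop accStack _).seq
        (exec_copyTo (by decide) (by decide) (by decide) _ ?_)).of_eq ?_ ?_
      · simp [F, ht]
      · have : (a - j) * N = N + (a - (j + 1)) * N := by
          have : a - j = a - (j + 1) + 1 := by omega
          rw [this]; ring
        have h2 : List.replicate ((a - j) * N) true =
          List.replicate N true ++ List.replicate ((a - (j + 1)) * N) true := by
          rw [this, List.replicate_add]
        have h3 : (List.replicate (j + 1) true).tail = List.replicate j true := by simp
        simp only [F, h2]
        funext i
        grind [update_apply]
      · simp [F, hs]
    · simp [F]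
  have h₀ : F a = S := by
    funext i
    simp only [F]
    grind [update_apply]
  rw [h₀] at hF
  refine (hF.seq (exec_transfer (by decide) _)).of_eq ?_ ?_
  · simp only [F]
    funext i
    grind [update_apply]
  · simp [F]

/-- Extend the position in the accumulator by the values of the variables in a list. -/
def horner : List ℕ → StackProg
  | [] => .skip
  | i :: l => .seq mulSize (.seq (copyTo (varStack i) tmpStack accStack) (horner l))

/-- A tuple is read as a number in base N. The parameter k counts the digits that are already read:
the bound a < N ^ k keeps the accumulator, and the cost of multiplying it, polynomial in N. -/
theorem exec_horner (args : List ℕ) : ∀ k, ∃ T, PolyBounded T ∧ ∀ (N : ℕ) (S : StackStore)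
    (val : ℕ → ℕ) (a : ℕ), a < N ^ k → (∀ i, val i < N) → S sizeStack = List.replicate N true →
    S accStack = List.replicate a true → S auxStack = [] → S tmpStack = [] →
    (∀ i, S (varStack i) = List.replicate (val i) true) →
    (args.map val).foldl (fun a x => a * N + x) a < N ^ (k + args.length) ∧
    Exec (horner args) S (update S accStack (List.replicate
      ((args.map val).foldl (fun a x => a * N + x) a) true)) (T N) := by
  induction args with
  | nil =>
    intro k
    refine ⟨_, .const 1, fun N S val a hk _ _ ha _ _ _ => ⟨by simpa using hk, ?_⟩⟩
    exact (Exec.skip S).of_eq (by simp [← ha]) le_rfl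
  | cons i l ih =>
    intro k
    obtain ⟨T, hT, h⟩ := ih (k + 1)
    refine ⟨fun N => (N ^ k * (5 * N + 4) + 1 + (2 * (N ^ k * N) + 1)) + ((5 * N + 2) + T N), ?_,
      fun N S val a hk hv hs ha haux ht hvar => ?_⟩
    · exact (((((PolyBounded.pow k).mul (((PolyBounded.const 5).mul .id).add (.const 4))).add
        (.const 1)).add (((PolyBounded.const 2).mul ((PolyBounded.pow k).mul .id)).add
        (.const 1)))).add ((((PolyBounded.const 5).mul .id).add (.const 2)).add hT)
    · have hlt : a * N + val i < N ^ (k + 1) := by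
        have : (a + 1) * N ≤ N ^ k * N := Nat.mul_le_mul_right _ hk
        have := hv i
        rw [pow_succ]
        linarith
      obtain ⟨h₁, h₂⟩ := h N (update S accStack (List.replicate (a * N + val i) true)) val
        (a * N + val i) hlt hv (by simpa using hs) (by simp) (by simpa using haux)
        (by simpa using ht) (fun j => by rw [update_of_ne (by omega)]; exact hvar j)
      refine ⟨?_, ?_⟩
      · simp only [List.map_cons, List.foldl_cons, List.length_cons]
        rw [show k + (l.length + 1) = k + 1 + l.length by ring]
        exact h₁
      · have e₁ := exec_mulSize hs ha haux ht
        have e₂ := exec_copyTo (x := varStack i) (tmp := tmpStack) (a := accStack) (by omega)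
          (by omega) (by decide) (update S accStack (List.replicate (a * N) true))
          (by simpa using ht)
        have hle : a * (5 * N + 4) + 1 + (2 * (a * N) + 1) ≤
            N ^ k * (5 * N + 4) + 1 + (2 * (N ^ k * N) + 1) := by gcongr
        have hc : update (update S accStack (List.replicate (a * N) true)) accStack
            (List.replicate (update S accStack (List.replicate (a * N) true) (varStack i)).length
              true ++ update S accStack (List.replicate (a * N) true) accStack) =
            update S accStack (List.replicate (a * N + val i) true) := by
          rw [update_of_ne (by omega), hvar i, update_idem, update_self, List.length_replicate,
            ← List.replicate_add, add_comm]
        rw [hc] at e₂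
        refine ((e₁.weaken hle).seq ((e₂.weaken ?_).seq h₂)).of_eq (by simp) le_rfl
        rw [update_of_ne (by omega), hvar i, List.length_replicate]
        have := hv i
        omega

/-- Push the entry of the table of `r` at the position in the accumulator. -/
def readTable (r : ℕ) : StackProg :=
  .seq (.loop Option.isSome accStack (.seq (.pop accStack) (.mv (relStack r) tmpStack)))
    (.seq (.ite topTrue (relStack r) (.push resStack true) (.push resStack false))
      (transfer tmpStack (relStack r)))

/-- The first a entries go to the buffer, the top is inspected, and the entries return. Beyond the
end of the table the moves have no effect and the test yields `false`, in agreement with the default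
of `getD`. -/
theorem exec_readTable (r : ℕ) {S : StackStore} {a : ℕ} (ha : S accStack = List.replicate a true)
    (ht : S tmpStack = []) :
    Exec (readTable r) S (update (update S accStack []) resStack
      ((S (relStack r)).getD a false :: S resStack)) (3 * a + 1 + (2 + (2 * a + 1))) := by
  let F : ℕ → StackStore := fun j => update (update (update S accStack (List.replicate j true))
    (relStack r) ((S (relStack r)).drop (a - j))) tmpStack
    ((S (relStack r)).take (a - j)).reverse
  have hF : Exec (.loop Option.isSome accStack (.seq (.pop accStack) (.mv (relStack r) tmpStack)))
      (F a) (F 0) (3 * a + 1) := by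
    refine (Exec.loop_family (T := 1 + 1) F (fun j hj => ⟨?_, ?_⟩) ?_).weaken (by omega)
    · simp only [F]
      rw [update_of_ne (by omega), update_of_ne (by omega), update_self]
      simp [List.replicate_succ]
    · have hj' : a - j = a - (j + 1) + 1 := by omega
      have h3 : (List.replicate (j + 1) true).tail = List.replicate j true := by simp
      rcases lt_or_ge (a - (j + 1)) (S (relStack r)).length with hlt | hge
      · refine ((Exec.pop accStack _).seq (Exec.mv (b := (S (relStack r))[a - (j + 1)])
          (l := (S (relStack r)).drop (a - j)) ?_)).of_eq ?_ le_rfl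
        · simp only [F]
          rw [update_of_ne (by omega), update_of_ne (by omega), update_self,
            List.drop_eq_getElem_cons hlt, hj']
        · have h4 : (S (relStack r)).take (a - j) =
            (S (relStack r)).take (a - (j + 1)) ++ [(S (relStack r))[a - (j + 1)]] := by
            rw [hj', List.take_succ_eq_append_getElem hlt]
          simp only [F, h4, List.reverse_append]
          funext i
          grind [update_apply]
      · have h5 : (S (relStack r)).drop (a - j) = [] := List.drop_eq_nil_of_le (by omega)
        have h6 : (S (relStack r)).drop (a - (j + 1)) = [] := List.drop_eq_nil_of_le hge
        have h7 : (S (relStack r)).take (a - j) = S (relStack r) := List.take_of_length_le (by omega)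
        have h8 : (S (relStack r)).take (a - (j + 1)) = S (relStack r) :=
          List.take_of_length_le hge
        refine ((Exec.pop accStack _).seq (Exec.mvNil ?_)).of_eq ?_ le_rfl
        · simp only [F, h6]
          rw [update_of_ne (by omega), update_of_ne (by omega), update_self]
        · simp only [F, h5, h6, h7, h8]
          clear h5 h6 h7 h8 hge hj'
          funext i
          grind [update_apply]
    · simp only [F]
      rw [update_of_ne (by omega), update_of_ne (by omega), update_self]
      simp
  have h₀ : F a = S := by
    funext i
    simp only [F]
    grind [update_apply]
  rw [h₀] at hF
  have hd : ((S (relStack r)).drop a).head? = (S (relStack r))[a]? := by simp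
  have hF0 : F 0 (relStack r) = (S (relStack r)).drop a := by
    simp only [F]
    rw [update_of_ne (by omega), update_self, Nat.sub_zero]
  have hi : Exec (.ite topTrue (relStack r) (.push resStack true) (.push resStack false)) (F 0)
      (update (F 0) resStack ((S (relStack r)).getD a false :: F 0 resStack)) 2 := by
    rw [List.getD_eq_getElem?_getD]
    rcases hb : (S (relStack r))[a]? with _ | _ | _
    · exact Exec.iteFalse (by rw [hF0, hd, hb]; rfl) (Exec.push _ _ _)
    · exact Exec.iteFalse (by rw [hF0, hd, hb]; rfl) (Exec.push _ _ _)
    · exact Exec.iteTrue (by rw [hF0, hd, hb]; rfl) (Exec.push _ _ _)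
  refine (hF.seq (hi.seq (exec_transfer (by omega) _))).of_eq ?_ ?_
  · have ht' : ((S (relStack r)).take a).reverse.reverse ++ (S (relStack r)).drop a =
        S (relStack r) := by simp
    simp only [F, Nat.sub_zero]
    clear hF h₀ hd hF0 hi
    generalize (S (relStack r)).getD a false = x
    generalize ((S (relStack r)).take a).reverse = l₁ at *
    generalize (S (relStack r)).drop a = l₂ at *
    funext i
    grind [update_apply]
  · simp [F]

/-- Push the truth value of the formula, whose free variables are `0, …, d - 1`. -/
def evalFormula : FOFormula → ℕ → StackProg
  | .lt i j, _ =>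
    .seq (copyTo (varStack i) tmpStack auxStack) <| .seq (copyTo (varStack j) tmpStack accStack) <|
    .seq (.loop Option.isSome auxStack (.seq (.pop auxStack) (.pop accStack))) <|
    .seq (.ite topTrue accStack (.push resStack true) (.push resStack false)) (clear accStack)
  | .rel r args, _ => .seq (horner args) (readTable r)
  | .neg φ, d => .seq (evalFormula φ d) (.ite topTrue resStack
      (.seq (.pop resStack) (.push resStack false)) (.seq (.pop resStack) (.push resStack true)))
  | .and φ ψ, d => .seq (evalFormula φ d) <| .seq (evalFormula ψ d) (.ite topTrue resStack
      (.pop resStack) (.seq (.pop resStack) (.seq (.pop resStack) (.push resStack false))))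
  | .ex φ, d => .seq (.push resStack false) <| .seq (copyTo sizeStack tmpStack (varStack d))
      (.loop Option.isSome (varStack d) (.seq (.pop (varStack d)) <| .seq (evalFormula φ (d + 1))
        (.ite topTrue resStack (.seq (.pop resStack) (.seq (.pop resStack) (.push resStack true)))
          (.pop resStack))))

open Classical in
-- The bound is built by recursion on the formula and is uniform in the interpretation, the
-- environment and the store. A quantifier multiplies it by roughly N, so its degree depends on the
-- formula alone.
theorem exec_evalFormula (ar : ℕ → ℕ) (φ : FOFormula) (hφ : φ.WF ar) :
    ∃ T, PolyBounded T ∧ ∀ N, 2 ≤ N → ∀ (ρ : RelStore) (env : List ℕ) (S : StackStore),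
      Represents ar N ρ env S → Exec (evalFormula φ env.length) S
        (update S resStack (decide (φ.Holds N ρ env) :: S resStack)) (T N) := by
  induction φ with
  | lt i j =>
    refine ⟨fun N => (5 * N + 2) + ((5 * N + 2) + ((3 * N + 1) + (2 + (2 * N + 1)))), ?_, ?_⟩
    · exact (((PolyBounded.const 5).mul .id).add (.const 2)).add
        ((((PolyBounded.const 5).mul .id).add (.const 2)).add
        ((((PolyBounded.const 3).mul .id).add (.const 1)).add
        ((PolyBounded.const 2).add (((PolyBounded.const 2).mul .id).add (.const 1)))))
    intro N hN ρ env S h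
    have hi := h.getD_lt hN i
    have hj := h.getD_lt hN j
    have hvi := h.var i
    have hvj := h.var j
    obtain ⟨x, hx⟩ : ∃ x, x = env.getD i 0 := ⟨_, rfl⟩
    obtain ⟨y, hy⟩ : ∃ y, y = env.getD j 0 := ⟨_, rfl⟩
    rw [show decide ((FOFormula.lt i j).Holds N ρ env) = decide (x < y) by
      simp [FOFormula.Holds, hx, hy]]
    rw [← hx] at hi hvi
    rw [← hy] at hj hvj
    have e₁ := exec_copyTo (x := varStack i) (tmp := tmpStack) (a := auxStack) (by omega)
      (by omega) (by decide) S h.tmp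
    rw [hvi, h.aux, List.append_nil, List.length_replicate] at e₁
    have e₂ := exec_copyTo (x := varStack j) (tmp := tmpStack) (a := accStack) (by omega)
      (by omega) (by decide) (update S auxStack (List.replicate x true))
      (by simpa using h.tmp)
    rw [update_of_ne (by omega), hvj, List.length_replicate,
      show update S auxStack (List.replicate x true) accStack = [] by simpa using h.acc,
      List.append_nil] at e₂
    -- Of the x simultaneous pops, k are left. The truncated subtraction is intended: at k = 0 a
    -- symbol remains iff x < y.
    let F : ℕ → StackStore := fun k => update (update S auxStack (List.replicate k true)) accStack
      (List.replicate (y - (x - k)) true)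
    have e₃ : Exec (.loop Option.isSome auxStack (.seq (.pop auxStack) (.pop accStack)))
        (F x) (F 0) (3 * x + 1) := by
      refine (Exec.loop_family (T := 1 + 1) F (fun k hk => ⟨?_, ?_⟩) ?_).weaken (by omega)
      · simp [F, List.replicate_succ]
      · refine ((Exec.pop auxStack _).seq (Exec.pop accStack _)).of_eq ?_ le_rfl
        have : y - (x - k) = y - (x - (k + 1)) - 1 := by omega
        have h4 : (List.replicate (y - (x - (k + 1))) true).tail =
          List.replicate (y - (x - k)) true := by simp [this]
        have h3 : (List.replicate (k + 1) true).tail = List.replicate k true := by simp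
        simp only [F]
        funext i
        grind [update_apply]
      · simp [F]
    have hFx : F x = update (update S auxStack (List.replicate x true)) accStack
        (List.replicate y true) := by simp [F]
    rw [← hFx] at e₂
    have e₄ : Exec (.ite topTrue accStack (.push resStack true) (.push resStack false)) (F 0)
        (update (F 0) resStack (decide (x < y) :: F 0 resStack)) 2 := by
      by_cases hxy : x < y
      · obtain ⟨m, hm⟩ : ∃ m, y - x = m + 1 := ⟨y - x - 1, by omega⟩
        rw [decide_eq_true hxy]
        exact Exec.iteTrue (by simp [F, hm, List.replicate_succ, topTrue]) (Exec.push _ _ _)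
      · have hm : y - x = 0 := by omega
        rw [decide_eq_false hxy]
        exact Exec.iteFalse (by simp [F, hm, topTrue]) (Exec.push _ _ _)
    refine ((e₁.weaken ?_).seq ((e₂.weaken ?_).seq ((e₃.weaken ?_).seq
      (e₄.seq ((exec_clear accStack _).weaken ?_))))).of_eq ?_ le_rfl
    · omega
    · omega
    · omega
    · simp [F]; omega
    · have := h.acc
      have := h.aux
      simp only [F]
      funext i
      grind [update_apply]
  | rel r args =>
    obtain ⟨T, hT, h⟩ := exec_horner args 0
    refine ⟨fun N => T N + (3 * N ^ args.length + 1 + (2 + (2 * N ^ args.length + 1))), ?_, ?_⟩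
    · exact hT.add ((((PolyBounded.const 3).mul (.pow _)).add (.const 1)).add
        ((PolyBounded.const 2).add (((PolyBounded.const 2).mul (.pow _)).add (.const 1))))
    intro N hN ρ env S hS
    obtain ⟨h₁, h₂⟩ := h N S (fun i => env.getD i 0) 0 (by simp) (hS.getD_lt hN) hS.size
      (by simpa using hS.acc) hS.aux hS.tmp hS.var
    rw [zero_add] at h₁
    refine (h₂.seq (exec_readTable r (a := tuplePos N (args.map fun i => env.getD i 0))
      (by simp [tuplePos]) (by simpa using hS.tmp))).of_eq ?_ ?_
    · have ht : (S (relStack r)).getD (tuplePos N (args.map fun i => env.getD i 0)) false =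
          decide ((FOFormula.rel r args).Holds N ρ env) :=
        hS.table r _ (by rw [List.length_map]; exact hφ)
          (by simp only [List.mem_map]; rintro _ ⟨i, -, rfl⟩; exact hS.getD_lt hN i)
      rw [update_of_ne (by omega), update_of_ne (by decide), ht]
      have := hS.acc
      clear h h₁ h₂ ht
      funext i
      grind [update_apply]
    · have : tuplePos N (args.map fun i => env.getD i 0) ≤ N ^ args.length := h₁.le
      change _ ≤ T N + (3 * N ^ args.length + 1 + (2 + (2 * N ^ args.length + 1)))
      omega
  | neg φ ih =>
    obtain ⟨T, hT, h⟩ := ih hφ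
    refine ⟨fun N => T N + 3, hT.add (.const 3), fun N hN ρ env S hS => ?_⟩
    refine (h N hN ρ env S hS).seq ?_
    simp only [FOFormula.Holds]
    by_cases hp : φ.Holds N ρ env
    · refine (Exec.iteTrue (by simp [hp, topTrue]) ((Exec.pop _ _).seq (Exec.push _ _ _))).of_eq
        ?_ le_rfl
      simp [hp]
    · refine (Exec.iteFalse (by simp [hp, topTrue]) ((Exec.pop _ _).seq (Exec.push _ _ _))).of_eq
        ?_ le_rfl
      simp [hp]
  | and φ ψ ih₁ ih₂ =>
    obtain ⟨T, hT, h⟩ := ih₁ hφ.1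
    obtain ⟨T', hT', h'⟩ := ih₂ hφ.2
    refine ⟨fun N => T N + (T' N + 4), hT.add (hT'.add (.const 4)), fun N hN ρ env S hS => ?_⟩
    refine (h N hN ρ env S hS).seq ((h' N hN ρ env _ (hS.update_res _)).seq ?_)
    simp only [FOFormula.Holds]
    by_cases hp : ψ.Holds N ρ env
    · refine (Exec.iteTrue (by simp [hp, topTrue]) (Exec.pop _ _)).of_eq ?_ (by omega)
      simp [hp]
    · refine (Exec.iteFalse (by simp [hp, topTrue]) ((Exec.pop _ _).seq ((Exec.pop _ _).seq
        (Exec.push _ _ _)))).of_eq ?_ (by omega)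
      simp [hp]
  | ex φ ih =>
    obtain ⟨T, hT, h⟩ := ih hφ
    refine ⟨fun N => 1 + ((5 * N + 2) + (N * ((1 + (T N + 4)) + 1) + 1)), ?_,
      fun N hN ρ env S hS => ?_⟩
    · exact (PolyBounded.const 1).add ((((PolyBounded.const 5).mul .id).add (.const 2)).add
        ((PolyBounded.id.mul (((PolyBounded.const 1).add (hT.add (.const 4))).add
        (.const 1))).add (.const 1)))
    -- The stack of the bound variable is also the loop counter, so the values are tried downwards
    -- from N - 1; with j of them left, the result tells whether some x ≥ j is a witness.
    let F : ℕ → StackStore := fun j =>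
      update (update S (varStack env.length) (List.replicate j true)) resStack
        (decide (∃ x, j ≤ x ∧ x < N ∧ φ.Holds N ρ (env ++ [x])) :: S resStack)
    have hv : S (varStack env.length) = [] := by rw [hS.var]; simp
    have e₂ : Exec (copyTo sizeStack tmpStack (varStack env.length))
        (update S resStack (false :: S resStack)) (F N) (5 * N + 2) := by
      refine (exec_copyTo (by decide) (by omega) (by omega) _ ?_).of_eq ?_ ?_
      · simpa using hS.tmp
      · have h0 : decide (∃ x, N ≤ x ∧ x < N ∧ φ.Holds N ρ (env ++ [x])) = false := by
          rw [decide_eq_false_iff_not]; rintro ⟨x, h1, h2, -⟩; omega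
        have := hS.size
        simp only [F, h0]
        funext i
        grind [update_apply]
      · simp [hS.size]
    have e₃ : Exec (.loop Option.isSome (varStack env.length) (.seq (.pop (varStack env.length)) <|
        .seq (evalFormula φ (env.length + 1))
        (.ite topTrue resStack (.seq (.pop resStack) (.seq (.pop resStack) (.push resStack true)))
          (.pop resStack)))) (F N) (F 0) (N * ((1 + (T N + 4)) + 1) + 1) := by
      refine Exec.loop_family F (fun j hj => ⟨?_, (Exec.pop _ _).seq ?_⟩) ?_
      · simp only [F]
        rw [update_of_ne (by omega), update_self]
        simp [List.replicate_succ]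
      · have hG : update (F (j + 1)) (varStack env.length)
            (F (j + 1) (varStack env.length)).tail =
            update (update S (varStack env.length) (List.replicate j true)) resStack
            (decide (∃ x, j + 1 ≤ x ∧ x < N ∧ φ.Holds N ρ (env ++ [x])) :: S resStack) := by
          have h3 : (List.replicate (j + 1) true).tail = List.replicate j true := by simp
          simp only [F]
          funext i
          grind [update_apply]
        rw [hG]
        have e := h N hN ρ (env ++ [j]) _ ((hS.update_var hj).update_res
          (decide (∃ x, j + 1 ≤ x ∧ x < N ∧ φ.Holds N ρ (env ++ [x])) :: S resStack))
        rw [List.length_append, List.length_singleton] at e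
        refine e.seq ?_
        by_cases hp : φ.Holds N ρ (env ++ [j])
        · have : ∃ x, j ≤ x ∧ x < N ∧ φ.Holds N ρ (env ++ [x]) := ⟨j, le_rfl, hj, hp⟩
          refine (Exec.iteTrue (by simp [hp, topTrue]) ((Exec.pop _ _).seq ((Exec.pop _ _).seq
            (Exec.push _ _ _)))).of_eq ?_ le_rfl
          simp [F, this]
        · have : (∃ x, j + 1 ≤ x ∧ x < N ∧ φ.Holds N ρ (env ++ [x])) ↔
              (∃ x, j ≤ x ∧ x < N ∧ φ.Holds N ρ (env ++ [x])) := by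
            constructor
            · rintro ⟨x, h1, h2, h3⟩
              exact ⟨x, by omega, h2, h3⟩
            · rintro ⟨x, h1, h2, h3⟩
              refine ⟨x, ?_, h2, h3⟩
              rcases Nat.lt_or_eq_of_le h1 with h | rfl
              · exact h
              · exact absurd h3 hp
          refine (Exec.iteFalse (by simp [hp, topTrue]) (Exec.pop _ _)).of_eq ?_ (by omega)
          simp only [F, update_self, update_idem, List.tail_cons, decide_eq_decide.2 this]
      · simp only [F]
        rw [update_of_ne (by omega), update_self]
        simp
    refine ((Exec.push resStack false S).seq (e₂.seq e₃)).of_eq ?_ le_rfl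
    have h1 : (∃ x, 0 ≤ x ∧ x < N ∧ φ.Holds N ρ (env ++ [x])) ↔ (FOFormula.ex φ).Holds N ρ env := by
      simp [FOFormula.Holds]
    simp only [F, h1]
    funext i
    grind [update_apply]

end StackProg

/-! ### Tables of relations -/

/-- The values of `f` on the tuples of length `k` over `0, …, N - 1` in lexicographic order. -/
def tupleTable (N : ℕ) : ℕ → (List ℕ → Bool) → List Bool
  | 0, f => [f []]
  | k + 1, f => (List.range N).flatMap fun i => tupleTable N k fun a => f (i :: a)

theorem length_tupleTable (N k : ℕ) (f : List ℕ → Bool) : (tupleTable N k f).length = N ^ k := by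
  induction k generalizing f with
  | zero => simp [tupleTable]
  | succ k ih => simp [tupleTable, List.length_flatMap, ih, pow_succ, mul_comm]

theorem getElem?_flatMap_range {α : Type*} {L M : ℕ} (g : ℕ → List α) (hg : ∀ i, (g i).length = L)
    {i j : ℕ} (hi : i < M) (hj : j < L) :
    ((List.range M).flatMap g)[i * L + j]? = (g i)[j]? := by
  induction M with
  | zero => omega
  | succ M ih =>
    have hlen : ((List.range M).flatMap g).length = M * L := by
      simp [List.length_flatMap, hg]
    rw [List.range_succ, List.flatMap_append]
    rcases Nat.lt_succ_iff_lt_or_eq.1 hi with h | rfl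
    · rw [List.getElem?_append_left, ih h]
      rw [hlen]
      have : (i + 1) * L ≤ M * L := Nat.mul_le_mul_right _ h
      linarith
    · rw [List.getElem?_append_right (by rw [hlen]; omega), hlen]
      simp

/-- A start value acts as an additional leading digit; this makes inductions on the first entry of a
tuple possible. -/
theorem foldl_tuplePos (N : ℕ) (args : List ℕ) (a : ℕ) :
    args.foldl (fun a x => a * N + x) a = a * N ^ args.length + tuplePos N args := by
  induction args generalizing a with
  | nil => simp [tuplePos]
  | cons x l ih =>
    rw [tuplePos, List.foldl_cons, List.foldl_cons, ih, ih (0 * N + x), List.length_cons]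
    ring

theorem tuplePos_lt {N : ℕ} {args : List ℕ} (h : ∀ x ∈ args, x < N) :
    tuplePos N args < N ^ args.length := by
  induction args with
  | nil => simp [tuplePos]
  | cons x l ih =>
    have h₁ := ih fun y hy => h y (List.mem_cons_of_mem _ hy)
    have h₂ : x < N := h x List.mem_cons_self
    rw [tuplePos, List.foldl_cons, foldl_tuplePos, List.length_cons, pow_succ]
    have : (x + 1) * N ^ l.length ≤ N * N ^ l.length := Nat.mul_le_mul_right _ h₂
    linarith

/-- Lexicographic order is the numerical order in base N: the block of the tuples that begin with x
starts at x times the block length. -/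
theorem getElem?_tupleTable {N k : ℕ} (f : List ℕ → Bool) {args : List ℕ} (hk : args.length = k)
    (h : ∀ x ∈ args, x < N) : (tupleTable N k f)[tuplePos N args]? = some (f args) := by
  induction args generalizing k f with
  | nil => subst hk; simp [tuplePos, tupleTable]
  | cons x l ih =>
    subst hk
    have h₁ : ∀ y ∈ l, y < N := fun y hy => h y (List.mem_cons_of_mem _ hy)
    rw [tuplePos, List.foldl_cons, foldl_tuplePos, List.length_cons, tupleTable]
    rw [show (0 * N + x) * N ^ l.length = x * N ^ l.length by ring,
      getElem?_flatMap_range _ (fun i => length_tupleTable N _ _) (h x List.mem_cons_self)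
        (tuplePos_lt h₁)]
    exact ih _ rfl h₁

/-! ### Programs that compute relations -/

/-- An instruction defines a relation by a formula, or by iterating a formula. -/
inductive RelInstr where
  | define (r : ℕ) (φ : FOFormula) : RelInstr
  | iterate (r : ℕ) (φ : FOFormula) : RelInstr

namespace FOFormula

/-- Disjunction. -/
def or (φ ψ : FOFormula) : FOFormula := .neg (.and (.neg φ) (.neg ψ))

/-- A formula that never holds. -/
def false : FOFormula := .lt 0 0

end FOFormula

namespace RelInstr

variable (ar : ℕ → ℕ) (N : ℕ)

/-- The relation that the instruction computes. -/
def target : RelInstr → ℕ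
  | define r _ => r
  | iterate r _ => r

/-- The formula of the instruction uses the relations with their arities. -/
def WF : RelInstr → Prop
  | define _ φ => φ.WF ar
  | iterate _ φ => φ.WF ar

/-- Replace the relation `r` by the one that `φ` defines. -/
def assign (r : ℕ) (φ : FOFormula) (ρ : RelStore) : RelStore :=
  update ρ r fun a => a.length = ar r ∧ (∀ x ∈ a, x < N) ∧ φ.Holds N ρ a

/-- The formula that adds to the relation `r` the tuples defined by `φ`. -/
def extend (r : ℕ) (φ : FOFormula) : FOFormula := .or (.rel r (List.range (ar r))) φ

/-- The effect of an instruction. An iteration runs through `N ^ k` stages, where `k` is the arity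
of the relation. -/
def apply : RelInstr → RelStore → RelStore
  | define r φ => assign ar N r φ
  | iterate r φ => fun ρ =>
    (assign ar N r (extend ar r φ))^[N ^ ar r] (assign ar N r .false ρ)

end RelInstr

/-! ### Stack programs for instructions. -/

namespace StackProg

theorem Represents.update_other {ar N ρ env S} (h : Represents ar N ρ env S) {k : ℕ}
    (hk : k = inputStack ∨ k = resStack ∨ k = outStack ∨ ∃ j, k = cntStack j) (l : List Bool) :
    Represents ar N ρ env (update S k l) where
  size := by rw [update_of_ne (by omega)]; exact h.size
  acc := by rw [update_of_ne (by omega)]; exact h.acc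
  aux := by rw [update_of_ne (by omega)]; exact h.aux
  tmp := by rw [update_of_ne (by omega)]; exact h.tmp
  var i := by rw [update_of_ne (by omega)]; exact h.var i
  env_lt := h.env_lt
  table r args := by rw [update_of_ne (by omega)]; exact h.table r args
  length_le r := by rw [update_of_ne (by omega)]; exact h.length_le r

/-- Evaluate the formula for all values of `k` further variables, and push the table of the truth
values. -/
def fillTable (φ : FOFormula) : ℕ → ℕ → StackProg
  | d, 0 => .seq (evalFormula φ d) (.mv resStack outStack)
  | d, k + 1 => .seq (copyTo sizeStack tmpStack (varStack d))
      (.loop Option.isSome (varStack d) (.seq (.pop (varStack d)) (fillTable φ (d + 1) k)))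

open Classical in
-- The loops run downwards and push each value in front of the earlier ones, so the table comes out
-- in increasing lexicographic order.
theorem exec_fillTable (ar : ℕ → ℕ) (φ : FOFormula) (hφ : φ.WF ar) (k : ℕ) :
    ∃ T, PolyBounded T ∧ ∀ N, 2 ≤ N → ∀ (ρ : RelStore) (env : List ℕ) (S : StackStore),
      Represents ar N ρ env S → Exec (fillTable φ env.length k) S
        (update S outStack
          ((tupleTable N k fun a => decide (φ.Holds N ρ (env ++ a))) ++ S outStack)) (T N) := by
  induction k with
  | zero =>
    obtain ⟨T, hT, h⟩ := exec_evalFormula ar φ hφ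
    refine ⟨fun N => T N + 1, hT.add (.const 1), fun N hN ρ env S hS => ?_⟩
    refine ((h N hN ρ env S hS).seq (Exec.mv (b := decide (φ.Holds N ρ env)) (l := S resStack)
      (by simp))).of_eq ?_ le_rfl
    simp only [tupleTable, List.append_nil]
    funext i
    grind [update_apply]
  | succ k ih =>
    obtain ⟨T, hT, h⟩ := ih
    refine ⟨fun N => (5 * N + 2) + (N * ((1 + T N) + 1) + 1), ?_, fun N hN ρ env S hS => ?_⟩
    · exact (((PolyBounded.const 5).mul .id).add (.const 2)).add
        ((PolyBounded.id.mul (((PolyBounded.const 1).add hT).add (.const 1))).add (.const 1))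
    let g : ℕ → List Bool := fun j => tupleTable N k fun a => decide (φ.Holds N ρ (env ++ j :: a))
    let F : ℕ → StackStore := fun j =>
      update (update S (varStack env.length) (List.replicate j true)) outStack
        ((List.range' j (N - j)).flatMap g ++ S outStack)
    have hv : S (varStack env.length) = [] := by rw [hS.var]; simp
    have e₁ : Exec (copyTo sizeStack tmpStack (varStack env.length)) S (F N) (5 * N + 2) := by
      refine (exec_copyTo (by decide) (by omega) (by omega) _ hS.tmp).of_eq ?_ ?_
      · have := hS.size
        simp only [F, Nat.sub_self, List.range'_zero, List.flatMap_nil, List.nil_append]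
        funext i
        grind [update_apply]
      · simp [hS.size]
    have e₂ : Exec (.loop Option.isSome (varStack env.length)
        (.seq (.pop (varStack env.length)) (fillTable φ (env.length + 1) k))) (F N) (F 0)
        (N * ((1 + T N) + 1) + 1) := by
      refine Exec.loop_family F (fun j hj => ⟨?_, (Exec.pop _ _).seq ?_⟩) ?_
      · simp only [F]
        rw [update_of_ne (by omega), update_self]
        simp [List.replicate_succ]
      · have hG : update (F (j + 1)) (varStack env.length)
            (F (j + 1) (varStack env.length)).tail =
            update (update S (varStack env.length) (List.replicate j true)) outStack
            ((List.range' (j + 1) (N - (j + 1))).flatMap g ++ S outStack) := by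
          have h3 : (List.replicate (j + 1) true).tail = List.replicate j true := by simp
          simp only [F]
          generalize (List.range' (j + 1) (N - (j + 1))).flatMap g ++ S outStack = l
          funext i
          grind [update_apply]
        rw [hG]
        have e := h N hN ρ (env ++ [j]) _ ((hS.update_var hj).update_other (k := outStack)
          (by simp) ((List.range' (j + 1) (N - (j + 1))).flatMap g ++ S outStack))
        rw [List.length_append, List.length_singleton] at e
        refine e.of_eq ?_ le_rfl
        have hr : N - j = N - (j + 1) + 1 := by omega
        simp only [F, hr, List.range'_succ, List.flatMap_cons, update_self, update_idem,
          List.append_assoc, List.singleton_append, g]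
      · simp only [F]
        rw [update_of_ne (by omega), update_self]
        simp
    refine (e₁.seq e₂).of_eq ?_ le_rfl
    simp only [F, tupleTable, List.range_eq_range', Nat.sub_zero, g, List.replicate_zero]
    rw [← hv, update_eq_self]

/-- Replace the table of the relation `r`, of arity `k`, by the one that the formula defines. -/
def assignTable (r k : ℕ) (φ : FOFormula) : StackProg :=
  .seq (fillTable φ 0 k) <| .seq (clear (relStack r)) <| .seq (transfer outStack tmpStack)
    (transfer tmpStack (relStack r))

/-- The old table is cleared only when the new one is complete, since `φ` may mention `r`. The new
table is transferred twice so that its order is restored. -/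
theorem exec_assignTable (ar : ℕ → ℕ) (r : ℕ) (φ : FOFormula) (hφ : φ.WF ar) :
    ∃ T, PolyBounded T ∧ ∀ N, 2 ≤ N → ∀ (ρ : RelStore) (S : StackStore),
      Represents ar N ρ [] S → S outStack = [] → ∃ l,
        Exec (assignTable r (ar r) φ) S (update S (relStack r) l) (T N) ∧
        Represents ar N (RelInstr.assign ar N r φ ρ) [] (update S (relStack r) l) := by
  classical
  obtain ⟨T, hT, h⟩ := exec_fillTable ar φ hφ (ar r)
  refine ⟨fun N => T N + ((2 * N ^ ar r + 1) + ((2 * N ^ ar r + 1) + (2 * N ^ ar r + 1))), ?_,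
    fun N hN ρ S hS ho => ?_⟩
  · have hc : PolyBounded fun N => 2 * N ^ ar r + 1 :=
      ((PolyBounded.const 2).mul (.pow _)).add (.const 1)
    exact hT.add (hc.add (hc.add hc))
  have e := h N hN ρ [] S hS
  obtain ⟨l, hl⟩ : ∃ l, l = tupleTable N (ar r) fun a => decide (φ.Holds N ρ a) := ⟨_, rfl⟩
  have hlen : l.length = N ^ ar r := by rw [hl, length_tupleTable]
  simp only [List.nil_append, List.length_nil, ho, List.append_nil, ← hl] at e
  refine ⟨l, ?_, ?_⟩
  · refine (e.seq (((exec_clear (relStack r) _).weaken ?_).seq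
      (((exec_transfer (by decide) _).weaken ?_).seq
      ((exec_transfer (by omega) _).weaken ?_)))).of_eq ?_ le_rfl
    · rw [update_of_ne (by omega)]
      have := hS.length_le r
      omega
    · rw [update_of_ne (by omega), update_self, hlen]
    · rw [update_self, update_of_ne (by omega), update_self, update_of_ne (by omega),
        update_of_ne (by omega), hS.tmp, List.append_nil, List.length_reverse, hlen]
    · have := hS.tmp
      clear e hl h hlen
      funext i
      grind [update_apply]
  · exact
    { size := by rw [update_of_ne (by omega)]; exact hS.size
      acc := by rw [update_of_ne (by omega)]; exact hS.acc
      aux := by rw [update_of_ne (by omega)]; exact hS.aux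
      tmp := by rw [update_of_ne (by omega)]; exact hS.tmp
      var := fun i => by rw [update_of_ne (by omega)]; exact hS.var i
      env_lt := hS.env_lt
      table := fun s args h₁ h₂ => by
        by_cases hs : s = r
        · subst hs
          rw [update_self, hl, List.getD_eq_getElem?_getD, getElem?_tupleTable _ h₁ h₂]
          simp only [RelInstr.assign, update_self, Option.getD_some, decide_eq_decide]
          exact ⟨fun h => ⟨h₁, h₂, h⟩, fun h => h.2.2⟩
        · rw [update_of_ne (by omega), hS.table s args h₁ h₂]
          simp [RelInstr.assign, hs]
      length_le := fun s => by
        by_cases hs : s = r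
        · subst hs
          rw [update_self, hlen]
        · rw [update_of_ne (by omega)]
          exact hS.length_le s }

/-- Run a program `N ^ k` times. -/
def repeatPow (c : StackProg) : ℕ → StackProg
  | 0 => c
  | k + 1 => .seq (copyTo sizeStack tmpStack (cntStack k))
      (.loop Option.isSome (cntStack k) (.seq (.pop (cntStack k)) (repeatPow c k)))

/-- The N ^ k repetitions are k nested loops of N rounds, each with its own counter, so a polynomial
bound stays polynomial. -/
theorem exec_repeatPow {ar : ℕ → ℕ} {c : StackProg} {r : ℕ} {f : ℕ → RelStore → RelStore}
    {T : ℕ → ℕ} (hT : PolyBounded T)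
    (h : ∀ N, 2 ≤ N → ∀ (ρ : RelStore) (S : StackStore),
      Represents ar N ρ [] S → S outStack = [] → ∃ l,
        Exec c S (update S (relStack r) l) (T N) ∧
        Represents ar N (f N ρ) [] (update S (relStack r) l)) (k : ℕ) :
    ∃ T, PolyBounded T ∧ ∀ N, 2 ≤ N → ∀ (ρ : RelStore) (S : StackStore),
      Represents ar N ρ [] S → S outStack = [] → (∀ j < k, S (cntStack j) = []) → ∃ l,
        Exec (repeatPow c k) S (update S (relStack r) l) (T N) ∧
        Represents ar N ((f N)^[N ^ k] ρ) [] (update S (relStack r) l) := by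
  induction k with
  | zero =>
    refine ⟨T, hT, fun N hN ρ S hS ho _ => ?_⟩
    simpa [repeatPow] using h N hN ρ S hS ho
  | succ k ih =>
    obtain ⟨T, hT, ih⟩ := ih
    refine ⟨fun N => (5 * N + 2) + (N * ((1 + T N) + 1) + 1), ?_, fun N hN ρ S hS ho hc => ?_⟩
    · exact (((PolyBounded.const 5).mul .id).add (.const 2)).add
        ((PolyBounded.id.mul (((PolyBounded.const 1).add hT).add (.const 1))).add (.const 1))
    have key : ∀ m (ρ : RelStore) (S : StackStore), Represents ar N ρ [] S → S outStack = [] →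
        (∀ j < k, S (cntStack j) = []) → S (cntStack k) = List.replicate m true → ∃ l,
        Exec (.loop Option.isSome (cntStack k) (.seq (.pop (cntStack k)) (repeatPow c k))) S
          (update (update S (cntStack k) []) (relStack r) l) (m * ((1 + T N) + 1) + 1) ∧
        Represents ar N ((f N)^[N ^ k * m] ρ) []
          (update (update S (cntStack k) []) (relStack r) l) := by
      intro m
      induction m with
      | zero =>
        intro ρ S hS ho hc hk
        have hu : update (update S (cntStack k) []) (relStack r) (S (relStack r)) = S := by
          funext i
          grind [update_apply]
        refine ⟨S (relStack r), ?_, ?_⟩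
        · rw [hu]
          exact (Exec.loopFalse (by simp [hk])).weaken (by omega)
        · rw [hu]
          simpa using hS
      | succ m ihm =>
        intro ρ S hS ho hc hk
        have hS₁ := hS.update_other (k := cntStack k) (Or.inr (Or.inr (Or.inr ⟨k, rfl⟩)))
          (S (cntStack k)).tail
        obtain ⟨l₁, e₁, hr₁⟩ := ih N hN ρ _ hS₁ (by rw [update_of_ne (by omega)]; exact ho)
          (fun j hj => by rw [update_of_ne (by omega)]; exact hc j hj)
        obtain ⟨l₂, e₂, hr₂⟩ := ihm _ _ hr₁
          (by rw [update_of_ne (by omega), update_of_ne (by omega)]; exact ho)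
          (fun j hj => by rw [update_of_ne (by omega), update_of_ne (by omega)]; exact hc j hj)
          (by rw [update_of_ne (by omega), update_self, hk]; simp)
        have hu : update (update (update (update S (cntStack k) (S (cntStack k)).tail)
            (relStack r) l₁) (cntStack k) []) (relStack r) l₂ =
            update (update S (cntStack k) []) (relStack r) l₂ := by
          clear e₁ hr₁ e₂ hr₂ hS₁ ihm ih h hc
          funext i
          grind [update_apply]
        rw [hu] at e₂ hr₂
        refine ⟨l₂, (Exec.loopTrue (by simp [hk, List.replicate_succ])
          ((Exec.pop (cntStack k) S).seq e₁) e₂).weaken (by ring_nf; omega), ?_⟩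
        rw [← iterate_add_apply] at hr₂
        exact hr₂
    have e₁ := exec_copyTo (x := sizeStack) (tmp := tmpStack) (a := cntStack k) (by decide)
      (by omega) (by omega) S hS.tmp
    rw [hS.size, List.length_replicate, hc k (Nat.lt_succ_self k), List.append_nil] at e₁
    obtain ⟨l, e₂, hr⟩ := key N ρ _
      (hS.update_other (k := cntStack k) (Or.inr (Or.inr (Or.inr ⟨k, rfl⟩)))
        (List.replicate N true))
      (by rw [update_of_ne (by omega)]; exact ho)
      (fun j hj => by rw [update_of_ne (by omega)]; exact hc j (by omega)) (update_self ..)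
    have hu : update (update S (cntStack k) (List.replicate N true)) (cntStack k) [] = S := by
      rw [update_idem, ← hc k (Nat.lt_succ_self k), update_eq_self]
    rw [hu] at e₂ hr
    exact ⟨l, e₁.seq e₂, by rw [pow_succ]; exact hr⟩

/-- The stack program of an instruction. -/
def ofInstr (ar : ℕ → ℕ) : RelInstr → StackProg
  | .define r φ => assignTable r (ar r) φ
  | .iterate r φ => .seq (assignTable r (ar r) .false)
      (repeatPow (assignTable r (ar r) (RelInstr.extend ar r φ)) (ar r))

theorem exec_ofInstr (ar : ℕ → ℕ) (I : RelInstr) (hI : I.WF ar) :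
    ∃ T, PolyBounded T ∧ ∀ N, 2 ≤ N → ∀ (ρ : RelStore) (S : StackStore),
      Represents ar N ρ [] S → S outStack = [] → (∀ j, S (cntStack j) = []) → ∃ l,
        Exec (ofInstr ar I) S (update S (relStack I.target) l) (T N) ∧
        Represents ar N (I.apply ar N ρ) [] (update S (relStack I.target) l) := by
  cases I with
  | define r φ =>
    obtain ⟨T, hT, h⟩ := exec_assignTable ar r φ hI
    exact ⟨T, hT, fun N hN ρ S hS ho _ => h N hN ρ S hS ho⟩
  | iterate r φ =>
    obtain ⟨T₁, hT₁, h₁⟩ := exec_assignTable ar r .false trivial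
    have hW : (RelInstr.extend ar r φ).WF ar := ⟨List.length_range, hI⟩
    obtain ⟨T₀, hT₀, h₀⟩ := exec_assignTable ar r _ hW
    obtain ⟨T₂, hT₂, h₂⟩ := exec_repeatPow hT₀ h₀ (ar r)
    refine ⟨fun N => T₁ N + T₂ N, hT₁.add hT₂, fun N hN ρ S hS ho hc => ?_⟩
    obtain ⟨l₁, e₁, hr₁⟩ := h₁ N hN ρ S hS ho
    obtain ⟨l₂, e₂, hr₂⟩ := h₂ N hN _ _ hr₁ (by rw [update_of_ne (by omega)]; exact ho)
      (fun j _ => by rw [update_of_ne (by omega)]; exact hc j)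
    rw [update_idem] at e₂ hr₂
    exact ⟨l₂, e₁.seq e₂, hr₂⟩

/-- The stack program of a list of instructions. -/
def ofInstrs (ar : ℕ → ℕ) : List RelInstr → StackProg
  | [] => .skip
  | I :: P => .seq (ofInstr ar I) (ofInstrs ar P)

theorem exec_ofInstrs (ar : ℕ → ℕ) (P : List RelInstr) (hP : ∀ I ∈ P, I.WF ar) :
    ∃ T, PolyBounded T ∧ ∀ N, 2 ≤ N → ∀ (ρ : RelStore) (S : StackStore),
      Represents ar N ρ [] S → S outStack = [] → (∀ j, S (cntStack j) = []) → ∃ S',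
        Exec (ofInstrs ar P) S S' (T N) ∧
        Represents ar N (P.foldl (fun ρ I => I.apply ar N ρ) ρ) [] S' ∧
        ∀ i, (∀ I ∈ P, i ≠ relStack I.target) → S' i = S i := by
  induction P with
  | nil => exact ⟨_, .const 1, fun N hN ρ S hS ho hc => ⟨S, .skip S, hS, fun _ _ => rfl⟩⟩
  | cons I P ih =>
    obtain ⟨T, hT, h⟩ := ih fun I hI => hP I (List.mem_cons_of_mem _ hI)
    obtain ⟨T₁, hT₁, h₁⟩ := exec_ofInstr ar I (hP I List.mem_cons_self)
    refine ⟨fun N => T₁ N + T N, hT₁.add hT, fun N hN ρ S hS ho hc => ?_⟩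
    obtain ⟨l, e₁, hr₁⟩ := h₁ N hN ρ S hS ho hc
    obtain ⟨S', e₂, hr₂, hS'⟩ := h N hN _ _ hr₁ (by rw [update_of_ne (by omega)]; exact ho)
      (fun j => by rw [update_of_ne (by omega)]; exact hc j)
    refine ⟨S', e₁.seq e₂, hr₂, fun i hi => ?_⟩
    rw [hS' i fun J hJ => hi J (List.mem_cons_of_mem _ hJ),
      update_of_ne (hi I List.mem_cons_self)]

end StackProg

/-! ### Fixed points -/

namespace RelInstr

theorem holds_extend {ar : ℕ → ℕ} {N r : ℕ} {φ : FOFormula} {ρ : RelStore} {a : List ℕ}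
    (ha : a.length = ar r) : (extend ar r φ).Holds N ρ a ↔ ρ r a ∨ φ.Holds N ρ a := by
  have : (List.range (ar r)).map (fun i => a.getD i 0) = a := by
    apply List.ext_getElem
    · simp [ha]
    · intro i h₁ h₂
      simp [List.getD_eq_getElem?_getD, h₂]
  simp only [extend, FOFormula.or, FOFormula.Holds, this]
  tauto

theorem apply_of_ne {ar : ℕ → ℕ} {N s : ℕ} {I : RelInstr} (ρ : RelStore) (h : s ≠ I.target) :
    I.apply ar N ρ s = ρ s := by
  cases I with
  | define r φ => exact update_of_ne h _ _
  | iterate r φ =>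
    have key : ∀ m (ρ : RelStore), (assign ar N r (extend ar r φ))^[m] ρ s = ρ s := by
      intro m
      induction m with
      | zero => intro ρ; rfl
      | succ m ih =>
        intro ρ
        rw [iterate_succ_apply, ih]
        exact update_of_ne h _ _
    refine (key _ _).trans ?_
    exact update_of_ne h _ _

theorem apply_define {ar : ℕ → ℕ} {N r : ℕ} {φ : FOFormula} {ρ : RelStore} {a : List ℕ}
    (ha : a.length = ar r) (haN : ∀ x ∈ a, x < N) :
    (define r φ).apply ar N ρ r a ↔ φ.Holds N ρ a := by
  simp only [apply, assign, update_self]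
  exact ⟨fun h => h.2.2, fun h => ⟨ha, haN, h⟩⟩

/-- The stages of an iteration. -/
def stage (ar : ℕ → ℕ) (N r : ℕ) (φ : FOFormula) (ρ : RelStore) (m : ℕ) : RelStore :=
  (assign ar N r (extend ar r φ))^[m] (assign ar N r .false ρ)

theorem stage_succ {ar : ℕ → ℕ} {N r : ℕ} {φ : FOFormula} {ρ : RelStore} {m : ℕ} {a : List ℕ} :
    stage ar N r φ ρ (m + 1) r a ↔ a.length = ar r ∧ (∀ x ∈ a, x < N) ∧
      (stage ar N r φ ρ m r a ∨ φ.Holds N (stage ar N r φ ρ m) a) := by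
  rw [stage, iterate_succ_apply', assign, update_self]
  constructor
  · rintro ⟨h₁, h₂, h₃⟩
    exact ⟨h₁, h₂, (holds_extend h₁).1 h₃⟩
  · rintro ⟨h₁, h₂, h₃⟩
    exact ⟨h₁, h₂, (holds_extend h₁).2 h₃⟩

/-- A stage is thus the original interpretation with some relation R in place of `r`, the form in
which the induction principle below speaks of stages. -/
theorem stage_eq_update (ar : ℕ → ℕ) (N r : ℕ) (φ : FOFormula) (ρ : RelStore) (m : ℕ) :
    stage ar N r φ ρ m = update ρ r (stage ar N r φ ρ m r) := by
  induction m with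
  | zero => simp [stage, assign]
  | succ m ih =>
    funext s
    by_cases hs : s = r
    · subst hs; simp
    · rw [update_of_ne hs, stage, iterate_succ_apply', assign, update_of_ne hs]
      have := congrFun ih s
      rwa [update_of_ne hs] at this

theorem not_stage_zero {ar : ℕ → ℕ} {N r : ℕ} {φ : FOFormula} {ρ : RelStore} {a : List ℕ} :
    ¬ stage ar N r φ ρ 0 r a := by
  simp [stage, assign, FOFormula.false, FOFormula.Holds]

theorem stage_valid {ar : ℕ → ℕ} {N r : ℕ} {φ : FOFormula} {ρ : RelStore} {m : ℕ} {a : List ℕ}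
    (h : stage ar N r φ ρ m r a) : a.length = ar r ∧ ∀ x ∈ a, x < N := by
  cases m with
  | zero => exact absurd h not_stage_zero
  | succ m => exact ⟨(stage_succ.1 h).1, (stage_succ.1 h).2.1⟩

/-- The tuples of length `k` over `0, …, N - 1`. -/
def tuples (N k : ℕ) : Finset (List ℕ) :=
  (Finset.univ : Finset (Fin k → Fin N)).image fun v => List.ofFn fun i => (v i : ℕ)

theorem mem_tuples {N k : ℕ} {a : List ℕ} : a ∈ tuples N k ↔ a.length = k ∧ ∀ x ∈ a, x < N := by
  simp only [tuples, Finset.mem_image, Finset.mem_univ, true_and]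
  constructor
  · rintro ⟨v, rfl⟩
    simp [List.mem_ofFn]
  · rintro ⟨rfl, h⟩
    exact ⟨fun i => ⟨a[i], h _ (List.getElem_mem _)⟩, by simp⟩

theorem card_tuples_le (N k : ℕ) : (tuples N k).card ≤ N ^ k :=
  Finset.card_image_le.trans (by simp)

/-- The result of an iteration is closed under the formula. -/
theorem apply_iterate_closed {ar : ℕ → ℕ} {N r : ℕ} {φ : FOFormula} {ρ : RelStore} {a : List ℕ}
    (ha : a.length = ar r) (haN : ∀ x ∈ a, x < N)
    (h : φ.Holds N ((iterate r φ).apply ar N ρ) a) : (iterate r φ).apply ar N ρ r a := by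
  classical
  change φ.Holds N (stage ar N r φ ρ (N ^ ar r)) a at h
  change stage ar N r φ ρ (N ^ ar r) r a
  let X : ℕ → Finset (List ℕ) := fun m => (tuples N (ar r)).filter (stage ar N r φ ρ m r)
  -- The stages increase, so until the first repetition every stage gains a tuple. After N ^ k
  -- stages there was a repetition, or all tuples are present; the result is closed in both cases.
  have key : ∀ m, (∃ i ≤ m, stage ar N r φ ρ (i + 1) = stage ar N r φ ρ i) ∨ m ≤ (X m).card := by
    intro m
    induction m with
    | zero => exact Or.inr (Nat.zero_le _)
    | succ m ih =>
      rcases ih with ⟨i, hi, h⟩ | h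
      · exact Or.inl ⟨i, by omega, h⟩
      by_cases hs : stage ar N r φ ρ (m + 1) = stage ar N r φ ρ m
      · exact Or.inl ⟨m, by omega, hs⟩
      right
      have hsub : X m ⊆ X (m + 1) := by
        intro b hb
        simp only [X, Finset.mem_filter, mem_tuples] at hb ⊢
        exact ⟨hb.1, stage_succ.2 ⟨hb.1.1, hb.1.2, Or.inl hb.2⟩⟩
      have hne : X m ≠ X (m + 1) := by
        intro he
        apply hs
        rw [stage_eq_update, stage_eq_update (m := m)]
        congr 1
        funext b
        have := congrArg (b ∈ ·) he
        simp only [X, Finset.mem_filter, mem_tuples] at this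
        apply propext
        constructor
        · intro hb
          exact (this.mpr ⟨stage_valid hb, hb⟩).2
        · intro hb
          exact (this.mp ⟨stage_valid hb, hb⟩).2
      have := Finset.card_lt_card (hsub.ssubset_of_ne hne)
      omega
  rcases key (N ^ ar r) with ⟨i, hi, he⟩ | hc
  · have hst : ∀ j, stage ar N r φ ρ (i + j) = stage ar N r φ ρ i := by
      intro j
      induction j with
      | zero => rfl
      | succ j ih =>
        have hs : ∀ m, stage ar N r φ ρ (m + 1) =
            assign ar N r (extend ar r φ) (stage ar N r φ ρ m) :=
          fun m => iterate_succ_apply' _ _ _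
        rw [← add_assoc, hs, ih, ← hs, he]
    obtain ⟨j, hj⟩ := Nat.exists_eq_add_of_le hi
    rw [hj, hst] at h ⊢
    rw [← he]
    exact stage_succ.2 ⟨ha, haN, Or.inr h⟩
  · have : X (N ^ ar r) = tuples N (ar r) :=
      Finset.eq_of_subset_of_card_le (Finset.filter_subset _ _)
        ((card_tuples_le _ _).trans hc)
    have hm : a ∈ X (N ^ ar r) := by rw [this]; exact mem_tuples.2 ⟨ha, haN⟩
    exact (Finset.mem_filter.1 hm).2

/-- Induction over the stages of an iteration. -/
theorem apply_iterate_induction {ar : ℕ → ℕ} {N r : ℕ} {φ : FOFormula} {ρ : RelStore}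
    (Q : List ℕ → Prop)
    (hQ : ∀ R : List ℕ → Prop, (∀ a, a.length = ar r → (∀ x ∈ a, x < N) → R a → Q a) →
      ∀ a, a.length = ar r → (∀ x ∈ a, x < N) → φ.Holds N (update ρ r R) a → Q a)
    {a : List ℕ} (h : (iterate r φ).apply ar N ρ r a) : Q a := by
  change stage ar N r φ ρ (N ^ ar r) r a at h
  generalize N ^ ar r = m at h
  induction m generalizing a with
  | zero => exact absurd h not_stage_zero
  | succ m ih =>
    obtain ⟨h₁, h₂, h₃ | h₃⟩ := stage_succ.1 h
    · exact ih h₃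
    · rw [stage_eq_update] at h₃
      exact hQ _ (fun b _ _ hb => ih hb) a h₁ h₂ h₃

end RelInstr

namespace StackProg

/-! ### The size of the structure -/

/-- Double the number in the stack `a`; `b` is used as an empty buffer. -/
def double (a b : ℕ) : StackProg :=
  .seq (.loop Option.isSome a (.seq (.pop a) (.seq (.push b true) (.push b true)))) (transfer b a)

theorem exec_double {a b : ℕ} (hab : a ≠ b) {S : StackStore} {m : ℕ}
    (ha : S a = List.replicate m true) (hb : S b = []) :
    Exec (double a b) S (update S a (List.replicate (2 * m) true)) (8 * m + 2) := by
  let F : ℕ → StackStore := fun j => update (update S a (List.replicate j true)) b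
    (List.replicate (2 * (m - j)) true)
  have hF : Exec (.loop Option.isSome a (.seq (.pop a) (.seq (.push b true) (.push b true))))
      (F m) (F 0) (4 * m + 1) := by
    refine (Exec.loop_family (T := 1 + (1 + 1)) F (fun j hj => ⟨?_, ?_⟩) ?_).weaken (by omega)
    · simp [F, hab, List.replicate_succ]
    · refine ((Exec.pop a _).seq ((Exec.push b true _).seq (Exec.push b true _))).of_eq ?_ le_rfl
      have h1 : 2 * (m - j) = 2 * (m - (j + 1)) + 1 + 1 := by omega
      have h2 : (List.replicate (j + 1) true).tail = List.replicate j true := by simp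
      simp only [F, h1, List.replicate_succ]
      funext i
      grind [update_apply]
    · simp [F, hab]
  have h₀ : F m = S := by
    simp only [F]
    funext i
    grind [update_apply]
  rw [h₀] at hF
  refine (hF.seq (exec_transfer hab.symm _)).of_eq ?_ ?_
  · simp only [F]
    funext i
    grind [update_apply]
  · simp [F]
    omega

/-- For an input that starts with `t` in unary as its second field, compute the size
`N = l * 2 ^ 2 ^ (t + 1)`, where `l` is the length of the input, and move the input to the table of
the relation `0`. -/
def setup : StackProg :=
  .seq (copyTo inputStack tmpStack sizeStack) <|
  .seq (.loop topTrue inputStack (.mv inputStack tmpStack)) <|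
  .seq (.mv inputStack tmpStack) <|
  .seq (.seq (.push accStack true) (.push accStack true)) <|
  .seq (.loop topTrue inputStack (.seq (.mv inputStack tmpStack) (double accStack auxStack))) <|
  .seq (.loop Option.isSome accStack (.seq (.pop accStack) (double sizeStack auxStack))) <|
  .seq (transfer inputStack tmpStack) (transfer tmpStack (relStack 0))

/-- The accumulator starts at 2 and is doubled once for each symbol of the unary t, which gives
2^(t+1); then the length of the input is doubled that many times. All intermediate numbers are at
most N, hence the polynomial bound. The input passes through the buffer and gets its order back on
the way to the table. -/
theorem exec_setup : ∃ T, PolyBounded T ∧ ∀ (n t N : ℕ) (x y : List Bool),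
    x = List.replicate n true ++ false :: (List.replicate t true ++ false :: y) →
    N = x.length * 2 ^ 2 ^ (t + 1) →
    Exec setup (update (fun _ => []) inputStack x)
      (update (update (fun _ => []) sizeStack (List.replicate N true)) (relStack 0) x) (T N) := by
  refine ⟨fun N => (5 * N + 2) + ((2 * N + 1) + (1 + (2 + ((N * (8 * N + 4) + 1) +
    ((N * (8 * N + 4) + 1) + ((2 * N + 1) + (2 * N + 1))))))), ?_, ?_⟩
  · have h₁ : PolyBounded fun N => 2 * N + 1 := ((PolyBounded.const 2).mul .id).add (.const 1)
    have h₂ : PolyBounded fun N => N * (8 * N + 4) + 1 :=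
      (PolyBounded.id.mul (((PolyBounded.const 8).mul .id).add (.const 4))).add (.const 1)
    exact (((PolyBounded.const 5).mul .id).add (.const 2)).add (h₁.add ((PolyBounded.const 1).add
      ((PolyBounded.const 2).add (h₂.add (h₂.add (h₁.add h₁))))))
  intro n t N x y hx hN
  have hpos : 0 < x.length := by simp [hx]
  have hxN : x.length ≤ N := by
    rw [hN]
    exact Nat.le_mul_of_pos_right _ (by positivity)
  have htN : 2 ^ (t + 1) ≤ N := by
    have h₁ : 2 ^ (t + 1) < 2 ^ 2 ^ (t + 1) := Nat.lt_two_pow_self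
    have h₂ : 2 ^ 2 ^ (t + 1) ≤ x.length * 2 ^ 2 ^ (t + 1) := Nat.le_mul_of_pos_left _ hpos
    omega
  have htN' : t ≤ N := (Nat.lt_two_pow_self (n := t + 1)).le.trans' (by omega) |>.trans htN
  have hlen : x.length = n + (t + y.length) + 2 := by simp [hx]; omega
  let Z : StackStore := fun _ => []
  let S₁ : StackStore := update (update Z inputStack x) sizeStack (List.replicate x.length true)
  have e₁ : Exec (copyTo inputStack tmpStack sizeStack) (update Z inputStack x) S₁ (5 * N + 2) := by
    refine (exec_copyTo (by decide) (by decide) (by decide) _ (by simp [Z])).of_eq ?_ ?_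
    · simp [S₁, Z]
    · simp; omega
  let S₂ : ℕ → StackStore := fun j => update (update S₁ inputStack (List.replicate j true ++
    false :: (List.replicate t true ++ false :: y))) tmpStack (List.replicate (n - j) true)
  have e₂ : Exec (.loop topTrue inputStack (.mv inputStack tmpStack)) (S₂ n) (S₂ 0)
      (2 * N + 1) := by
    refine (Exec.loop_family (T := 1) S₂ (fun j hj => ⟨?_, ?_⟩) ?_).weaken (by omega)
    · simp [S₂, topTrue, List.replicate_succ]
    · refine (Exec.mv (b := true) (l := List.replicate j true ++
        false :: (List.replicate t true ++ false :: y)) ?_).of_eq ?_ le_rfl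
      · simp [S₂, List.replicate_succ]
      · have : n - j = n - (j + 1) + 1 := by omega
        simp only [S₂, this, List.replicate_succ]
        funext i
        grind [update_apply]
    · simp [S₂, topTrue]
  have h₂ : S₂ n = S₁ := by
    simp only [S₂, ← hx, S₁, Z]
    funext i
    grind [update_apply]
  rw [h₂] at e₂
  let S₃ : StackStore := update (update S₁ inputStack (List.replicate t true ++ false :: y))
    tmpStack (false :: List.replicate n true)
  have e₃ : Exec (.mv inputStack tmpStack) (S₂ 0) S₃ 1 := by
    refine (Exec.mv (b := false) (l := List.replicate t true ++ false :: y) (by simp [S₂])).of_eq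
      ?_ le_rfl
    simp only [S₂, S₃, Nat.sub_zero]
    funext i
    grind [update_apply]
  let S₅ : ℕ → StackStore := fun j => update (update (update S₁ inputStack
    (List.replicate j true ++ false :: y)) tmpStack
    (List.replicate (t - j) true ++ false :: List.replicate n true)) accStack
    (List.replicate (2 ^ (t - j + 1)) true)
  have e₄ : Exec (.seq (.push accStack true) (.push accStack true)) S₃ (S₅ t) 2 := by
    refine ((Exec.push _ _ _).seq (Exec.push _ _ _)).of_eq ?_ le_rfl
    simp only [S₅, S₃, Nat.sub_self, S₁, Z, List.replicate_zero, List.nil_append, zero_add,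
      pow_one, List.replicate_succ]
    funext i
    grind [update_apply]
  have e₅ : Exec (.loop topTrue inputStack (.seq (.mv inputStack tmpStack)
      (double accStack auxStack))) (S₅ t) (S₅ 0) (N * (8 * N + 4) + 1) := by
    refine (Exec.loop_family (T := 1 + (8 * N + 2)) S₅ (fun j hj => ⟨?_, ?_⟩) ?_).weaken ?_
    · simp [S₅, topTrue, List.replicate_succ]
    · have hm : 2 ^ (t - (j + 1) + 1) ≤ N :=
        (Nat.pow_le_pow_right (by norm_num) (by omega)).trans htN
      refine ((Exec.mv (b := true) (l := List.replicate j true ++ false :: y) ?_).seq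
        ((exec_double (m := 2 ^ (t - (j + 1) + 1)) (by decide) ?_ ?_).weaken ?_)).of_eq ?_ le_rfl
      · simp [S₅, List.replicate_succ]
      · simp [S₅]
      · simp [S₅, S₁, Z]
      · omega
      · have h1 : t - j = t - (j + 1) + 1 := by omega
        have h2 : 2 * 2 ^ (t - (j + 1) + 1) = 2 ^ (t - (j + 1) + 1 + 1) := by ring
        rw [h2]
        simp only [S₅, h1]
        have h3 : List.replicate (t - (j + 1) + 1) true =
          true :: List.replicate (t - (j + 1)) true := List.replicate_succ
        rw [h3]
        generalize List.replicate (2 ^ (t - (j + 1) + 1 + 1)) true = l₁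
        generalize List.replicate (2 ^ (t - (j + 1) + 1)) true = l₂
        generalize List.replicate (t - (j + 1)) true = l₃
        funext i
        grind [update_apply]
    · simp [S₅, topTrue]
    · have : t * (1 + (8 * N + 2) + 1) ≤ N * (8 * N + 4) :=
        Nat.mul_le_mul htN' (by omega)
      omega
  let S₆ : ℕ → StackStore := fun j => update (update (update (update Z inputStack (false :: y))
    tmpStack (List.replicate t true ++ false :: List.replicate n true)) accStack
    (List.replicate j true)) sizeStack
    (List.replicate (x.length * 2 ^ (2 ^ (t + 1) - j)) true)
  have h₆ : S₅ 0 = S₆ (2 ^ (t + 1)) := by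
    simp only [S₅, S₆, S₁, Nat.sub_zero, Nat.sub_self, pow_zero, mul_one, List.replicate_zero,
      List.nil_append]
    generalize List.replicate (2 ^ (t + 1)) true = l
    funext i
    grind [update_apply]
  have e₆ : Exec (.loop Option.isSome accStack (.seq (.pop accStack) (double sizeStack auxStack)))
      (S₆ (2 ^ (t + 1))) (S₆ 0) (N * (8 * N + 4) + 1) := by
    refine (Exec.loop_family (T := 1 + (8 * N + 2)) S₆ (fun j hj => ⟨?_, ?_⟩) ?_).weaken ?_
    · simp [S₆, List.replicate_succ]
    · have hm : x.length * 2 ^ (2 ^ (t + 1) - (j + 1)) ≤ N := by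
        rw [hN]
        exact Nat.mul_le_mul_left _ (Nat.pow_le_pow_right (by norm_num) (by omega))
      refine ((Exec.pop _ _).seq ((exec_double
        (m := x.length * 2 ^ (2 ^ (t + 1) - (j + 1))) (by decide) ?_ ?_).weaken ?_)).of_eq ?_
        le_rfl
      · simp [S₆]
      · simp [S₆, Z]
      · omega
      · have h1 : 2 ^ (t + 1) - j = 2 ^ (t + 1) - (j + 1) + 1 := by omega
        have h2 : 2 * (x.length * 2 ^ (2 ^ (t + 1) - (j + 1))) =
          x.length * 2 ^ (2 ^ (t + 1) - j) := by rw [h1]; ring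
        have h3 : (List.replicate (j + 1) true).tail = List.replicate j true := by simp
        rw [h2]
        simp only [S₆]
        generalize List.replicate (x.length * 2 ^ (2 ^ (t + 1) - j)) true = l₁
        generalize List.replicate (x.length * 2 ^ (2 ^ (t + 1) - (j + 1))) true = l₂
        clear hj h1 h2 hm h₆ e₅ e₄ e₃ e₂ e₁ h₂
        funext i
        grind [update_apply]
    · simp [S₆]
    · have : 2 ^ (t + 1) * (1 + (8 * N + 2) + 1) ≤ N * (8 * N + 4) :=
        Nat.mul_le_mul htN (by omega)
      omega
  rw [← h₆] at e₆
  refine (e₁.seq (e₂.seq (e₃.seq (e₄.seq (e₅.seq (e₆.seq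
    (((exec_transfer (by decide) _).weaken ?_).seq
    ((exec_transfer (by decide) _).weaken ?_)))))))).of_eq ?_ le_rfl
  · simp [S₆]
    omega
  · simp [S₆]
    omega
  · have hr : ((false :: y).reverse ++ (List.replicate t true ++ false ::
        List.replicate n true)).reverse = x := by
      rw [hx]; simp
    simp only [S₆, Nat.sub_zero, ← hN]
    clear e₁ e₂ e₃ e₄ e₅ e₆ h₆ h₂ hlen htN htN' hxN hpos hN hx
    generalize List.replicate N true = l₁
    generalize false :: y = l₂ at *
    generalize List.replicate t true ++ false :: List.replicate n true = l₃ at *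
    subst hr
    funext i
    grind [update_apply]

/-! ### Machines for definable problems -/

/-- Empty the tables of the relations `0, …, m - 1`. -/
def clearTables : ℕ → StackProg
  | 0 => .skip
  | m + 1 => .seq (clear (relStack m)) (clearTables m)

theorem exec_clearTables (ar : ℕ → ℕ) (m : ℕ) : ∃ T, PolyBounded T ∧ ∀ (N : ℕ) (S : StackStore),
    (∀ r, (S (relStack r)).length ≤ N ^ ar r) → ∃ S', Exec (clearTables m) S S' (T N) ∧
      (∀ r < m, S' (relStack r) = []) ∧ ∀ i, (∀ r < m, i ≠ relStack r) → S' i = S i := by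
  induction m with
  | zero => exact ⟨_, .const 1, fun N S _ => ⟨S, .skip S, by simp, fun _ _ => rfl⟩⟩
  | succ m ih =>
    obtain ⟨T, hT, h⟩ := ih
    refine ⟨fun N => (2 * N ^ ar m + 1) + T N, (((PolyBounded.const 2).mul (.pow _)).add
      (.const 1)).add hT, fun N S hS => ?_⟩
    obtain ⟨S', e, h₁, h₂⟩ := h N (update S (relStack m) []) fun r => by
      by_cases hr : r = m
      · subst hr; simp
      · rw [update_of_ne (by omega)]; exact hS r
    refine ⟨S', ((exec_clear _ _).weaken (by have := hS m; omega)).seq e, fun r hr => ?_,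
      fun i hi => ?_⟩
    · rcases Nat.lt_succ_iff_lt_or_eq.1 hr with hr | rfl
      · exact h₁ r hr
      · rw [h₂ _ fun s hs => by omega, update_self]
    · rw [h₂ i fun r hr => hi r (by omega), update_of_ne (hi m (by omega))]

theorem topTrue_eq_getD (o : Option Bool) : topTrue o = o.getD false := by
  rcases o with _ | _ | _ <;> rfl

/-- The relations at the start: the relation `0` tells the positions of the ones of the input. -/
def inputRel (x : List Bool) : RelStore := fun r a => r = 0 ∧ x.getD (a.headD 0) false = true

/-- Compute the relations, and output whether the relation `r` of arity `0` holds. The relations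
have the indices `0, …, m - 1`. -/
def decider (ar : ℕ → ℕ) (P : List RelInstr) (m r : ℕ) : StackProg :=
  .seq setup <| .seq (ofInstrs ar P) <|
  .seq (.ite topTrue (relStack r) (.push inputStack true) (.push inputStack false)) <|
  .seq (clearTables m) (clear sizeStack)

open Classical in
-- The exponent depends on the program only. At the end everything but the answer must be empty;
-- variables, buffers and counters are again as at the start, so only the tables and the size have
-- to be cleared.
theorem exec_decider (ar : ℕ → ℕ) (P : List RelInstr) (hP : ∀ I ∈ P, I.WF ar) {m r : ℕ}
    (hm : 0 < m) (hPm : ∀ I ∈ P, I.target < m) (h0 : ar 0 = 1) (hr : ar r = 0) :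
    ∃ e, ∀ (n t N : ℕ) (x y : List Bool),
    x = List.replicate n true ++ false :: (List.replicate t true ++ false :: y) →
    N = x.length * 2 ^ 2 ^ (t + 1) →
    Exec (decider ar P m r) (update (fun _ => []) inputStack x) (update (fun _ => []) inputStack
      [decide (P.foldl (fun ρ I => I.apply ar N ρ) (inputRel x) r [])]) (N ^ e) := by
  obtain ⟨T₁, hT₁, h₁⟩ := exec_setup
  obtain ⟨T₂, hT₂, h₂⟩ := exec_ofInstrs ar P hP
  obtain ⟨T₃, hT₃, h₃⟩ := exec_clearTables ar m
  obtain ⟨e, he⟩ : PolyBounded fun N => T₁ N + (T₂ N + (2 + (T₃ N + (2 * N + 1)))) :=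
    hT₁.add (hT₂.add ((PolyBounded.const 2).add (hT₃.add (((PolyBounded.const 2).mul .id).add
      (.const 1)))))
  refine ⟨e, fun n t N x y hx hN => ?_⟩
  have hpos : 0 < x.length := by simp [hx]
  have hxN : x.length ≤ N := by
    rw [hN]
    exact Nat.le_mul_of_pos_right _ (by positivity)
  have hN2 : 2 ≤ N := by
    have : 2 ≤ x.length := by simp [hx]; omega
    omega
  have hS : Represents ar N (inputRel x) []
      (update (update (fun _ => []) sizeStack (List.replicate N true)) (relStack 0) x) :=
    { size := by simp
      acc := by simp
      aux := by simp
      tmp := by simp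
      var := fun i => by
        rw [update_of_ne (by omega), update_of_ne (by omega)]
        simp
      env_lt := by simp
      table := fun s args hs hlt => by
        by_cases h : s = 0
        · subst h
          obtain ⟨i, rfl⟩ := List.length_eq_one_iff.1 (hs.trans h0)
          simp [inputRel, tuplePos]
        · rw [update_of_ne (by omega), update_of_ne (by omega)]
          simp [inputRel, h]
      length_le := fun s => by
        by_cases h : s = 0
        · subst h
          simpa [h0] using hxN
        · rw [update_of_ne (by omega), update_of_ne (by omega)]
          simp }
  obtain ⟨S₂, e₂, hR, hS₂⟩ := h₂ N hN2 _ _ hS (by simp)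
    (fun j => by rw [update_of_ne (by omega), update_of_ne (by omega)])
  have ht := hR.table r [] (by simp [hr]) (by simp)
  obtain ⟨b, hb⟩ : ∃ b, b = decide (P.foldl (fun ρ I => I.apply ar N ρ) (inputRel x) r []) :=
    ⟨_, rfl⟩
  rw [← hb] at ht ⊢
  have hin : S₂ inputStack = [] := by
    rw [hS₂ _ fun I _ => by omega, update_of_ne (by omega), update_of_ne (by omega)]
  have e₃ : Exec (.ite topTrue (relStack r) (.push inputStack true) (.push inputStack false)) S₂
      (update S₂ inputStack [b]) 2 := by
    have ht' : (S₂ (relStack r)).head?.getD false = b := by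
      simpa [tuplePos, List.getD_eq_getElem?_getD, List.head?_eq_getElem?] using ht
    rw [← topTrue_eq_getD] at ht'
    cases b with
    | false => exact (Exec.iteFalse ht' (Exec.push _ _ _)).of_eq (by rw [hin]) le_rfl
    | true => exact (Exec.iteTrue ht' (Exec.push _ _ _)).of_eq (by rw [hin]) le_rfl
  obtain ⟨S₄, e₄, h₄, h₄'⟩ := h₃ N (update S₂ inputStack [b]) fun s => by
    rw [update_of_ne (by omega)]
    exact hR.length_le s
  refine ((h₁ n t N x y hx hN).seq (e₂.seq (e₃.seq (e₄.seq
    ((exec_clear sizeStack S₄).weaken ?_))))).of_eq ?_ (he N hN2)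
  · rw [h₄' _ fun s _ => by omega, update_of_ne (by decide), hR.size, List.length_replicate]
  · funext i
    by_cases hi : i = sizeStack
    · subst hi; simp
    rw [update_of_ne hi]
    by_cases hi' : ∃ s < m, i = relStack s
    · obtain ⟨s, hs, rfl⟩ := hi'
      rw [h₄ s hs, update_of_ne (by omega)]
    · have hi'' : ∀ s < m, i ≠ relStack s := fun s hs h => hi' ⟨s, hs, h⟩
      rw [h₄' i hi'']
      by_cases hi0 : i = inputStack
      · subst hi0; simp
      · rw [update_of_ne hi0, update_of_ne hi0, hS₂ i fun I hI => hi'' _ (hPm I hI),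
          update_of_ne (hi'' 0 hm), update_of_ne hi]

end StackProg

/-! ### A characterization of the games with a solution -/

namespace ReachSPGame

open GameArena

variable {V : Type*} {t : ℕ} (g : ReachSPGame V t)

/-- The colours of a vertex: `0` for the target of Player 0, and `i + 1` for the target `i`. -/
def colours (v : V) : Set ℕ :=
  {i | (i = 0 ∧ v ∈ g.target₀) ∨ ∃ j : Fin t, i = j + 1 ∧ v ∈ g.target j}

/-- Comparison of the payoffs that belong to sets of colours. -/
def PayLE (p q : Set ℕ) : Prop := ∀ i ≠ 0, i ∈ p → i ∈ q

/-- The payoff of `c` is smaller than that of some element of `W`. -/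
def Below (W : Set (Set ℕ)) (c : Set ℕ) : Prop := ∃ p ∈ W, PayLE c p ∧ ¬ PayLE p c

/-- Player 0 can force a visit to the target of Player 0 from `v` when `c` is the set of the colours
seen so far. -/
inductive Attr : V → Set ℕ → Prop where
  | base {v c} : 0 ∈ c → Attr v c
  | zero {v c u} : g.arena.owner v = 0 → (v, u) ∈ g.arena.E → Attr u (c ∪ g.colours u) → Attr v c
  | one {v c} : g.arena.owner v = 1 → (∀ u, (v, u) ∈ g.arena.E → Attr u (c ∪ g.colours u)) →
      Attr v c

/-- Player 1 can avoid the target of Player 0 with a payoff that is not below `W`. -/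
inductive Lose (W : Set (Set ℕ)) : V → Set ℕ → Prop where
  | base {v c} : ¬ g.Attr v c → ¬ Below W c → Lose W v c
  | zero {v c} : ¬ g.Attr v c → g.arena.owner v = 0 →
      (∀ u, (v, u) ∈ g.arena.E → Lose W u (c ∪ g.colours u)) → Lose W v c
  | one {v c u} : ¬ g.Attr v c → g.arena.owner v = 1 → (v, u) ∈ g.arena.E →
      Lose W u (c ∪ g.colours u) → Lose W v c

/-- Player 0 can allow plays with at least the payoffs in `S`, and ensure that all plays visit the
target of Player 0 or have a payoff below `W`. -/
inductive Good (W : Set (Set ℕ)) : V → Set ℕ → Set (Set ℕ) → Prop where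
  | leaf {v c S} : (∀ p ∈ S, PayLE p c) → ¬ g.Lose W v c → Good W v c S
  | zero {v c S u} : g.arena.owner v = 0 → (v, u) ∈ g.arena.E → Good W u (c ∪ g.colours u) S →
      Good W v c S
  | one {v c S} (F : V → Set (Set ℕ)) : g.arena.owner v = 1 →
      (∀ p ∈ S, ∃ u, (v, u) ∈ g.arena.E ∧ p ∈ F u) →
      (∀ u, (v, u) ∈ g.arena.E → F u ⊆ S) →
      (∀ u, (v, u) ∈ g.arena.E → Good W u (c ∪ g.colours u) (F u)) → Good W v c S

/-- The colours seen up to position `j` on a sequence, where `c` are those of position `0`. -/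
def seen (c : Set ℕ) (ρ : ℕ → V) : ℕ → Set ℕ
  | 0 => c
  | j + 1 => seen c ρ j ∪ g.colours (ρ (j + 1))

/-- Used to strip the first vertex of a play in inductions: its tail starts with the colours of the
second vertex already added. -/
theorem seen_shift (c : Set ℕ) (ρ : ℕ → V) (j : ℕ) :
    g.seen (c ∪ g.colours (ρ 1)) (fun k => ρ (k + 1)) j = g.seen c ρ (j + 1) := by
  induction j with
  | zero => rfl
  | succ j ih => rw [seen, ih]; rfl

theorem seen_congr {c : Set ℕ} {ρ ρ' : ℕ → V} {j : ℕ} (h : ∀ k ≤ j, ρ k = ρ' k) :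
    g.seen c ρ j = g.seen c ρ' j := by
  induction j with
  | zero => rfl
  | succ j ih => rw [seen, seen, ih fun k hk => h k (by omega), h (j + 1) le_rfl]

theorem mem_seen {ρ : ℕ → V} {i j : ℕ} :
    i ∈ g.seen (g.colours (ρ 0)) ρ j ↔ ∃ k ≤ j, i ∈ g.colours (ρ k) := by
  induction j with
  | zero => simp [seen]
  | succ j ih =>
    rw [seen, Set.mem_union, ih]
    constructor
    · rintro (⟨k, hk, h⟩ | h)
      · exact ⟨k, by omega, h⟩
      · exact ⟨j + 1, le_rfl, h⟩
    · rintro ⟨k, hk, h⟩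
      rcases Nat.le_succ_iff.1 hk with hk | rfl
      · exact Or.inl ⟨k, hk, h⟩
      · exact Or.inr h

/-! #### Strategies from an arbitrary vertex -/

/-- All moves follow edges. -/
def Legal (τ : List V → V) : Prop := ∀ (h : List V) (hne : h ≠ []), (h.getLast hne, τ h) ∈ g.arena.E

/-- The infinite paths from `v` that are consistent with `τ`. -/
def LocalPlay (τ : List V → V) (v : V) (ρ : ℕ → V) : Prop :=
  ρ 0 = v ∧ (∀ j, (ρ j, ρ (j + 1)) ∈ g.arena.E) ∧
    ∀ j, g.arena.owner (ρ j) = 0 → ρ (j + 1) = τ (pref ρ j)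

/-- Some successor of a vertex. -/
noncomputable def someSucc (v : V) : V := (g.arena.exists_succ v).choose

theorem someSucc_mem (v : V) : (v, g.someSucc v) ∈ g.arena.E := (g.arena.exists_succ v).choose_spec

/-- A strategy that moves to some successor. -/
noncomputable def anyMove (h : List V) : V :=
  g.someSucc (h.getLast?.getD g.arena.init)

theorem legal_anyMove : g.Legal g.anyMove := by
  intro h hne
  rw [anyMove, List.getLast?_eq_getLast_of_ne_nil hne]
  exact g.someSucc_mem _

theorem pref_ne_nil (ρ : ℕ → V) (j : ℕ) : pref ρ j ≠ [] := by simp [pref]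

theorem getLast_pref (ρ : ℕ → V) (j : ℕ) : (pref ρ j).getLast (pref_ne_nil ρ j) = ρ j := by
  simp [pref]

theorem pref_shift (ρ : ℕ → V) (j : ℕ) :
    pref ρ (j + 1) = ρ 0 :: pref (fun k => ρ (k + 1)) j := by
  simp [pref, List.range_succ_eq_map (n := j + 1), Function.comp_def]

theorem LocalPlay.shift {g : ReachSPGame V t} {τ τ' : List V → V} {v : V} {ρ : ℕ → V}
    (h : g.LocalPlay τ v ρ) (hτ : ∀ l, τ (v :: ρ 1 :: l) = τ' (ρ 1 :: l)) :
    g.LocalPlay τ' (ρ 1) fun k => ρ (k + 1) := by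
  refine ⟨rfl, fun j => h.2.1 (j + 1), fun j hj => ?_⟩
  change ρ (j + 1 + 1) = _
  rw [h.2.2 (j + 1) hj, pref_shift, h.1]
  cases j with
  | zero => exact hτ []
  | succ j => rw [pref_shift]; exact hτ _

/-- Prepend a vertex to a sequence. -/
def consSeq (v : V) (ρ : ℕ → V) : ℕ → V
  | 0 => v
  | k + 1 => ρ k

theorem LocalPlay.cons {g : ReachSPGame V t} {τ τ' : List V → V} {v u : V} {ρ : ℕ → V}
    (h : g.LocalPlay τ' u ρ) (hE : (v, u) ∈ g.arena.E) (h₀ : g.arena.owner v = 0 → u = τ [v])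
    (hτ : ∀ l, τ (v :: u :: l) = τ' (u :: l)) : g.LocalPlay τ v (consSeq v ρ) := by
  refine ⟨rfl, fun j => ?_, fun j hj => ?_⟩
  · cases j with
    | zero => change (v, ρ 0) ∈ _; rw [h.1]; exact hE
    | succ j => exact h.2.1 j
  · cases j with
    | zero => change ρ 0 = _; rw [h.1, h₀ hj]; rfl
    | succ j =>
      change ρ (j + 1) = _
      rw [h.2.2 j hj, pref_shift]
      change _ = τ (v :: pref ρ j)
      cases j with
      | zero => rw [show pref ρ 0 = [u] by simp [pref, h.1]]; exact (hτ []).symm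
      | succ j => rw [pref_shift, h.1]; exact (hτ _).symm

theorem exists_localPlay {τ : List V → V} (hτ : g.Legal τ) (v : V) : ∃ ρ, g.LocalPlay τ v ρ := by
  -- Restarting the arena in v makes the existence of outcomes available at an arbitrary vertex.
  let G : GameArena V := { g.arena with init := v }
  let σ₀ : G.Strategy 0 := ⟨τ, fun h u _ _ => by simpa using hτ (h ++ [u]) (by simp)⟩
  let σ₁ : G.Strategy 1 :=
    ⟨g.anyMove, fun h u _ _ => by simpa using g.legal_anyMove (h ++ [u]) (by simp)⟩
  obtain ⟨ρ, ⟨h₁, h₂, -⟩, -⟩ := existsUnique_isOutcome σ₀ σ₁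
  exact ⟨ρ, h₁.1, h₁.2, h₂⟩

/-- The strategy makes the move to u and then forgets the first vertex. Both directions are needed:
guarantees are inherited from the tails of its plays, and witness plays for `τ'` are lifted to it.
-/
theorem exists_legal_zero {v u : V} (hv : g.arena.owner v = 0) (hE : (v, u) ∈ g.arena.E)
    {τ' : List V → V} (hτ' : g.Legal τ') : ∃ τ, g.Legal τ ∧
      (∀ ρ, g.LocalPlay τ v ρ → ρ 1 = u ∧ g.LocalPlay τ' u fun k => ρ (k + 1)) ∧
      ∀ ρ, g.LocalPlay τ' u ρ → g.LocalPlay τ v (consSeq v ρ) := by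
  classical
  let τ : List V → V
    | [] => v
    | [w] => if w = v then u else g.someSucc w
    | _ :: w :: l => τ' (w :: l)
  have hu : τ [v] = u := if_pos rfl
  refine ⟨τ, ?_, fun ρ hρ => ?_, fun ρ hρ => hρ.cons hE (fun _ => hu.symm) fun _ => rfl⟩
  · intro h hne
    match h, hne with
    | [w], _ =>
      change (w, if w = v then u else g.someSucc w) ∈ _
      split_ifs with h
      · subst h; exact hE
      · exact g.someSucc_mem w
    | _ :: w :: l, _ => exact hτ' (w :: l) (by simp)
  · have h1 : ρ 1 = u := by
      rw [hρ.2.2 0 (by rw [hρ.1]; exact hv), ← hu]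
      simp [pref, hρ.1]
    exact ⟨h1, h1 ▸ hρ.shift fun l => rfl⟩

/-- Here the second vertex of the history, chosen by Player 1, selects the strategy that is followed
afterwards. -/
theorem exists_legal_one {v : V} (hv : g.arena.owner v = 1) {τ' : V → List V → V}
    (hτ' : ∀ u, g.Legal (τ' u)) : ∃ τ, g.Legal τ ∧
      (∀ ρ, g.LocalPlay τ v ρ → (v, ρ 1) ∈ g.arena.E ∧
        g.LocalPlay (τ' (ρ 1)) (ρ 1) fun k => ρ (k + 1)) ∧
      ∀ u, (v, u) ∈ g.arena.E → ∀ ρ, g.LocalPlay (τ' u) u ρ → g.LocalPlay τ v (consSeq v ρ) := by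
  let τ : List V → V
    | [] => v
    | [w] => g.someSucc w
    | _ :: w :: l => τ' w (w :: l)
  refine ⟨τ, ?_, fun ρ hρ => ⟨?_, hρ.shift fun l => rfl⟩, fun u hu ρ hρ => hρ.cons hu
    (fun h => absurd (h.symm.trans hv) (by decide)) fun _ => rfl⟩
  · intro h hne
    match h, hne with
    | [w], _ => exact g.someSucc_mem w
    | _ :: w :: l, _ => exact hτ' w (w :: l) (by simp)
  · have := hρ.2.1 0
    rwa [hρ.1] at this

theorem Attr.exists_strategy {g : ReachSPGame V t} {v : V} {c : Set ℕ} (h : g.Attr v c) :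
    ∃ τ, g.Legal τ ∧ ∀ ρ, g.LocalPlay τ v ρ → ∃ j, 0 ∈ g.seen c ρ j := by
  induction h with
  | base h => exact ⟨g.anyMove, g.legal_anyMove, fun ρ _ => ⟨0, h⟩⟩
  | @zero v c u hv hE _ ih =>
    obtain ⟨τ', hτ', h⟩ := ih
    obtain ⟨τ, hτ, h₁, -⟩ := g.exists_legal_zero hv hE hτ'
    refine ⟨τ, hτ, fun ρ hρ => ?_⟩
    obtain ⟨rfl, h₂⟩ := h₁ ρ hρ
    obtain ⟨j, hj⟩ := h _ h₂
    exact ⟨j + 1, by rwa [seen_shift] at hj⟩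
  | @one v c hv _ ih =>
    have : ∀ u, ∃ τ, g.Legal τ ∧ ((v, u) ∈ g.arena.E → ∀ ρ, g.LocalPlay τ u ρ →
        ∃ j, 0 ∈ g.seen (c ∪ g.colours u) ρ j) := by
      intro u
      by_cases hu : (v, u) ∈ g.arena.E
      · obtain ⟨τ, h₁, h₂⟩ := ih u hu
        exact ⟨τ, h₁, fun _ => h₂⟩
      · exact ⟨_, g.legal_anyMove, fun h => absurd h hu⟩
    choose τ' hτ' h using this
    obtain ⟨τ, hτ, h₁, -⟩ := g.exists_legal_one hv hτ'
    refine ⟨τ, hτ, fun ρ hρ => ?_⟩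
    obtain ⟨hE, h₂⟩ := h₁ ρ hρ
    obtain ⟨j, hj⟩ := h _ hE _ h₂
    exact ⟨j + 1, by rwa [seen_shift] at hj⟩

/-- The play visits the target of Player 0, or its payoff stays below `W`. -/
def Safe (W : Set (Set ℕ)) (c : Set ℕ) (ρ : ℕ → V) : Prop :=
  (∃ j, 0 ∈ g.seen c ρ j) ∨ ∀ j, Below W (g.seen c ρ j)

/-- Being below W passes to smaller sets of colours, so the additional first position imposes no
condition of its own. -/
theorem safe_of_shift {W : Set (Set ℕ)} {c : Set ℕ} {ρ : ℕ → V}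
    (h : g.Safe W (c ∪ g.colours (ρ 1)) fun k => ρ (k + 1)) : g.Safe W c ρ := by
  rcases h with ⟨j, hj⟩ | h
  · exact Or.inl ⟨j + 1, by rwa [seen_shift] at hj⟩
  · refine Or.inr fun j => ?_
    cases j with
    | succ j => have := h j; rwa [seen_shift] at this
    | zero =>
      obtain ⟨p, hp, h₁, h₂⟩ := h 0
      refine ⟨p, hp, fun i hi hc => h₁ i hi (Or.inl hc), fun h' => h₂ fun i hi hip => ?_⟩
      exact Or.inl (h' i hi hip)

open Classical in
/-- Stay outside of the losing states until the visit to the target of Player 0 can be forced. -/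
noncomputable def safeMove (W : Set (Set ℕ)) (τA : V → Set ℕ → List V → V) :
    Set ℕ → List V → V
  | _, [] => g.arena.init
  | c, [v] => if g.Attr v c then τA v c [v]
      else if h : ∃ u, (v, u) ∈ g.arena.E ∧ ¬ g.Lose W u (c ∪ g.colours u) then h.choose
      else g.someSucc v
  | c, v :: u :: l => if g.Attr v c then τA v c (v :: u :: l)
      else safeMove W τA (c ∪ g.colours u) (u :: l)

/-- Outside of `Lose` and `Attr` the colours are below W, and the play can be kept outside of
`Lose`: otherwise a constructor of `Lose` would apply to the present state. A play that enters
`Attr` is taken over by the attractor strategy, and any other play stays below W forever. -/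
theorem exists_strategy_of_not_lose {W : Set (Set ℕ)} {v : V} {c : Set ℕ} (h : ¬ g.Lose W v c) :
    ∃ τ, g.Legal τ ∧ ∀ ρ, g.LocalPlay τ v ρ → g.Safe W c ρ := by
  have hA : ∀ v c, ∃ τ, g.Legal τ ∧ (g.Attr v c → ∀ ρ, g.LocalPlay τ v ρ →
      ∃ j, 0 ∈ g.seen c ρ j) := by
    intro v c
    by_cases h : g.Attr v c
    · obtain ⟨τ, h₁, h₂⟩ := h.exists_strategy
      exact ⟨τ, h₁, fun _ => h₂⟩
    · exact ⟨_, g.legal_anyMove, fun h' => absurd h' h⟩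
  choose τA hτA hA using hA
  -- From a state in `Attr` on, the recursion in `safeMove` stops there and delegates every later
  -- move to `τA v c`.
  have hattr : ∀ {v c ρ}, g.Attr v c → g.LocalPlay (g.safeMove W τA c) v ρ →
      ∃ j, 0 ∈ g.seen c ρ j := by
    intro v c ρ hv hρ
    refine hA v c hv ρ ⟨hρ.1, hρ.2.1, fun j hj => ?_⟩
    rw [hρ.2.2 j hj]
    cases j with
    | zero => simp [pref, hρ.1, safeMove, hv]
    | succ j =>
      rw [pref_shift, hρ.1]
      cases j with
      | zero => simp [pref, safeMove, hv]
      | succ j => rw [pref_shift]; simp [safeMove, hv]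
  have hshift : ∀ {v c ρ}, ¬ g.Attr v c → g.LocalPlay (g.safeMove W τA c) v ρ →
      g.LocalPlay (g.safeMove W τA (c ∪ g.colours (ρ 1))) (ρ 1) fun k => ρ (k + 1) := by
    intro v c ρ hv hρ
    exact hρ.shift fun l => by simp [safeMove, hv]
  refine ⟨g.safeMove W τA c, ?_, fun ρ hρ => ?_⟩
  · have : ∀ (l : List V) (c : Set ℕ) (hne : l ≠ []),
        (l.getLast hne, g.safeMove W τA c l) ∈ g.arena.E := by
      intro l
      induction l with
      | nil => intro c hne; exact absurd rfl hne
      | cons v l ih =>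
        intro c hne
        cases l with
        | nil =>
          simp only [safeMove]
          split_ifs with h₁ h₂
          · exact hτA v c [v] hne
          · exact h₂.choose_spec.1
          · exact g.someSucc_mem v
        | cons u l =>
          simp only [safeMove]
          split_ifs with h₁
          · exact hτA v c _ hne
          · exact ih (c ∪ g.colours u) (by simp)
    exact fun l hne => this l c hne
  by_cases hex : ∃ j, g.Attr (ρ j) (g.seen c ρ j)
  · obtain ⟨j, hj⟩ := hex
    left
    clear h
    induction j generalizing v c ρ with
    | zero => exact hattr (hρ.1 ▸ hj) hρ
    | succ j ih =>
      by_cases hv : g.Attr v c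
      · exact hattr hv hρ
      · obtain ⟨k, hk⟩ := ih _ (hshift hv hρ) (by rw [seen_shift]; exact hj)
        exact ⟨k + 1, by rwa [seen_shift] at hk⟩
  · right
    intro j
    push Not at hex
    induction j generalizing v c ρ with
    | zero =>
      by_contra hb
      exact h (.base (hρ.1 ▸ hex 0) hb)
    | succ j ih =>
      have hv : ¬ g.Attr v c := hρ.1 ▸ hex 0
      rw [← seen_shift]
      refine ih ?_ _ (hshift hv hρ) fun k => by rw [seen_shift]; exact hex (k + 1)
      intro hl
      have hE : (v, ρ 1) ∈ g.arena.E := by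
        have := hρ.2.1 0
        rwa [hρ.1] at this
      rcases (by omega : g.arena.owner v = 0 ∨ g.arena.owner v = 1) with h0 | h1
      · have hu : ∃ u, (v, u) ∈ g.arena.E ∧ ¬ g.Lose W u (c ∪ g.colours u) := by
          by_contra hu
          push Not at hu
          exact h (.zero hv h0 hu)
        have h2 : ρ 1 = hu.choose := by
          rw [hρ.2.2 0 (by rw [hρ.1]; exact h0)]
          simp [pref, hρ.1, safeMove, hv, hu]
        rw [h2] at hl
        exact hu.choose_spec.2 hl
      · exact h (.one hv h1 hE hl)

/-- At a leaf all obligations are already met, so any play is a witness and only safety remains. At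
a vertex of Player 1 each obligation has its witness in a branch to which `F` assigns it. -/
theorem Good.exists_strategy {g : ReachSPGame V t} {W S : Set (Set ℕ)} {v : V} {c : Set ℕ}
    (h : g.Good W v c S) : ∃ τ, g.Legal τ ∧ (∀ ρ, g.LocalPlay τ v ρ → g.Safe W c ρ) ∧
      ∀ p ∈ S, ∃ ρ, g.LocalPlay τ v ρ ∧ ∃ j, PayLE p (g.seen c ρ j) := by
  induction h with
  | @leaf v c S hS hl =>
    obtain ⟨τ, hτ, h⟩ := g.exists_strategy_of_not_lose hl
    refine ⟨τ, hτ, h, fun p hp => ?_⟩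
    obtain ⟨ρ, hρ⟩ := g.exists_localPlay hτ v
    exact ⟨ρ, hρ, 0, hS p hp⟩
  | @zero v c S u hv hE _ ih =>
    obtain ⟨τ', hτ', h, h'⟩ := ih
    obtain ⟨τ, hτ, h₁, h₂⟩ := g.exists_legal_zero hv hE hτ'
    refine ⟨τ, hτ, fun ρ hρ => ?_, fun p hp => ?_⟩
    · obtain ⟨rfl, h₃⟩ := h₁ ρ hρ
      exact g.safe_of_shift (h _ h₃)
    · obtain ⟨ρ, hρ, j, hj⟩ := h' p hp
      refine ⟨_, h₂ ρ hρ, j + 1, ?_⟩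
      rw [← seen_shift]
      change PayLE p (g.seen (c ∪ g.colours (ρ 0)) ρ j)
      rwa [hρ.1]
  | @one v c S F hv hF hFS _ ih =>
    have : ∀ u, ∃ τ, g.Legal τ ∧ ((v, u) ∈ g.arena.E →
        (∀ ρ, g.LocalPlay τ u ρ → g.Safe W (c ∪ g.colours u) ρ) ∧
        ∀ p ∈ F u, ∃ ρ, g.LocalPlay τ u ρ ∧ ∃ j, PayLE p (g.seen (c ∪ g.colours u) ρ j)) := by
      intro u
      by_cases hu : (v, u) ∈ g.arena.E
      · obtain ⟨τ, h₁, h₂⟩ := ih u hu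
        exact ⟨τ, h₁, fun _ => h₂⟩
      · exact ⟨_, g.legal_anyMove, fun h => absurd h hu⟩
    choose τ' hτ' h using this
    obtain ⟨τ, hτ, h₁, h₂⟩ := g.exists_legal_one hv hτ'
    refine ⟨τ, hτ, fun ρ hρ => ?_, fun p hp => ?_⟩
    · obtain ⟨hE, h₃⟩ := h₁ ρ hρ
      exact g.safe_of_shift ((h _ hE).1 _ h₃)
    · obtain ⟨u, hu, hpu⟩ := hF p hp
      obtain ⟨ρ, hρ, j, hj⟩ := (h u hu).2 p hpu
      refine ⟨_, h₂ u hu ρ hρ, j + 1, ?_⟩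
      rw [← seen_shift]
      change PayLE p (g.seen (c ∪ g.colours (ρ 0)) ρ j)
      rwa [hρ.1]

/-! #### Payoffs -/

/-- The colours of all vertices of a sequence. -/
def allColours (ρ : ℕ → V) : Set ℕ := {i | ∃ k, i ∈ g.colours (ρ k)}

theorem le_of_mem_colours {v : V} {i : ℕ} (h : i ∈ g.colours v) : i ≤ t := by
  rcases h with ⟨rfl, -⟩ | ⟨j, rfl, -⟩ <;> omega

theorem succ_mem_colours {v : V} {i : Fin t} : (i : ℕ) + 1 ∈ g.colours v ↔ v ∈ g.target i := by
  constructor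
  · rintro (⟨h, -⟩ | ⟨j, h, hj⟩)
    · omega
    · have : i = j := by ext; omega
      exact this ▸ hj
  · intro h
    exact Or.inr ⟨i, rfl, h⟩

theorem zero_mem_colours {v : V} : 0 ∈ g.colours v ↔ v ∈ g.target₀ := by
  constructor
  · rintro (⟨-, h⟩ | ⟨j, h, -⟩)
    · exact h
    · omega
  · intro h
    exact Or.inl ⟨rfl, h⟩

theorem payoff_le_iff {ρ ρ' : ℕ → V} (h : g.arena.IsPlay ρ) (h' : g.arena.IsPlay ρ') :
    g.toSPGame.payoff ρ ≤ g.toSPGame.payoff ρ' ↔ PayLE (g.allColours ρ) (g.allColours ρ') := by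
  have key : ∀ {ρ} (_ : g.arena.IsPlay ρ) (i : Fin t),
      g.toSPGame.payoff ρ i = true ↔ (i : ℕ) + 1 ∈ g.allColours ρ := by
    intro ρ hρ i
    simp only [SPGame.payoff, decide_eq_true_eq, allColours, Set.mem_ofPred_eq, succ_mem_colours]
    exact ⟨fun h => h.2, fun h => ⟨hρ, h⟩⟩
  constructor
  · intro hle i hi hmem
    obtain ⟨k, hk⟩ := id hmem
    have hit := g.le_of_mem_colours hk
    obtain ⟨m, rfl⟩ := Nat.exists_eq_succ_of_ne_zero hi
    have := hle ⟨m, by omega⟩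
    rw [Bool.le_iff_imp] at this
    exact (key h' ⟨m, by omega⟩).1 (this ((key h ⟨m, by omega⟩).2 hmem))
  · intro hle i
    rw [Bool.le_iff_imp, key h, key h']
    exact hle _ (by omega)

/-- There are only the colours 0, …, t, so the maximum of positions where the occurring ones are
seen is finite. -/
theorem exists_payLE_seen (ρ : ℕ → V) :
    ∃ j, ∀ k ≥ j, g.allColours ρ ⊆ g.seen (g.colours (ρ 0)) ρ k := by
  have : ∀ i, ∃ j, i ∈ g.allColours ρ → i ∈ g.colours (ρ j) := by
    intro i
    by_cases h : i ∈ g.allColours ρ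
    · obtain ⟨j, hj⟩ := h
      exact ⟨j, fun _ => hj⟩
    · exact ⟨0, fun h' => absurd h' h⟩
  choose f hf using this
  refine ⟨(Finset.range (t + 1)).sup f, fun k hk i hi => g.mem_seen.2 ⟨f i, ?_, hf i hi⟩⟩
  obtain ⟨m, hm⟩ := id hi
  have := g.le_of_mem_colours hm
  exact (Finset.le_sup (f := f) (Finset.mem_range.2 (by omega))).trans hk

theorem seen_subset_allColours (ρ : ℕ → V) (j : ℕ) :
    g.seen (g.colours (ρ 0)) ρ j ⊆ g.allColours ρ := by
  intro i hi
  obtain ⟨k, -, hk⟩ := g.mem_seen.1 hi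
  exact ⟨k, hk⟩

/-- If a play is below W at all positions, it is so once all its colours have appeared. Then some p
in W strictly dominates its payoff, and so does the consistent play that witnesses p; hence the
payoff is not Pareto-optimal. -/
theorem hasSolution_of_good {W : Set (Set ℕ)}
    (h : g.Good W g.arena.init (g.colours g.arena.init) W) : g.toSPGame.HasSolution := by
  obtain ⟨τ, hτ, hsafe, hW⟩ := h.exists_strategy
  let σ₀ : g.arena.Strategy 0 :=
    ⟨τ, fun h u _ _ => by simpa using hτ (h ++ [u]) (by simp)⟩
  refine ⟨σ₀, fun σ₁ ρ hρ hpar => ?_⟩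
  obtain ⟨hplay, hcons, -⟩ := hρ
  have hρ0 : ρ 0 = g.arena.init := hplay.1
  rcases hsafe ρ ⟨hplay.1, hplay.2, hcons⟩ with ⟨j, hj⟩ | hb
  · rw [← hρ0, mem_seen] at hj
    obtain ⟨k, -, hk⟩ := hj
    exact ⟨hplay, k, g.zero_mem_colours.1 hk⟩
  · exfalso
    obtain ⟨j, hj⟩ := g.exists_payLE_seen ρ
    obtain ⟨p, hp, h₁, h₂⟩ := hb j
    rw [← hρ0] at h₁ h₂
    obtain ⟨ρ', hρ', k, hk⟩ := hW p hp
    rw [← hρ'.1] at hk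
    have hplay' : g.arena.IsPlay ρ' := ⟨hρ'.1, hρ'.2.1⟩
    have hle : g.toSPGame.payoff ρ ≤ g.toSPGame.payoff ρ' :=
      (g.payoff_le_iff hplay hplay').2 fun i hi hm =>
        g.seen_subset_allColours ρ' k (hk i hi (h₁ i hi (hj j le_rfl hm)))
    have hge := hpar.2 ⟨ρ', ⟨hplay', hρ'.2.2⟩, rfl⟩ hle
    rw [g.payoff_le_iff hplay' hplay] at hge
    exact h₂ fun i hi hm => hj j le_rfl (hge i hi (g.seen_subset_allColours ρ' k (hk i hi hm)))

/-! #### From solutions to good sets of payoffs -/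

section Completeness

variable {g}

/-- Player 1 copies `ρ` on its prefixes at positions before j and uses `β` on all other histories.
From position j on, histories are too long for the first case. -/
theorem exists_isOutcome_extend {σ₀ : g.arena.Strategy 0} {ρ : ℕ → V} (hρ : ρ ∈ σ₀.plays) (j : ℕ)
    {β : List V → V} (hβ : g.Legal β) : ∃ (σ₁ : g.arena.Strategy 1) (ρ' : ℕ → V),
      IsOutcome σ₀ σ₁ ρ' ∧ (∀ k ≤ j, ρ' k = ρ k) ∧
      ∀ k ≥ j, g.arena.owner (ρ' k) = 1 → ρ' (k + 1) = β (pref ρ' k) := by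
  classical
  let σ₁ : g.arena.Strategy 1 :=
    { move := fun h => if ∃ k < j, h = pref ρ k then ρ h.length else β h
      legal := fun h v _ _ => by
        split_ifs with hk
        · obtain ⟨k, -, hk⟩ := hk
          have hv : v = ρ k := by
            have := congrArg List.getLast? hk
            rw [List.getLast?_eq_getLast_of_ne_nil (pref_ne_nil ρ k), getLast_pref] at this
            simpa using this
          have hlen : (h ++ [v]).length = k + 1 := by rw [hk]; simp [pref]
          rw [hlen, hv]
          exact hρ.1.2 k
        · simpa using hβ (h ++ [v]) (by simp) }
  obtain ⟨ρ', hρ', -⟩ := existsUnique_isOutcome σ₀ σ₁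
  have hlen : ∀ (ρ : ℕ → V) k, (pref ρ k).length = k + 1 := fun ρ k => by simp [pref]
  have key : ∀ k ≤ j, pref ρ' k = pref ρ k ∧ ρ' k = ρ k := by
    intro k
    induction k with
    | zero =>
      intro _
      have : ρ' 0 = ρ 0 := hρ'.1.1.trans hρ.1.1.symm
      exact ⟨by simp [pref, this], this⟩
    | succ k ih =>
      intro hk
      obtain ⟨ih₁, ih₂⟩ := ih (by omega)
      have hs : ρ' (k + 1) = ρ (k + 1) := by
        rcases (by omega : g.arena.owner (ρ k) = 0 ∨ g.arena.owner (ρ k) = 1) with h0 | h1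
        · rw [hρ'.2.1 k (by rw [ih₂]; exact h0), hρ.2 k h0, ih₁]
        · rw [hρ'.2.2 k (by rw [ih₂]; exact h1), ih₁]
          change (if ∃ m < j, pref ρ k = pref ρ m then ρ (pref ρ k).length else _) = _
          rw [if_pos ⟨k, by omega, rfl⟩, hlen]
      exact ⟨by rw [pref_succ, pref_succ, ih₁, hs], hs⟩
  refine ⟨σ₁, ρ', hρ', fun k hk => (key k hk).2, fun k hk h1 => ?_⟩
  rw [hρ'.2.2 k h1]
  change (if ∃ m < j, pref ρ' k = pref ρ m then _ else β (pref ρ' k)) = _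
  rw [if_neg]
  rintro ⟨m, hm, he⟩
  have := congrArg List.length he
  rw [hlen, hlen] at this
  omega

theorem exists_play_extend {σ₀ : g.arena.Strategy 0} {ρ : ℕ → V} (hρ : ρ ∈ σ₀.plays) {j : ℕ}
    (h1 : g.arena.owner (ρ j) = 1) {u : V} (hu : (ρ j, u) ∈ g.arena.E) :
    ∃ ρ' ∈ σ₀.plays, (∀ k ≤ j, ρ' k = ρ k) ∧ ρ' (j + 1) = u := by
  classical
  let β : List V → V := fun h => if h.getLast? = some (ρ j) then u else g.anyMove h
  have hβ : g.Legal β := by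
    intro h hne
    simp only [β]
    split_ifs with hl
    · rw [List.getLast?_eq_getLast_of_ne_nil hne] at hl
      rw [Option.some.inj hl]
      exact hu
    · exact g.legal_anyMove h hne
  obtain ⟨σ₁, ρ', hρ', h₁, h₂⟩ := exists_isOutcome_extend hρ j hβ
  refine ⟨ρ', ⟨hρ'.1, hρ'.2.1⟩, h₁, ?_⟩
  rw [h₂ j le_rfl (by rw [h₁ j le_rfl]; exact h1)]
  simp only [β]
  rw [if_pos]
  rw [List.getLast?_eq_getLast_of_ne_nil (pref_ne_nil ρ' j), getLast_pref, h₁ j le_rfl]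

/-- The complement of `Attr` is a trap for Player 0: no move of Player 0 leaves it, and Player 1
always has a move that stays inside. The seen colours are recomputed from the history. -/
theorem exists_isOutcome_avoid {σ₀ : g.arena.Strategy 0} {ρ : ℕ → V} (hρ : ρ ∈ σ₀.plays) {j : ℕ}
    (hA : ¬ g.Attr (ρ j) (g.seen (g.colours (ρ 0)) ρ j)) :
    ∃ (σ₁ : g.arena.Strategy 1) (ρ' : ℕ → V), IsOutcome σ₀ σ₁ ρ' ∧ (∀ k ≤ j, ρ' k = ρ k) ∧
      0 ∉ g.allColours ρ' := by
  classical
  let cs : List V → Set ℕ := fun h => {i | ∃ v ∈ h, i ∈ g.colours v}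
  have hcs : ∀ (ρ : ℕ → V) k, cs (pref ρ k) = g.seen (g.colours (ρ 0)) ρ k := by
    intro ρ k
    ext i
    rw [mem_seen]
    simp only [cs, pref, Set.mem_ofPred_eq, List.mem_map, List.mem_range]
    constructor
    · rintro ⟨_, ⟨m, hm, rfl⟩, h⟩
      exact ⟨m, by omega, h⟩
    · rintro ⟨m, hm, h⟩
      exact ⟨_, ⟨m, by omega, rfl⟩, h⟩
  let β : List V → V := fun h =>
    if hx : ∃ u, (∃ v, h.getLast? = some v ∧ (v, u) ∈ g.arena.E) ∧
      ¬ g.Attr u (cs h ∪ g.colours u) then hx.choose else g.anyMove h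
  have hβ : g.Legal β := by
    intro h hne
    simp only [β]
    split_ifs with hx
    · obtain ⟨⟨v, hv, hE⟩, -⟩ := hx.choose_spec
      rw [List.getLast?_eq_getLast_of_ne_nil hne] at hv
      rw [Option.some.inj hv]
      exact hE
    · exact g.legal_anyMove h hne
  obtain ⟨σ₁, ρ', hρ', h₁, h₂⟩ := exists_isOutcome_extend hρ j hβ
  have hstep : ∀ d, ¬ g.Attr (ρ' (j + d)) (g.seen (g.colours (ρ' 0)) ρ' (j + d)) := by
    intro d
    induction d with
    | zero =>
      rw [add_zero, g.seen_congr h₁, h₁ j le_rfl, h₁ 0 (Nat.zero_le _)]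
      exact hA
    | succ d ih =>
      rw [← add_assoc]
      have hE := hρ'.1.2 (j + d)
      rcases (by omega : g.arena.owner (ρ' (j + d)) = 0 ∨ g.arena.owner (ρ' (j + d)) = 1) with
        h0 | h1
      · exact fun h => ih (.zero h0 hE h)
      · have hx : ∃ u, (∃ v, (pref ρ' (j + d)).getLast? = some v ∧ (v, u) ∈ g.arena.E) ∧
            ¬ g.Attr u (cs (pref ρ' (j + d)) ∪ g.colours u) := by
          by_contra hx
          push Not at hx
          refine ih (.one h1 fun u hu => ?_)
          rw [← hcs]
          refine hx u ⟨_, ?_, hu⟩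
          rw [List.getLast?_eq_getLast_of_ne_nil (pref_ne_nil _ _), getLast_pref]
        have hb := h₂ (j + d) (by omega) h1
        simp only [β] at hb
        rw [dif_pos hx] at hb
        have := hx.choose_spec.2
        rw [← hb, hcs] at this
        exact this
  refine ⟨σ₁, ρ', hρ', h₁, ?_⟩
  rintro ⟨k, hk⟩
  exact hstep k (.base (g.mem_seen.2 ⟨k, by omega, hk⟩))

/-- The sets of colours of the plays that are consistent with a strategy. -/
def outcomes (σ₀ : g.arena.Strategy 0) : Set (Set ℕ) := {p | ∃ ρ ∈ σ₀.plays, p = g.allColours ρ}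

/-- Player 1 can follow the derivation of `Lose` to a base state and then avoid T₀ forever. As σ₀ is
a solution, the resulting play is not Pareto-optimal, so some consistent play has a strictly greater
payoff. Its colour set lies in `outcomes σ₀` and shows that c was below it, a contradiction. -/
theorem not_lose_of_isSolution {σ₀ : g.arena.Strategy 0} (h : g.toSPGame.IsSolution σ₀) {v : V}
    {c : Set ℕ} (hl : g.Lose (outcomes σ₀) v c) : ∀ ρ ∈ σ₀.plays, ∀ j, ρ j = v →
      g.seen (g.colours (ρ 0)) ρ j = c → False := by
  induction hl with
  | @base v c hA hb =>
    rintro ρ hρ j rfl rfl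
    obtain ⟨σ₁, ρ', hout, hag, h0⟩ := exists_isOutcome_avoid hρ hA
    have hmem : ρ' ∈ σ₀.plays := ⟨hout.1, hout.2.1⟩
    have hnp : g.toSPGame.payoff ρ' ∉ g.toSPGame.paretoSet σ₀ := by
      intro hp
      obtain ⟨-, k, hk⟩ := h σ₁ ρ' hout hp
      exact h0 ⟨k, g.zero_mem_colours.2 hk⟩
    have : ∃ ρ'' ∈ σ₀.plays, g.toSPGame.payoff ρ' ≤ g.toSPGame.payoff ρ'' ∧
        ¬ g.toSPGame.payoff ρ'' ≤ g.toSPGame.payoff ρ' := by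
      by_contra hx
      push Not at hx
      refine hnp ⟨⟨ρ', hmem, rfl⟩, ?_⟩
      rintro _ ⟨ρ'', hρ'', rfl⟩ hle
      exact hx ρ'' hρ'' hle
    obtain ⟨ρ'', hρ'', h₁, h₂⟩ := this
    rw [g.payoff_le_iff hmem.1 hρ''.1] at h₁
    rw [g.payoff_le_iff hρ''.1 hmem.1] at h₂
    have hsub : g.seen (g.colours (ρ 0)) ρ j ⊆ g.allColours ρ' := by
      rw [← hag 0 (Nat.zero_le _), ← g.seen_congr hag]
      exact g.seen_subset_allColours ρ' j
    exact hb ⟨_, ⟨ρ'', hρ'', rfl⟩, fun i hi hm => h₁ i hi (hsub hm),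
      fun hle => h₂ fun i hi hm => hsub (hle i hi hm)⟩
  | @zero v c hA hv _ ih =>
    rintro ρ hρ j rfl rfl
    exact ih _ (hρ.1.2 j) ρ hρ (j + 1) rfl rfl
  | @one v c u hA hv hE _ ih =>
    rintro ρ hρ j rfl rfl
    obtain ⟨ρ', hρ', hag, hu⟩ := exists_play_extend hρ hv hE
    refine ih ρ' hρ' (j + 1) hu ?_
    rw [seen, g.seen_congr hag, hu, hag 0 (Nat.zero_le _)]

theorem finite_outcomes (σ₀ : g.arena.Strategy 0) : (outcomes σ₀).Finite := by
  refine (Set.finite_Iic t).finite_subsets.subset ?_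
  rintro _ ⟨ρ, -, rfl⟩ i ⟨k, hk⟩
  exact g.le_of_mem_colours hk

/-- Every outcome p gets a witness play `w p`. There are finitely many outcomes, so by some position
J all witnesses have shown all their colours. Backwards from J, the obligations at a history are the
outcomes whose witnesses agree with this history; at J they are all covered, and
`not_lose_of_isSolution` provides the leaf. -/
theorem good_outcomes {σ₀ : g.arena.Strategy 0} (h : g.toSPGame.IsSolution σ₀) :
    g.Good (outcomes σ₀) g.arena.init (g.colours g.arena.init) (outcomes σ₀) := by
  have hw : ∀ p, ∃ ρ, p ∈ outcomes σ₀ → ρ ∈ σ₀.plays ∧ p = g.allColours ρ := by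
    intro p
    by_cases hp : p ∈ outcomes σ₀
    · obtain ⟨ρ, hρ⟩ := hp
      exact ⟨ρ, fun _ => hρ⟩
    · exact ⟨fun _ => g.arena.init, fun h => absurd h hp⟩
  choose w hw using hw
  have hJ : ∃ J, ∀ p ∈ outcomes σ₀, p ⊆ g.seen (g.colours (w p 0)) (w p) J := by
    have : ∀ p, ∃ j, ∀ k ≥ j, g.allColours (w p) ⊆ g.seen (g.colours (w p 0)) (w p) k :=
      fun p => g.exists_payLE_seen (w p)
    choose f hf using this
    refine ⟨(finite_outcomes σ₀).toFinset.sup f, fun p hp => ?_⟩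
    have := hf p _ (Finset.le_sup (f := f) ((finite_outcomes σ₀).mem_toFinset.2 hp))
    rwa [← (hw p hp).2] at this
  obtain ⟨J, hJ⟩ := hJ
  have key : ∀ d j, j + d = J → ∀ ρ ∈ σ₀.plays,
      g.Good (outcomes σ₀) (ρ j) (g.seen (g.colours (ρ 0)) ρ j)
        {p | p ∈ outcomes σ₀ ∧ ∀ k ≤ j, w p k = ρ k} := by
    intro d
    induction d with
    | zero =>
      rintro j rfl ρ hρ
      refine .leaf ?_ fun hl => not_lose_of_isSolution h hl ρ hρ j rfl rfl
      rintro p ⟨hp, hag⟩ i - hi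
      have := hJ p hp hi
      rwa [add_zero, g.seen_congr hag, hag 0 (Nat.zero_le _)] at this
    | succ d ih =>
      intro j hj ρ hρ
      rcases (by omega : g.arena.owner (ρ j) = 0 ∨ g.arena.owner (ρ j) = 1) with h0 | h1
      · refine .zero h0 (hρ.1.2 j) ?_
        -- The move of σ₀ is determined by the common history, so no witness departs from `ρ` here.
        have he : {p | p ∈ outcomes σ₀ ∧ ∀ k ≤ j, w p k = ρ k} =
            {p | p ∈ outcomes σ₀ ∧ ∀ k ≤ j + 1, w p k = ρ k} := by
          ext p
          constructor
          · rintro ⟨hp, hag⟩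
            refine ⟨hp, fun k hk => ?_⟩
            rcases Nat.le_succ_iff.1 hk with hk | rfl
            · exact hag k hk
            · have hpr : pref (w p) j = pref ρ j := by
                simp only [pref]
                exact List.map_congr_left fun k hk => hag k (by
                  have := List.mem_range.1 hk
                  omega)
              rw [(hw p hp).1.2 j (by rw [hag j le_rfl]; exact h0), hρ.2 j h0, hpr]
          · rintro ⟨hp, hag⟩
            exact ⟨hp, fun k hk => hag k (by omega)⟩
        rw [he]
        exact ih (j + 1) (by omega) ρ hρ
      -- The obligations are sorted by the next vertex of their witnesses.
      · refine .one (fun u => {p | (p ∈ outcomes σ₀ ∧ ∀ k ≤ j, w p k = ρ k) ∧ w p (j + 1) = u})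
          h1 ?_ ?_ ?_
        · rintro p ⟨hp, hag⟩
          refine ⟨w p (j + 1), ?_, ⟨hp, hag⟩, rfl⟩
          rw [← hag j le_rfl]
          exact (hw p hp).1.1.2 j
        · rintro u - p ⟨hp, -⟩
          exact hp
        · intro u hu
          obtain ⟨ρ', hρ', hag', rfl⟩ := exists_play_extend hρ h1 hu
          have := ih (j + 1) (by omega) ρ' hρ'
          rw [seen, g.seen_congr hag', hag' 0 (Nat.zero_le _)] at this
          convert this using 1
          ext p
          constructor
          · rintro ⟨⟨hp, hag⟩, hs⟩
            refine ⟨hp, fun k hk => ?_⟩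
            rcases Nat.le_succ_iff.1 hk with hk | rfl
            · rw [hag k hk, hag' k hk]
            · exact hs
          · rintro ⟨hp, hag⟩
            exact ⟨⟨hp, fun k hk => by rw [hag k (by omega), hag' k hk]⟩, hag (j + 1) le_rfl⟩
  let σ₁ : g.arena.Strategy 1 :=
    ⟨g.anyMove, fun h u _ _ => by simpa using g.legal_anyMove (h ++ [u]) (by simp)⟩
  obtain ⟨ρ, hρ, -⟩ := existsUnique_isOutcome σ₀ σ₁
  have := key J 0 (by omega) ρ ⟨hρ.1, hρ.2.1⟩
  rw [seen, hρ.1.1] at this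
  convert this using 1
  ext p
  constructor
  · intro hp
    refine ⟨hp, fun k hk => ?_⟩
    obtain rfl : k = 0 := by omega
    rw [(hw p hp).1.1.1, hρ.1.1]
  · exact fun hp => hp.1

end Completeness

/-- The game has a solution iff some set of payoffs is good. -/
theorem hasSolution_iff : g.toSPGame.HasSolution ↔ ∃ W : Set (Set ℕ), (∀ p ∈ W, p ⊆ Set.Iic t) ∧
    g.Good W g.arena.init (g.colours g.arena.init) W := by
  constructor
  · rintro ⟨σ₀, h⟩
    refine ⟨outcomes (g := g) σ₀, ?_, good_outcomes h⟩
    rintro _ ⟨ρ, -, rfl⟩ i ⟨k, hk⟩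
    exact g.le_of_mem_colours hk
  · rintro ⟨W, -, h⟩
    exact g.hasSolution_of_good h

end ReachSPGame

/-! ### Stratified programs -/

namespace FOFormula

/-- All relation symbols of the formula are smaller than `m`. -/
def UsesBelow (m : ℕ) : FOFormula → Prop
  | lt _ _ => True
  | rel r _ => r < m
  | neg φ => φ.UsesBelow m
  | and φ ψ => φ.UsesBelow m ∧ ψ.UsesBelow m
  | ex φ => φ.UsesBelow m

instance decidableUsesBelow (m : ℕ) : (φ : FOFormula) → Decidable (φ.UsesBelow m)
  | lt _ _ => inferInstanceAs (Decidable True)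
  | rel r _ => inferInstanceAs (Decidable (r < m))
  | neg φ => decidableUsesBelow m φ
  | and φ ψ =>
    letI := decidableUsesBelow m φ
    letI := decidableUsesBelow m ψ
    inferInstanceAs (Decidable (φ.UsesBelow m ∧ ψ.UsesBelow m))
  | ex φ => decidableUsesBelow m φ

instance decidableWF (ar : ℕ → ℕ) : (φ : FOFormula) → Decidable (φ.WF ar)
  | lt _ _ => inferInstanceAs (Decidable True)
  | rel r args => inferInstanceAs (Decidable (args.length = ar r))
  | neg φ => decidableWF ar φ
  | and φ ψ =>
    letI := decidableWF ar φ
    letI := decidableWF ar ψ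
    inferInstanceAs (Decidable (φ.WF ar ∧ ψ.WF ar))
  | ex φ => decidableWF ar φ

theorem holds_congr {N m : ℕ} {ρ ρ' : RelStore} (h : ∀ r < m, ρ r = ρ' r) {φ : FOFormula}
    (hφ : φ.UsesBelow m) (env : List ℕ) : φ.Holds N ρ env ↔ φ.Holds N ρ' env := by
  induction φ generalizing env with
  | lt i j => exact Iff.rfl
  | rel r args => simp only [Holds, h r hφ]
  | neg φ ih => simp only [Holds, ih hφ]
  | and φ ψ ih₁ ih₂ => simp only [Holds, ih₁ hφ.1, ih₂ hφ.2]
  | ex φ ih => simp only [Holds, ih hφ]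

/-- Universal quantification. -/
def all (φ : FOFormula) : FOFormula := .neg (.ex (.neg φ))

/-- Implication. -/
def imp (φ ψ : FOFormula) : FOFormula := .neg (.and φ (.neg ψ))

/-- Equivalence. -/
def iff (φ ψ : FOFormula) : FOFormula := .and (.imp φ ψ) (.imp ψ φ)

/-- Equality of variables. -/
def eq (i j : ℕ) : FOFormula := .and (.neg (.lt i j)) (.neg (.lt j i))

section

variable {N : ℕ} {ρ : RelStore} {env : List ℕ} {φ ψ : FOFormula} {i j : ℕ}

theorem holds_or : (or φ ψ).Holds N ρ env ↔ φ.Holds N ρ env ∨ ψ.Holds N ρ env := by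
  simp only [or, Holds]; tauto

theorem holds_all : (all φ).Holds N ρ env ↔ ∀ x < N, φ.Holds N ρ (env ++ [x]) := by
  simp only [all, Holds]; push Not; rfl

theorem holds_imp : (imp φ ψ).Holds N ρ env ↔ (φ.Holds N ρ env → ψ.Holds N ρ env) := by
  simp only [imp, Holds]; tauto

theorem holds_iff : (iff φ ψ).Holds N ρ env ↔ (φ.Holds N ρ env ↔ ψ.Holds N ρ env) := by
  simp only [iff, Holds, holds_imp]; tauto

theorem holds_eq : (eq i j).Holds N ρ env ↔ env.getD i 0 = env.getD j 0 := by
  simp only [eq, Holds]; omega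

end

end FOFormula

namespace RelInstr

/-- The formula uses only relations that are computed before. -/
def UsesBelow (m : ℕ) : RelInstr → Prop
  | define _ φ => φ.UsesBelow m
  | iterate _ φ => φ.UsesBelow (m + 1)

instance decidableUsesBelow (m : ℕ) : (I : RelInstr) → Decidable (I.UsesBelow m)
  | define _ φ => inferInstanceAs (Decidable (φ.UsesBelow m))
  | iterate _ φ => inferInstanceAs (Decidable (φ.UsesBelow (m + 1)))

instance decidableWF (ar : ℕ → ℕ) : (I : RelInstr) → Decidable (I.WF ar)
  | define _ φ => inferInstanceAs (Decidable (φ.WF ar))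
  | iterate _ φ => inferInstanceAs (Decidable (φ.WF ar))

/-- The instructions compute the relations `m, m + 1, …` in this order. -/
def Stratified : ℕ → List RelInstr → Prop
  | _, [] => True
  | m, I :: P => I.target = m ∧ I.UsesBelow m ∧ Stratified (m + 1) P

instance decidableStratified : (m : ℕ) → (P : List RelInstr) → Decidable (Stratified m P)
  | _, [] => inferInstanceAs (Decidable True)
  | m, I :: P =>
    letI := decidableStratified (m + 1) P
    inferInstanceAs (Decidable (I.target = m ∧ I.UsesBelow m ∧ Stratified (m + 1) P))

/-- The relation in `ρ` is the one that the instruction defines from the other relations in `ρ`. -/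
def Solved (ar : ℕ → ℕ) (N : ℕ) (ρ : RelStore) : RelInstr → Prop
  | define r φ => ∀ a, a.length = ar r → (∀ x ∈ a, x < N) → (ρ r a ↔ φ.Holds N ρ a)
  | iterate r φ =>
    (∀ a, a.length = ar r → (∀ x ∈ a, x < N) → φ.Holds N ρ a → ρ r a) ∧
    ∀ Q : List ℕ → Prop, (∀ R : List ℕ → Prop,
      (∀ a, a.length = ar r → (∀ x ∈ a, x < N) → R a → Q a) →
      ∀ a, a.length = ar r → (∀ x ∈ a, x < N) → φ.Holds N (update ρ r R) a → Q a) →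
      ∀ a, ρ r a → Q a

theorem foldl_apply_of_lt {ar : ℕ → ℕ} {N m : ℕ} {P : List RelInstr} (hP : Stratified m P)
    (ρ : RelStore) {s : ℕ} (hs : s < m) : P.foldl (fun ρ I => I.apply ar N ρ) ρ s = ρ s := by
  induction P generalizing m ρ with
  | nil => rfl
  | cons I P ih =>
    rw [List.foldl_cons, ih hP.2.2 _ (by omega), apply_of_ne]
    have := hP.1
    omega

/-- An instruction reads only relations that are final when it runs, apart from its own, and later
instructions leave its result alone. Hence all defining properties hold together in the final
interpretation, and the order of computation can be forgotten. -/
theorem solved_foldl_apply {ar : ℕ → ℕ} {N m : ℕ} {P : List RelInstr} (hP : Stratified m P)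
    (ρ : RelStore) : ∀ I ∈ P, I.Solved ar N (P.foldl (fun ρ I => I.apply ar N ρ) ρ) := by
  induction P generalizing m ρ with
  | nil => simp
  | cons I P ih =>
    intro J hJ
    rcases List.mem_cons.1 hJ with rfl | hJ
    swap
    · exact ih hP.2.2 _ J hJ
    obtain ⟨ht, hu, hP⟩ := hP
    rw [List.foldl_cons]
    have h₁ : ∀ s < m + 1, P.foldl (fun ρ I => I.apply ar N ρ) (J.apply ar N ρ) s =
        J.apply ar N ρ s := fun s hs => foldl_apply_of_lt hP _ hs
    have h₂ : ∀ s < m, J.apply ar N ρ s = ρ s := fun s hs => apply_of_ne ρ (by omega)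
    generalize P.foldl (fun ρ I => I.apply ar N ρ) (J.apply ar N ρ) = ρ' at h₁ ⊢
    cases J with
    | define r φ =>
      obtain rfl : r = m := ht
      intro a ha haN
      rw [h₁ r (by omega), apply_define ha haN]
      exact FOFormula.holds_congr (fun s hs => ((h₁ s (by omega)).trans (h₂ s hs)).symm) hu a
    | iterate r φ =>
      obtain rfl : r = m := ht
      refine ⟨fun a ha haN h => ?_, fun Q hQ a h => ?_⟩
      · rw [h₁ r (by omega)]
        exact apply_iterate_closed ha haN ((FOFormula.holds_congr h₁ hu a).1 h)
      · rw [h₁ r (by omega)] at h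
        refine apply_iterate_induction Q (fun R hR b hb hbN hh => hQ R hR b hb hbN ?_) h
        refine (FOFormula.holds_congr (fun s hs => ?_) hu b).1 hh
        by_cases hsr : s = r
        · subst hsr; simp
        · rw [update_of_ne hsr, update_of_ne hsr, h₁ s hs, h₂ s (by omega)]

end RelInstr

/-! ### The program for the synthesis problem -/

namespace SPSProgram

open FOFormula

notation "inpR" => (0 : ℕ)
notation "zeroR" => (1 : ℕ)
notation "succR" => (2 : ℕ)
notation "twoR" => (3 : ℕ)
notation "plusR" => (4 : ℕ)
notation "timesR" => (5 : ℕ)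
notation "bitR" => (6 : ℕ)
notation "isnR" => (7 : ℕ)
notation "istR" => (8 : ℕ)
notation "fieldR" => (9 : ℕ)
notation "edgeR" => (10 : ℕ)
notation "ownR" => (11 : ℕ)
notation "colR" => (12 : ℕ)
notation "stepR" => (13 : ℕ)
notation "attrR" => (14 : ℕ)
notation "subR" => (15 : ℕ)
notation "belowR" => (16 : ℕ)
notation "loseR" => (17 : ℕ)
notation "unionR" => (18 : ℕ)
notation "goodR" => (19 : ℕ)
notation "resR" => (20 : ℕ)

infixr:35 "⩓" => FOFormula.and
infixr:30 "⩔" => FOFormula.or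

/-- The arities of the relations. -/
def arity (r : ℕ) : ℕ :=
  [1, 1, 2, 2, 3, 3, 2, 1, 1, 2, 2, 1, 2, 3, 2, 2, 2, 3, 3, 5, 0].getD r 0

/-- `x = 0`. -/
def zeroF : FOFormula := neg (ex (lt 1 0))

/-- `y = x + 1`. -/
def succF : FOFormula := lt 0 1 ⩓ neg (ex (lt 0 2 ⩓ lt 2 1))

/-- `y = x + 2`. -/
def twoF : FOFormula := ex (rel succR [0, 2] ⩓ rel succR [2, 1])

/-- `x + y = z`. -/
def plusF : FOFormula :=
  (rel zeroR [1] ⩓ eq 0 2) ⩔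
    ex (ex (rel succR [3, 1] ⩓ rel succR [4, 2] ⩓ rel plusR [0, 3, 4]))

/-- `x * y = z`. -/
def timesF : FOFormula :=
  (rel zeroR [1] ⩓ rel zeroR [2]) ⩔
    ex (ex (rel succR [3, 1] ⩓ rel timesR [0, 3, 4] ⩓ rel plusR [4, 0, 2]))

/-- The bit `i` of `x` is one. -/
def bitF : FOFormula :=
  ex (ex (rel plusR [2, 2, 3] ⩓ ((rel zeroR [1] ⩓ rel succR [3, 0]) ⩔
    ex (rel succR [4, 1] ⩓ (eq 3 0 ⩔ rel succR [3, 0]) ⩓ rel bitR [2, 4]))))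

/-- `x` is the number of vertices. -/
def isnF : FOFormula := neg (rel inpR [0]) ⩓ all (imp (lt 1 0) (rel inpR [1]))

/-- `x` is the number of objectives of Player 1. -/
def istF : FOFormula :=
  ex (rel isnR [1] ⩓ ex (rel succR [1, 2] ⩓ ex (rel plusR [2, 0, 3] ⩓ neg (rel inpR [3]) ⩓
    all (imp (neg (lt 4 2) ⩓ lt 4 3) (rel inpR [4])))))

/-- The bit `j` of the row `k` of the input is one. -/
def fieldF : FOFormula :=
  ex (rel isnR [2] ⩓ lt 1 2 ⩓ ex (rel istR [3] ⩓ ex (rel plusR [2, 3, 4] ⩓ ex (rel twoR [4, 5] ⩓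
    ex (rel timesR [0, 2, 6] ⩓ ex (rel plusR [5, 6, 7] ⩓
      ex (rel plusR [7, 1, 8] ⩓ rel inpR [8])))))))

/-- There is an edge from `v` to `u`. -/
def edgeF : FOFormula :=
  ex (rel istR [2] ⩓ ex (rel plusR [2, 0, 3] ⩓ ex (rel succR [3, 4] ⩓
    ex (rel twoR [4, 5] ⩓ rel fieldR [5, 1]))))

/-- `v` is a vertex of Player 1. -/
def ownF : FOFormula := ex (rel zeroR [1] ⩓ rel fieldR [1, 0])

/-- `i` is a colour of `v`. -/
def colF : FOFormula :=
  ex (rel istR [2] ⩓ neg (lt 2 1) ⩓ ex (rel twoR [1, 3] ⩓ rel fieldR [3, 0]))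

/-- `c'` is the union of `c` and the colours of `u`. -/
def stepF : FOFormula := all (iff (rel bitR [2, 3]) (rel bitR [0, 3] ⩔ rel colR [1, 3]))

/-- The formula whose fixed point is `ReachSPGame.Attr`. -/
def attrF : FOFormula :=
  ex (rel zeroR [2] ⩓ rel bitR [1, 2]) ⩔
  (neg (rel ownR [0]) ⩓
    ex (ex (rel edgeR [0, 2] ⩓ rel stepR [1, 2, 3] ⩓ rel attrR [2, 3]))) ⩔
  (rel ownR [0] ⩓ all (all (imp (rel edgeR [0, 2] ⩓ rel stepR [1, 2, 3]) (rel attrR [2, 3]))))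

/-- The comparison of payoffs. -/
def subF : FOFormula := all (imp (neg (rel zeroR [2]) ⩓ rel bitR [0, 2]) (rel bitR [1, 2]))

/-- The payoff of `c` is below `W`. -/
def belowF : FOFormula := ex (rel bitR [0, 2] ⩓ rel subR [1, 2] ⩓ neg (rel subR [2, 1]))

/-- The formula whose fixed point is `ReachSPGame.Lose`. -/
def loseF : FOFormula :=
  neg (rel attrR [1, 2]) ⩓ (neg (rel belowR [0, 2]) ⩔
  (neg (rel ownR [1]) ⩓
    all (all (imp (rel edgeR [1, 3] ⩓ rel stepR [2, 3, 4]) (rel loseR [0, 3, 4])))) ⩔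
  (rel ownR [1] ⩓ ex (ex (rel edgeR [1, 3] ⩓ rel stepR [2, 3, 4] ⩓ rel loseR [0, 3, 4]))))

/-- `S` is the union of `S₁` and `S₂`. -/
def unionF : FOFormula := all (iff (rel bitR [2, 3]) (rel bitR [0, 3] ⩔ rel bitR [1, 3]))

/-- The formula whose fixed point is `ReachSPGame.Good`, for the index `0`. For the index `j + 1`,
the fixed point tells whether `S` can be distributed among the successors smaller than `j`. -/
def goodF : FOFormula :=
  (rel zeroR [3] ⩓ all (imp (rel bitR [4, 5]) (rel subR [5, 2])) ⩓ neg (rel loseR [0, 1, 2])) ⩔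
  (rel zeroR [3] ⩓ neg (rel ownR [1]) ⩓
    ex (ex (rel edgeR [1, 5] ⩓ rel stepR [2, 5, 6] ⩓ rel goodR [0, 5, 6, 3, 4]))) ⩔
  (rel zeroR [3] ⩓ rel ownR [1] ⩓
    ex (rel isnR [5] ⩓ ex (rel succR [5, 6] ⩓ rel goodR [0, 1, 2, 6, 4]))) ⩔
  ex (rel zeroR [5] ⩓ rel succR [5, 3] ⩓ all (neg (rel bitR [4, 6]))) ⩔
  ex (rel twoR [5, 3] ⩓ ex (rel succR [6, 3] ⩓
    ((neg (rel edgeR [1, 5]) ⩓ rel goodR [0, 1, 2, 6, 4]) ⩔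
    (rel edgeR [1, 5] ⩓ ex (ex (ex (ex (rel zeroR [10] ⩓ rel stepR [2, 5, 9] ⩓
      rel unionR [7, 8, 4] ⩓ rel goodR [0, 5, 9, 10, 7] ⩓ rel goodR [0, 1, 2, 6, 8]))))))))

/-- The game has a solution. -/
def resF : FOFormula :=
  ex (ex (ex (ex (rel zeroR [3] ⩓ ex (rel succR [3, 4] ⩓ rel fieldR [4, 1] ⩓
    all (iff (rel bitR [2, 5]) (rel colR [1, 5])) ⩓ rel goodR [0, 1, 2, 3, 0])))))

/-- The program for the synthesis problem. -/
def instrs : List RelInstr :=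
  [.define zeroR zeroF, .define succR succF, .define twoR twoF, .iterate plusR plusF,
    .iterate timesR timesF, .iterate bitR bitF, .define isnR isnF, .define istR istF,
    .define fieldR fieldF, .define edgeR edgeF, .define ownR ownF, .define colR colF,
    .define stepR stepF, .iterate attrR attrF, .define subR subF, .define belowR belowF,
    .iterate loseR loseF, .define unionR unionF, .iterate goodR goodF, .define resR resF]

theorem wf_instrs : ∀ I ∈ instrs, I.WF arity := by decide

theorem stratified_instrs : RelInstr.Stratified 1 instrs := by decide

theorem target_lt : ∀ I ∈ instrs, I.target < 21 := by decide

/-! #### Arithmetic -/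

/-- All relations of `ρ` are as the program computes them. -/
def Solved (N : ℕ) (ρ : RelStore) : Prop := ∀ I ∈ instrs, I.Solved arity N ρ

end SPSProgram

namespace SPSProgram

open FOFormula

section Arithmetic

variable {N : ℕ} {ρ : RelStore}

theorem zeroR_iff (h : Solved N ρ) {a : ℕ} (ha : a < N) : ρ zeroR [a] ↔ a = 0 := by
  rw [h (.define zeroR zeroF) (List.mem_of_getElem? (i := 0) rfl) [a] rfl (by simpa using ha)]
  simp only [zeroF, Holds, List.cons_append, List.nil_append, List.getD_cons_zero,
    List.getD_cons_succ]
  constructor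
  · intro h'
    by_contra h0
    exact h' ⟨0, by omega, by omega⟩
  · rintro rfl ⟨x, -, hx⟩
    omega

theorem succR_iff (h : Solved N ρ) {a b : ℕ} (ha : a < N) (hb : b < N) :
    ρ succR [a, b] ↔ b = a + 1 := by
  rw [h (.define succR succF) (List.mem_of_getElem? (i := 1) rfl) [a, b] rfl (by simp [ha, hb])]
  simp only [succF, Holds, List.cons_append, List.nil_append, List.getD_cons_zero,
    List.getD_cons_succ]
  constructor
  · rintro ⟨h₁, h₂⟩
    by_contra h0
    exact h₂ ⟨a + 1, by omega, by omega, by omega⟩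
  · rintro rfl
    exact ⟨by omega, fun ⟨x, _, h₁, h₂⟩ => by omega⟩

theorem twoR_iff (h : Solved N ρ) {a b : ℕ} (ha : a < N) (hb : b < N) :
    ρ twoR [a, b] ↔ b = a + 2 := by
  rw [h (.define twoR twoF) (List.mem_of_getElem? (i := 2) rfl) [a, b] rfl (by simp [ha, hb])]
  simp only [twoF, Holds, List.cons_append, List.nil_append, List.getD_cons_zero,
    List.getD_cons_succ, List.map_cons, List.map_nil]
  constructor
  · rintro ⟨x, hx, h₁, h₂⟩
    rw [succR_iff h ha hx] at h₁
    rw [succR_iff h hx hb] at h₂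
    omega
  · rintro rfl
    exact ⟨a + 1, by omega, (succR_iff h ha (by omega)).2 rfl,
      (succR_iff h (by omega) hb).2 rfl⟩

/-- The pattern for all iterated relations: soundness is the induction principle of `Solved`,
completeness is an ordinary induction with the closure property. Partial sums do not exceed c, so
they never leave the domain. -/
theorem plusR_iff (h : Solved N ρ) {a b c : ℕ} (ha : a < N) (hb : b < N) (hc : c < N) :
    ρ plusR [a, b, c] ↔ a + b = c := by
  obtain ⟨h₁, h₂⟩ := h (.iterate plusR plusF) (List.mem_of_getElem? (i := 3) rfl)
  constructor
  · intro hp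
    refine h₂ (fun l => ∀ a b c, l = [a, b, c] → a + b = c) ?_ _ hp a b c rfl
    rintro R hR _ - hlt hh a b c rfl
    simp only [List.mem_cons, List.not_mem_nil, or_false, forall_eq_or_imp, forall_eq] at hlt
    obtain ⟨ha, hb, hc⟩ := hlt
    simp [plusF, Holds, holds_or, holds_eq] at hh
    rcases hh with ⟨h₃, h₄⟩ | ⟨x, hx, y, hy, h₃, h₄, h₅⟩
    · rw [zeroR_iff h hb] at h₃
      omega
    · rw [succR_iff h hx hb] at h₃
      rw [succR_iff h hy hc] at h₄
      have := hR [a, x, y] rfl (by simp [ha, hx, hy]) h₅ a x y rfl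
      omega
  · intro he
    induction b generalizing c with
    | zero =>
      refine h₁ _ rfl (by simp [ha, hb, hc]) ?_
      simp [plusF, Holds, holds_or, holds_eq, zeroR_iff h hb]
      omega
    | succ b ih =>
      refine h₁ _ rfl (by simp [ha, hb, hc]) ?_
      simp [plusF, Holds, holds_or, holds_eq]
      exact Or.inr ⟨b, by omega, a + b, by omega, (succR_iff h (by omega) hb).2 rfl,
        (succR_iff h (by omega) hc).2 (by omega), ih (by omega) (by omega) rfl⟩

theorem timesR_iff (h : Solved N ρ) {a b c : ℕ} (ha : a < N) (hb : b < N) (hc : c < N) :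
    ρ timesR [a, b, c] ↔ a * b = c := by
  obtain ⟨h₁, h₂⟩ := h (.iterate timesR timesF) (List.mem_of_getElem? (i := 4) rfl)
  constructor
  · intro hp
    refine h₂ (fun l => ∀ a b c, l = [a, b, c] → a * b = c) ?_ _ hp a b c rfl
    rintro R hR _ - hlt hh a b c rfl
    simp only [List.mem_cons, List.not_mem_nil, or_false, forall_eq_or_imp, forall_eq] at hlt
    obtain ⟨ha, hb, hc⟩ := hlt
    simp [timesF, Holds, holds_or] at hh
    rcases hh with ⟨h₃, h₄⟩ | ⟨x, hx, y, hy, h₃, h₄, h₅⟩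
    · rw [zeroR_iff h hb] at h₃
      rw [zeroR_iff h hc] at h₄
      simp [h₃, h₄]
    · rw [succR_iff h hx hb] at h₃
      rw [plusR_iff h hy ha hc] at h₅
      have := hR [a, x, y] rfl (by simp [ha, hx, hy]) h₄ a x y rfl
      rw [h₃, mul_add, this, mul_one, h₅]
  · intro he
    induction b generalizing c with
    | zero =>
      refine h₁ _ rfl (by simp [ha, hb, hc]) ?_
      simp [timesF, Holds, holds_or, zeroR_iff h hb, zeroR_iff h hc]
      omega
    | succ b ih =>
      refine h₁ _ rfl (by simp [ha, hb, hc]) ?_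
      rw [mul_add, mul_one] at he
      simp [timesF, Holds, holds_or]
      exact Or.inr ⟨b, by omega, a * b, by omega, (succR_iff h (by omega) hb).2 rfl,
        ih (by omega) (by omega) rfl, (plusR_iff h (by omega) ha hc).2 he⟩

/-- Every number is 2y or 2y + 1: its bit 0 is the parity, and its bit i + 1 is the bit i of y. -/
theorem bitR_iff (h : Solved N ρ) {a i : ℕ} (ha : a < N) (hi : i < N) :
    ρ bitR [a, i] ↔ a.testBit i = true := by
  obtain ⟨h₁, h₂⟩ := h (.iterate bitR bitF) (List.mem_of_getElem? (i := 5) rfl)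
  constructor
  · intro hp
    refine h₂ (fun l => ∀ a i, l = [a, i] → a.testBit i = true) ?_ _ hp a i rfl
    rintro R hR _ - hlt hh a i rfl
    simp only [List.mem_cons, List.not_mem_nil, or_false, forall_eq_or_imp, forall_eq] at hlt
    obtain ⟨ha, hi⟩ := hlt
    simp [bitF, Holds, holds_or, holds_eq] at hh
    obtain ⟨y, hy, z, hz, h₃, h₄⟩ := hh
    rw [plusR_iff h hy hy hz] at h₃
    rw [zeroR_iff h hi, succR_iff h hz ha] at h₄
    rcases h₄ with ⟨rfl, h₄⟩ | ⟨j, hj, h₄, h₅, h₆⟩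
    · rw [Nat.testBit_zero, decide_eq_true_eq]
      omega
    · rw [succR_iff h hj hi] at h₄
      subst h₄
      have := hR [y, j] rfl (by simp [hy, hj]) h₆ y j rfl
      rw [Nat.testBit_succ, show a / 2 = y by omega]
      exact this
  · intro he
    induction i generalizing a with
    | zero =>
      rw [Nat.testBit_zero, decide_eq_true_eq] at he
      refine h₁ _ rfl (by simp [ha, hi]) ?_
      simp [bitF, Holds, holds_or, holds_eq]
      exact ⟨a / 2, by omega, 2 * (a / 2), by omega,
        (plusR_iff h (by omega) (by omega) (by omega)).2 (by omega),
        Or.inl ⟨(zeroR_iff h hi).2 rfl, (succR_iff h (by omega) ha).2 (by omega)⟩⟩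
    | succ i ih =>
      rw [Nat.testBit_succ] at he
      refine h₁ _ rfl (by simp [ha, hi]) ?_
      simp [bitF, Holds, holds_or, holds_eq]
      refine ⟨a / 2, by omega, 2 * (a / 2), by omega,
        (plusR_iff h (by omega) (by omega) (by omega)).2 (by omega),
        Or.inr ⟨i, by omega, (succR_iff h (by omega) hi).2 rfl, ?_, ih (by omega) (by omega) he⟩⟩
      rw [succR_iff h (by omega) ha]
      omega

/-- Since a < N ≤ i < 2 ^ i, quantifiers over bit positions lose nothing by being bounded by N. -/
theorem testBit_eq_false_of_lt {a i : ℕ} (ha : a < N) (hi : N ≤ i) : a.testBit i = Bool.false :=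
  Nat.testBit_lt_two_pow (ha.trans_le (hi.trans Nat.lt_two_pow_self.le))

theorem subR_iff (h : Solved N ρ) {p q : ℕ} (hp : p < N) (hq : q < N) :
    ρ subR [p, q] ↔ ∀ i ≠ 0, p.testBit i = true → q.testBit i = true := by
  rw [h (.define subR subF) (List.mem_of_getElem? (i := 14) rfl) [p, q] rfl (by simp [hp, hq])]
  simp [subF, Holds, holds_all, holds_imp]
  constructor
  · intro h' i hi hpi
    by_cases hiN : i < N
    · rw [← bitR_iff h hq hiN]
      exact h' i hiN (by rwa [zeroR_iff h hiN]) ((bitR_iff h hp hiN).2 hpi)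
    · rw [testBit_eq_false_of_lt hp (by omega)] at hpi
      exact absurd hpi (by simp)
  · intro h' i hiN hi hpi
    rw [zeroR_iff h hiN] at hi
    rw [bitR_iff h hp hiN] at hpi
    exact (bitR_iff h hq hiN).2 (h' i hi hpi)

theorem unionR_iff (h : Solved N ρ) {a b c : ℕ} (ha : a < N) (hb : b < N) (hc : c < N) :
    ρ unionR [a, b, c] ↔ ∀ i, c.testBit i = true ↔ a.testBit i = true ∨ b.testBit i = true := by
  rw [h (.define unionR unionF) (List.mem_of_getElem? (i := 17) rfl) [a, b, c] rfl
    (by simp [ha, hb, hc])]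
  simp [unionF, Holds, holds_all, holds_iff, holds_or]
  constructor
  · intro h' i
    by_cases hiN : i < N
    · have := h' i hiN
      rwa [bitR_iff h ha hiN, bitR_iff h hb hiN, bitR_iff h hc hiN] at this
    · simp [testBit_eq_false_of_lt ha (not_lt.1 hiN), testBit_eq_false_of_lt hb (not_lt.1 hiN),
        testBit_eq_false_of_lt hc (not_lt.1 hiN)]
  · intro h' i hiN
    rw [bitR_iff h ha hiN, bitR_iff h hb hiN, bitR_iff h hc hiN]
    exact h' i

end Arithmetic

end SPSProgram

/-! ### Reading the input -/

namespace ReachSPInstance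

variable (I : ReachSPInstance)

/-- The rows of the encoding of an instance. -/
def rows : List (List Bool) :=
  (List.ofFn fun v => decide (I.game.arena.owner v = 1)) :: bits {I.game.arena.init} ::
    bits I.game.target₀ :: ((List.ofFn fun i => bits (I.game.target i)) ++
      List.ofFn fun v => List.ofFn fun v' => decide ((v, v') ∈ I.game.arena.E))

theorem encode_eq : I.encode = List.replicate I.n true ++ false ::
    (List.replicate I.t true ++ false :: I.rows.flatten) := by
  simp [encode, rows]

theorem length_of_mem_rows {l : List Bool} (hl : l ∈ I.rows) : l.length = I.n := by
  simp only [rows, List.mem_cons, List.mem_append, List.mem_ofFn] at hl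
  rcases hl with rfl | rfl | rfl | ⟨i, rfl⟩ | ⟨i, rfl⟩ <;> simp [bits]

theorem n_pos : 0 < I.n := (Fin.pos I.game.arena.init)

theorem length_encode : I.encode.length = I.n + I.t + 2 + (3 + I.t + I.n) * I.n := by
  have h : I.rows.flatten.length = (3 + I.t + I.n) * I.n := by
    rw [List.length_flatten, List.map_congr_left (g := fun _ => I.n)
      fun l hl => I.length_of_mem_rows hl, List.map_const', List.sum_replicate, smul_eq_mul]
    congr 1
    simp [rows]
    ring
  rw [encode_eq]
  simp only [List.length_append, List.length_cons, List.length_replicate, h]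
  ring

theorem getElem?_flatten_of_length {α : Type*} {L : List (List α)} {n : ℕ}
    (hL : ∀ l ∈ L, l.length = n) {k j : ℕ} (hj : j < n) :
    L.flatten[k * n + j]? = (L[k]?.getD [])[j]? := by
  induction L generalizing k with
  | nil => simp
  | cons l L ih =>
    have hl : l.length = n := hL l List.mem_cons_self
    rw [List.flatten_cons]
    cases k with
    | zero =>
      rw [List.getElem?_append_left (by omega)]
      simp
    | succ k =>
      rw [List.getElem?_append_right (by rw [hl]; linarith [Nat.le_mul_of_pos_left n k.succ_pos]),
        hl, show (k + 1) * n + j - n = k * n + j by rw [add_mul]; omega,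
        ih fun l hl => hL l (List.mem_cons_of_mem _ hl)]
      simp

theorem getD_encode_of_lt {i : ℕ} (hi : i < I.n) : I.encode.getD i false = true := by
  rw [encode_eq, List.getD_eq_getElem?_getD, List.getElem?_append_left (by simpa using hi)]
  simp [hi]

theorem getD_encode_n : I.encode.getD I.n false = false := by
  rw [encode_eq, List.getD_eq_getElem?_getD, List.getElem?_append_right (by simp)]
  simp

theorem getD_encode_right (i : ℕ) : I.encode.getD (I.n + 1 + i) false =
    (List.replicate I.t true ++ false :: I.rows.flatten).getD i false := by
  rw [encode_eq, List.getD_eq_getElem?_getD, List.getElem?_append_right (by simp; omega),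
    List.length_replicate, show I.n + 1 + i - I.n = i + 1 by omega, List.getElem?_cons_succ,
    List.getD_eq_getElem?_getD]

theorem getD_encode_of_lt_t {i : ℕ} (hi : i < I.t) : I.encode.getD (I.n + 1 + i) false = true := by
  rw [getD_encode_right, List.getD_eq_getElem?_getD, List.getElem?_append_left (by simpa using hi)]
  simp [hi]

theorem getD_encode_t : I.encode.getD (I.n + 1 + I.t) false = false := by
  rw [getD_encode_right, List.getD_eq_getElem?_getD, List.getElem?_append_right (by simp)]
  simp

/-- The two unary numbers with their final zeros take n + t + 2 symbols; rows of length n follow. -/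
theorem getD_encode_field {k j : ℕ} (hj : j < I.n) :
    I.encode.getD (I.n + I.t + 2 + k * I.n + j) false = (I.rows[k]?.getD []).getD j false := by
  rw [show I.n + I.t + 2 + k * I.n + j = I.n + 1 + (I.t + 1 + (k * I.n + j)) by ring,
    getD_encode_right, List.getD_eq_getElem?_getD,
    List.getElem?_append_right (by simp; omega), List.length_replicate,
    show I.t + 1 + (k * I.n + j) - I.t = k * I.n + j + 1 by omega, List.getElem?_cons_succ,
    getElem?_flatten_of_length (fun l hl => I.length_of_mem_rows hl) hj,
    List.getD_eq_getElem?_getD]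

theorem getD_ofFn_eq_true {m : ℕ} {f : Fin m → Bool} {j : ℕ} :
    (List.ofFn f).getD j false = true ↔ ∃ h : j < m, f ⟨j, h⟩ = true := by
  rw [List.getD_eq_getElem?_getD, List.getElem?_ofFn]
  by_cases h : j < m <;> simp [h]

theorem getD_bits {S : Finset (Fin I.n)} {j : ℕ} :
    (bits S).getD j false = true ↔ ∃ h : j < I.n, ⟨j, h⟩ ∈ S := by
  rw [bits, getD_ofFn_eq_true]
  simp

theorem rows_target {i : ℕ} (hi : i < I.t) :
    I.rows[i + 3]? = some (bits (I.game.target ⟨i, hi⟩)) := by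
  rw [rows, List.getElem?_cons_succ, List.getElem?_cons_succ, List.getElem?_cons_succ,
    List.getElem?_append_left (by simpa using hi)]
  simp [hi]

theorem rows_edge (v : ℕ) : I.rows[I.t + v + 3]? =
    (List.ofFn fun v => List.ofFn fun v' => decide ((v, v') ∈ I.game.arena.E))[v]? := by
  rw [rows, List.getElem?_cons_succ, List.getElem?_cons_succ, List.getElem?_cons_succ,
    List.getElem?_append_right (by simp)]
  simp

end ReachSPInstance

/-! ### Coding of colour sets by numbers, and correctness of the computed relations. -/

namespace SPSProgram

open FOFormula ReachSPInstance

/-- The set of the positions of the ones in the binary representation of a number. -/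
def bitSet (m : ℕ) : Set ℕ := {i | m.testBit i = true}

/-- The sets whose numbers belong to `bitSet S`. -/
def bitSets (S : ℕ) : Set (Set ℕ) := {p | ∃ m, S.testBit m = true ∧ p = bitSet m}

theorem mem_bitSet {m i : ℕ} : i ∈ bitSet m ↔ m.testBit i = true := Iff.rfl

theorem bitSet_injective : Injective bitSet := by
  intro a b hab
  refine Nat.eq_of_testBit_eq fun i => ?_
  have := congrArg (i ∈ ·) hab
  simp only [mem_bitSet, eq_iff_iff] at this
  exact Bool.eq_iff_iff.2 this

theorem bitSet_mem_bitSets {S m : ℕ} : bitSet m ∈ bitSets S ↔ S.testBit m = true := by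
  constructor
  · rintro ⟨m', h, he⟩
    rwa [bitSet_injective he]
  · exact fun h => ⟨m, h, rfl⟩

theorem exists_testBit_iff (k : ℕ) (P : ℕ → Prop) :
    ∃ m < 2 ^ k, ∀ i, m.testBit i = true ↔ i < k ∧ P i := by
  classical
  refine ⟨Nat.ofBits fun i : Fin k => decide (P i), Nat.ofBits_lt_two_pow _, fun i => ?_⟩
  by_cases hi : i < k
  · rw [Nat.testBit_ofBits_lt _ _ hi]
    simp [hi]
  · rw [Nat.testBit_ofBits_ge _ _ (by omega)]
    simp [hi]

theorem lt_of_testBit {m k i : ℕ} (h : m < 2 ^ k) (hi : m.testBit i = true) : i < k := by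
  by_contra hk
  rw [Nat.testBit_lt_two_pow (h.trans_le (Nat.pow_le_pow_right (by norm_num) (by omega)))] at hi
  exact absurd hi (by simp)

theorem lt_two_pow_of_testBit {m k : ℕ} (h : ∀ i, m.testBit i = true → i < k) : m < 2 ^ k := by
  refine Nat.lt_pow_two_of_testBit _ fun i hi => ?_
  by_contra hb
  have := h i (by simpa using hb)
  omega

/-- The relations of `ρ` are those that the program computes for the instance `I`. -/
structure Correct (I : ReachSPInstance) (N : ℕ) (ρ : RelStore) : Prop where
  solved : Solved N ρ
  size : N = I.encode.length * 2 ^ 2 ^ (I.t + 1)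
  input : ∀ i, ρ inpR [i] ↔ I.encode.getD i Bool.false = true

section

variable {I : ReachSPInstance} {N : ℕ} {ρ : RelStore}

namespace Correct

theorem length_le (h : Correct I N ρ) : I.encode.length ≤ N := by
  rw [h.size]
  exact Nat.le_mul_of_pos_right _ (by positivity)

/-- Room in the domain for the row numbers and offsets that the formulas build from n and t. -/
theorem n_add_t_lt (h : Correct I N ρ) : I.n + I.t + 4 < N := by
  have := h.length_le
  rw [length_encode] at this
  have := I.n_pos
  have : 3 + I.t + I.n ≤ (3 + I.t + I.n) * I.n := Nat.le_mul_of_pos_right _ I.n_pos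
  omega

theorem two_pow_le (h : Correct I N ρ) : 2 ^ 2 ^ (I.t + 1) ≤ N := by
  rw [h.size]
  refine Nat.le_mul_of_pos_left _ ?_
  rw [length_encode]
  omega

theorem two_pow_lt (h : Correct I N ρ) : 2 ^ (I.t + 1) < N :=
  Nat.lt_two_pow_self.trans_le h.two_pow_le

theorem lt_of_getD (h : Correct I N ρ) {i : ℕ} (hi : I.encode.getD i Bool.false = true) :
    i < N := by
  refine lt_of_lt_of_le ?_ h.length_le
  by_contra hc
  rw [List.getD_eq_getElem?_getD, List.getElem?_eq_none (by omega)] at hi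
  exact absurd hi (by simp)

theorem isnR_iff (h : Correct I N ρ) {a : ℕ} (ha : a < N) : ρ isnR [a] ↔ a = I.n := by
  rw [h.solved (.define isnR isnF) (List.mem_of_getElem? (i := 6) rfl) [a] rfl (by simpa using ha)]
  simp only [isnF, Holds, holds_all, holds_imp, List.cons_append, List.nil_append,
    List.getD_cons_zero, List.getD_cons_succ, List.map_cons, List.map_nil, h.input]
  constructor
  · rintro ⟨h₁, h₂⟩
    rcases lt_trichotomy a I.n with hlt | rfl | hgt
    · exact absurd (I.getD_encode_of_lt hlt) h₁
    · rfl
    · have := h₂ I.n (by omega) hgt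
      rw [I.getD_encode_n] at this
      exact absurd this (by simp)
  · rintro rfl
    exact ⟨by rw [I.getD_encode_n]; simp, fun b _ hb => I.getD_encode_of_lt hb⟩

theorem istR_iff (h : Correct I N ρ) {a : ℕ} (ha : a < N) : ρ istR [a] ↔ a = I.t := by
  have hnt := h.n_add_t_lt
  rw [h.solved (.define istR istF) (List.mem_of_getElem? (i := 7) rfl) [a] rfl (by simpa using ha)]
  simp only [istF, Holds, holds_all, holds_imp, List.cons_append, List.nil_append,
    List.getD_cons_zero, List.getD_cons_succ, List.map_cons, List.map_nil, h.input]
  constructor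
  · rintro ⟨n, hn, h₁, s, hs, h₂, m, hm, h₃, h₄, h₅⟩
    rw [h.isnR_iff hn] at h₁
    subst h₁
    rw [succR_iff h.solved hn hs] at h₂
    subst h₂
    rw [plusR_iff h.solved hs ha hm] at h₃
    subst h₃
    rcases lt_trichotomy a I.t with hlt | rfl | hgt
    · exact absurd (I.getD_encode_of_lt_t hlt) h₄
    · rfl
    · have := h₅ (I.n + 1 + I.t) (by omega) ⟨by omega, by omega⟩
      rw [I.getD_encode_t] at this
      exact absurd this (by simp)
  · rintro rfl
    refine ⟨I.n, by omega, (h.isnR_iff (by omega)).2 rfl, I.n + 1, by omega,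
      (succR_iff h.solved (by omega) (by omega)).2 rfl, I.n + 1 + I.t, by omega,
      (plusR_iff h.solved (by omega) (by omega) (by omega)).2 rfl,
      by rw [I.getD_encode_t]; simp, fun b _ hb => ?_⟩
    obtain ⟨c, rfl⟩ := Nat.exists_eq_add_of_le (not_lt.1 hb.1)
    exact I.getD_encode_of_lt_t (by omega)

theorem fieldR_iff (h : Correct I N ρ) {k j : ℕ} (hk : k < N) (hj : j < N) :
    ρ fieldR [k, j] ↔ j < I.n ∧ (I.rows[k]?.getD []).getD j Bool.false = true := by
  have hnt := h.n_add_t_lt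
  rw [h.solved (.define fieldR fieldF) (List.mem_of_getElem? (i := 8) rfl) [k, j] rfl
    (by simp [hk, hj])]
  simp only [fieldF, Holds, List.cons_append, List.nil_append, List.getD_cons_zero,
    List.getD_cons_succ, List.map_cons, List.map_nil, h.input]
  constructor
  · rintro ⟨n, hn, h₁, hjn, t, ht, h₂, a, ha, h₃, o, ho, h₄, m, hm, h₅, p, hp, h₆, q, hq, h₇, h₈⟩
    rw [h.isnR_iff hn] at h₁
    rw [h.istR_iff ht] at h₂
    rw [plusR_iff h.solved hn ht ha] at h₃
    rw [twoR_iff h.solved ha ho] at h₄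
    rw [timesR_iff h.solved hk hn hm] at h₅
    rw [plusR_iff h.solved ho hm hp] at h₆
    rw [plusR_iff h.solved hp hj hq] at h₇
    subst h₁ h₂ h₃ h₄ h₅ h₆ h₇
    rw [I.getD_encode_field hjn] at h₈
    exact ⟨hjn, h₈⟩
  · rintro ⟨hjn, h₈⟩
    rw [← I.getD_encode_field hjn] at h₈
    -- A one lies inside the input, so its position, and with it every intermediate number, is below
    -- N.
    have hlt := h.lt_of_getD h₈
    exact ⟨I.n, by omega, (h.isnR_iff (by omega)).2 rfl, hjn, I.t, by omega,
      (h.istR_iff (by omega)).2 rfl, I.n + I.t, by omega,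
      (plusR_iff h.solved (by omega) (by omega) (by omega)).2 rfl, I.n + I.t + 2, by omega,
      (twoR_iff h.solved (by omega) (by omega)).2 rfl, k * I.n, by omega,
      (timesR_iff h.solved hk (by omega) (by omega)).2 rfl, I.n + I.t + 2 + k * I.n, by omega,
      (plusR_iff h.solved (by omega) (by omega) (by omega)).2 rfl, I.n + I.t + 2 + k * I.n + j,
      hlt, (plusR_iff h.solved (by omega) hj hlt).2 rfl, h₈⟩

/-- The rows 0, 1, 2 hold the owners, the initial vertex and T₀, and the next t rows the targets of
Player 1, so the edges from v are in row t + v + 3. -/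
theorem edgeR_iff (h : Correct I N ρ) {v u : ℕ} (hv : v < N) (hu : u < N) : ρ edgeR [v, u] ↔
    ∃ (hv : v < I.n) (hu : u < I.n), (⟨v, hv⟩, ⟨u, hu⟩) ∈ I.game.arena.E := by
  have hnt := h.n_add_t_lt
  have key : (I.rows[I.t + v + 1 + 2]?.getD []).getD u Bool.false = true ↔
      ∃ (hv : v < I.n) (hu : u < I.n), (⟨v, hv⟩, ⟨u, hu⟩) ∈ I.game.arena.E := by
    rw [show I.t + v + 1 + 2 = I.t + v + 3 by ring, rows_edge, List.getElem?_ofFn]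
    by_cases hv : v < I.n
    · rw [dif_pos hv, Option.getD_some, getD_ofFn_eq_true]
      simp [hv]
    · rw [dif_neg hv]
      simp [hv]
  rw [h.solved (.define edgeR edgeF) (List.mem_of_getElem? (i := 9) rfl) [v, u] rfl
    (by simp [hv, hu])]
  simp only [edgeF, Holds, List.cons_append, List.nil_append, List.getD_cons_zero,
    List.getD_cons_succ, List.map_cons, List.map_nil]
  constructor
  · rintro ⟨t, ht, h₁, a, ha, h₂, b, hb, h₃, k, hk, h₄, h₅⟩
    rw [h.istR_iff ht] at h₁
    rw [plusR_iff h.solved ht hv ha] at h₂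
    rw [succR_iff h.solved ha hb] at h₃
    rw [twoR_iff h.solved hb hk] at h₄
    rw [h.fieldR_iff hk hu] at h₅
    subst h₁ h₂ h₃ h₄
    exact key.1 h₅.2
  · intro he
    obtain ⟨hv', hu', -⟩ := id he
    exact ⟨I.t, by omega, (h.istR_iff (by omega)).2 rfl, I.t + v, by omega,
      (plusR_iff h.solved (by omega) (by omega) (by omega)).2 rfl, I.t + v + 1, by omega,
      (succR_iff h.solved (by omega) (by omega)).2 rfl, I.t + v + 1 + 2, by omega,
      (twoR_iff h.solved (by omega) (by omega)).2 rfl,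
      (h.fieldR_iff (by omega) hu).2 ⟨hu', key.2 he⟩⟩

theorem ownR_iff (h : Correct I N ρ) {v : ℕ} (hv : v < I.n) :
    ρ ownR [v] ↔ I.game.arena.owner ⟨v, hv⟩ = 1 := by
  have hnt := h.n_add_t_lt
  have key : (I.rows[0]?.getD []).getD v Bool.false = true ↔
      I.game.arena.owner ⟨v, hv⟩ = 1 := by
    rw [rows, List.getElem?_cons_zero, Option.getD_some, getD_ofFn_eq_true]
    simp [hv]
  rw [h.solved (.define ownR ownF) (List.mem_of_getElem? (i := 10) rfl) [v] rfl
    (by simp; omega), ← key]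
  simp only [ownF, Holds, List.cons_append, List.nil_append, List.getD_cons_zero,
    List.getD_cons_succ, List.map_cons, List.map_nil]
  constructor
  · rintro ⟨z, hz, h₁, h₂⟩
    rw [zeroR_iff h.solved hz] at h₁
    subst h₁
    exact ((h.fieldR_iff hz (by omega)).1 h₂).2
  · intro h₂
    exact ⟨0, by omega, (zeroR_iff h.solved (by omega)).2 rfl,
      (h.fieldR_iff (by omega) (by omega)).2 ⟨hv, h₂⟩⟩

/-- Every colour i, 0 included, is stored in row i + 2. The restriction i ≤ t prevents rows of the
adjacency matrix from being read as colours. -/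
theorem colR_iff (h : Correct I N ρ) {v i : ℕ} (hv : v < I.n) (hi : i < N) :
    ρ colR [v, i] ↔ i ∈ I.game.colours ⟨v, hv⟩ := by
  have hnt := h.n_add_t_lt
  have key : i ≤ I.t → ((I.rows[i + 2]?.getD []).getD v Bool.false = true ↔
      i ∈ I.game.colours ⟨v, hv⟩) := by
    intro hit
    cases i with
    | zero =>
      rw [I.game.zero_mem_colours, rows, List.getElem?_cons_succ, List.getElem?_cons_succ,
        List.getElem?_cons_zero, Option.getD_some, getD_bits]
      simp [hv]
    | succ i =>
      have := I.game.succ_mem_colours (v := ⟨v, hv⟩) (i := ⟨i, hit⟩)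
      simp only at this
      rw [this, show i + 1 + 2 = i + 3 by ring, I.rows_target hit, Option.getD_some, getD_bits]
      simp [hv]
  rw [h.solved (.define colR colF) (List.mem_of_getElem? (i := 11) rfl) [v, i] rfl
    (by simp [hi]; omega)]
  simp only [colF, Holds, List.cons_append, List.nil_append, List.getD_cons_zero,
    List.getD_cons_succ, List.map_cons, List.map_nil]
  constructor
  · rintro ⟨t, ht, h₁, h₂, k, hk, h₃, h₄⟩
    rw [h.istR_iff ht] at h₁
    rw [twoR_iff h.solved hi hk] at h₃
    rw [h.fieldR_iff hk (by omega)] at h₄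
    subst h₁ h₃
    exact (key (not_lt.1 h₂)).1 h₄.2
  · intro hc
    have hit := I.game.le_of_mem_colours hc
    exact ⟨I.t, by omega, (h.istR_iff (by omega)).2 rfl, not_lt.2 hit, i + 2, by omega,
      (twoR_iff h.solved (by omega) (by omega)).2 rfl,
      (h.fieldR_iff (by omega) (by omega)).2 ⟨hv, (key hit).2 hc⟩⟩

theorem stepR_iff (h : Correct I N ρ) {c u c' : ℕ} (hc : c < N) (hu : u < I.n) (hc' : c' < N) :
    ρ stepR [c, u, c'] ↔ bitSet c' = bitSet c ∪ I.game.colours ⟨u, hu⟩ := by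
  have hnt := h.n_add_t_lt
  rw [h.solved (.define stepR stepF) (List.mem_of_getElem? (i := 12) rfl) [c, u, c'] rfl
    (by simp [hc, hc']; omega)]
  simp only [stepF, Holds, holds_all, holds_iff, holds_or, List.cons_append, List.nil_append,
    List.getD_cons_zero, List.getD_cons_succ, List.map_cons, List.map_nil]
  rw [Set.ext_iff]
  simp only [Set.mem_union, mem_bitSet]
  constructor
  · intro h' i
    by_cases hi : i < N
    · have := h' i hi
      rwa [bitR_iff h.solved hc' hi, bitR_iff h.solved hc hi, h.colR_iff hu hi] at this
    · rw [testBit_eq_false_of_lt hc' (not_lt.1 hi), testBit_eq_false_of_lt hc (not_lt.1 hi)]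
      constructor
      · simp
      · rintro (h | h)
        · exact absurd h (by simp)
        · have := I.game.le_of_mem_colours h
          omega
  · intro h' i hi
    rw [bitR_iff h.solved hc' hi, bitR_iff h.solved hc hi, h.colR_iff hu hi]
    exact h' i

theorem exists_step {c : ℕ} (hc : c < 2 ^ (I.t + 1)) (u : Fin I.n) :
    ∃ c' < 2 ^ (I.t + 1), bitSet c' = bitSet c ∪ I.game.colours u := by
  obtain ⟨c', hc', hb⟩ := exists_testBit_iff (I.t + 1) (· ∈ bitSet c ∪ I.game.colours u)
  refine ⟨c', hc', ?_⟩
  ext i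
  rw [mem_bitSet, hb]
  refine ⟨fun hi => hi.2, fun hi => ⟨?_, hi⟩⟩
  rcases hi with hi | hi
  · exact lt_of_testBit hc hi
  · exact Nat.lt_succ_of_le (I.game.le_of_mem_colours hi)

theorem lt_of_step {c c' : ℕ} (hc : c < 2 ^ (I.t + 1)) {u : Fin I.n}
    (h : bitSet c' = bitSet c ∪ I.game.colours u) : c' < 2 ^ (I.t + 1) := by
  refine lt_two_pow_of_testBit fun i hi => ?_
  rw [← mem_bitSet, h] at hi
  rcases hi with hi | hi
  · exact lt_of_testBit hc hi
  · exact Nat.lt_succ_of_le (I.game.le_of_mem_colours hi)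

/-! #### The winning regions -/

/-- The disjuncts of `attrF` match the constructors of `Attr`. The relation may also contain codes c
from 2 ^ (t + 1) on; they do no harm, since by `lt_of_step` no step leads to them from a smaller
code. -/
theorem attrR_iff (h : Correct I N ρ) {v c : ℕ} (hv : v < I.n) (hc : c < 2 ^ (I.t + 1)) :
    ρ attrR [v, c] ↔ I.game.Attr ⟨v, hv⟩ (bitSet c) := by
  have hnt := h.n_add_t_lt
  have hp := h.two_pow_lt
  obtain ⟨h₁, h₂⟩ := h.solved (.iterate attrR attrF) (List.mem_of_getElem? (i := 13) rfl)
  constructor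
  · intro hr
    refine h₂ (fun l => ∀ v c (hv : v < I.n), c < 2 ^ (I.t + 1) → l = [v, c] →
      I.game.Attr ⟨v, hv⟩ (bitSet c)) ?_ _ hr v c hv hc rfl
    rintro R hR _ - - hh v c hv hc rfl
    simp [attrF, Holds, holds_or, holds_all, holds_imp] at hh
    rw [h.ownR_iff hv] at hh
    rcases hh with ⟨z, hz, hz0, hb⟩ | ⟨ho, u, hu, c', hc', he, hs, hr⟩ | ⟨ho, hall⟩
    · rw [zeroR_iff h.solved hz] at hz0
      subst hz0
      rw [bitR_iff h.solved (by omega) hz] at hb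
      exact .base hb
    · rw [h.edgeR_iff (by omega) hu] at he
      obtain ⟨_, hu', he⟩ := he
      rw [h.stepR_iff (by omega) hu' hc'] at hs
      refine .zero (by omega) he ?_
      rw [← hs]
      exact hR [u, c'] rfl (by simp [hu, hc']) hr u c' hu' (lt_of_step hc hs) rfl
    · refine .one ho fun u he => ?_
      obtain ⟨c', hc', hs⟩ := exists_step hc u
      rw [← hs]
      refine hR [u, c'] rfl (by simp; omega) (hall u (by omega) c' (by omega)
        ((h.edgeR_iff (by omega) (by omega)).2 ⟨hv, u.2, he⟩)
        ((h.stepR_iff (by omega) u.2 (by omega)).2 hs)) u c' u.2 hc' rfl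
  · suffices key : ∀ (v : Fin I.n) (s : Set ℕ), I.game.Attr v s → ∀ c < 2 ^ (I.t + 1),
        bitSet c = s → ρ attrR [(v : ℕ), c] from fun ha => key _ _ ha c hc rfl
    intro v s ha
    induction ha with
    | @base v s h0 =>
      rintro c hc rfl
      refine h₁ _ rfl (by simp; omega) ?_
      simp [attrF, Holds, holds_or, holds_all, holds_imp]
      exact Or.inl ⟨0, by omega, (zeroR_iff h.solved (by omega)).2 rfl,
        (bitR_iff h.solved (by omega) (by omega)).2 h0⟩
    | @zero v s u ho he _ ih =>
      rintro c hc rfl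
      obtain ⟨c', hc', hs⟩ := exists_step hc u
      refine h₁ _ rfl (by simp; omega) ?_
      simp [attrF, Holds, holds_or, holds_all, holds_imp]
      refine Or.inr (Or.inl ⟨?_, u, by omega, c', by omega,
        (h.edgeR_iff (by omega) (by omega)).2 ⟨v.2, u.2, he⟩,
        (h.stepR_iff (by omega) u.2 (by omega)).2 hs, ih c' hc' hs⟩)
      rw [h.ownR_iff v.2]
      change ¬ I.game.arena.owner v = 1
      omega
    | @one v s ho _ ih =>
      rintro c hc rfl
      refine h₁ _ rfl (by simp; omega) ?_
      simp [attrF, Holds, holds_or, holds_all, holds_imp]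
      refine Or.inr (Or.inr ⟨(h.ownR_iff v.2).2 ho, fun u hu c' hc' he hs => ?_⟩)
      rw [h.edgeR_iff (by omega) hu] at he
      obtain ⟨_, hu', he⟩ := he
      rw [h.stepR_iff (by omega) hu' hc'] at hs
      exact ih _ he c' (lt_of_step hc hs) hs

theorem belowR_iff (h : Correct I N ρ) {W c : ℕ} (hW : W < N) (hc : c < N) :
    ρ belowR [W, c] ↔ ReachSPGame.Below (bitSets W) (bitSet c) := by
  rw [h.solved (.define belowR belowF) (List.mem_of_getElem? (i := 15) rfl) [W, c] rfl
    (by simp [hW, hc])]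
  simp only [belowF, Holds, List.cons_append, List.nil_append, List.getD_cons_zero,
    List.getD_cons_succ, List.map_cons, List.map_nil]
  constructor
  · rintro ⟨p, hp, h₁, h₂, h₃⟩
    rw [bitR_iff h.solved hW hp] at h₁
    rw [subR_iff h.solved hc hp] at h₂
    rw [subR_iff h.solved hp hc] at h₃
    exact ⟨bitSet p, ⟨p, h₁, rfl⟩, h₂, h₃⟩
  · rintro ⟨_, ⟨p, h₁, rfl⟩, h₂, h₃⟩
    have hp : p < N := by
      by_contra hp
      rw [testBit_eq_false_of_lt hW (not_lt.1 hp)] at h₁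
      exact absurd h₁ (by simp)
    exact ⟨p, hp, (bitR_iff h.solved hW hp).2 h₁, (subR_iff h.solved hc hp).2 h₂,
      fun hs => h₃ ((subR_iff h.solved hp hc).1 hs)⟩

/-- The number W is a parameter that stays fixed in all recursive uses. The relations that `loseF`
negates are complete before its iteration starts. -/
theorem loseR_iff (h : Correct I N ρ) {W v c : ℕ} (hW : W < N) (hv : v < I.n)
    (hc : c < 2 ^ (I.t + 1)) :
    ρ loseR [W, v, c] ↔ I.game.Lose (bitSets W) ⟨v, hv⟩ (bitSet c) := by
  have hnt := h.n_add_t_lt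
  have hp := h.two_pow_lt
  obtain ⟨h₁, h₂⟩ := h.solved (.iterate loseR loseF) (List.mem_of_getElem? (i := 16) rfl)
  constructor
  · intro hr
    refine h₂ (fun l => ∀ v c (hv : v < I.n), c < 2 ^ (I.t + 1) → l = [W, v, c] →
      I.game.Lose (bitSets W) ⟨v, hv⟩ (bitSet c)) ?_ _ hr v c hv hc rfl
    rintro R hR _ - - hh v c hv hc rfl
    simp [loseF, Holds, holds_or, holds_all, holds_imp] at hh
    rw [h.ownR_iff hv, h.attrR_iff hv hc, h.belowR_iff hW (by omega)] at hh
    rcases hh with ⟨hA, hb | ⟨ho, hall⟩ | ⟨ho, u, hu, c', hc', he, hs, hr⟩⟩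
    · exact .base hA hb
    · refine .zero hA (by omega) fun u he => ?_
      obtain ⟨c', hc', hs⟩ := exists_step hc u
      rw [← hs]
      refine hR [W, u, c'] rfl (by simp; omega) (hall u (by omega) c' (by omega)
        ((h.edgeR_iff (by omega) (by omega)).2 ⟨hv, u.2, he⟩)
        ((h.stepR_iff (by omega) u.2 (by omega)).2 hs)) u c' u.2 hc' rfl
    · rw [h.edgeR_iff (by omega) hu] at he
      obtain ⟨_, hu', he⟩ := he
      rw [h.stepR_iff (by omega) hu' hc'] at hs
      refine .one hA ho he ?_
      rw [← hs]
      exact hR [W, u, c'] rfl (by simp [hu, hc', hW]) hr u c' hu' (lt_of_step hc hs) rfl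
  · suffices key : ∀ (v : Fin I.n) (s : Set ℕ), I.game.Lose (bitSets W) v s →
        ∀ c < 2 ^ (I.t + 1), bitSet c = s → ρ loseR [W, (v : ℕ), c] from
      fun ha => key _ _ ha c hc rfl
    intro v s ha
    induction ha with
    | @base v s hA hb =>
      rintro c hc rfl
      refine h₁ _ rfl (by simp; omega) ?_
      simp [loseF, Holds, holds_or, holds_all, holds_imp]
      rw [h.attrR_iff v.2 hc, h.belowR_iff hW (by omega)]
      exact ⟨hA, Or.inl hb⟩
    | @zero v s hA ho _ ih =>
      rintro c hc rfl
      refine h₁ _ rfl (by simp; omega) ?_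
      simp [loseF, Holds, holds_or, holds_all, holds_imp]
      rw [h.attrR_iff v.2 hc, h.ownR_iff v.2]
      refine ⟨hA, Or.inr (Or.inl ⟨?_, fun u hu c' hc' he hs => ?_⟩)⟩
      · change ¬ I.game.arena.owner v = 1
        omega
      rw [h.edgeR_iff (by omega) hu] at he
      obtain ⟨_, hu', he⟩ := he
      rw [h.stepR_iff (by omega) hu' hc'] at hs
      exact ih _ he c' (lt_of_step hc hs) hs
    | @one v s u hA ho he _ ih =>
      rintro c hc rfl
      obtain ⟨c', hc', hs⟩ := exists_step hc u
      refine h₁ _ rfl (by simp; omega) ?_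
      simp [loseF, Holds, holds_or, holds_all, holds_imp]
      rw [h.attrR_iff v.2 hc, h.ownR_iff v.2]
      exact ⟨hA, Or.inr (Or.inr ⟨ho, u, by omega, c', by omega,
        (h.edgeR_iff (by omega) (by omega)).2 ⟨v.2, u.2, he⟩,
        (h.stepR_iff (by omega) u.2 (by omega)).2 hs, ih c' hc' hs⟩)⟩

end Correct

end

end SPSProgram

/-- Player 0 can distribute the payoffs in `S` among the successors smaller than `j` of the vertex
`v` of Player 1. -/
def ReachSPGame.Distributed {n t : ℕ} (g : ReachSPGame (Fin n) t) (W : Set (Set ℕ)) (v : Fin n)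
    (c : Set ℕ) (j : ℕ) (S : Set (Set ℕ)) : Prop :=
  ∃ F : Fin n → Set (Set ℕ), (∀ p ∈ S, ∃ u : Fin n, (u : ℕ) < j ∧ (v, u) ∈ g.arena.E ∧ p ∈ F u) ∧
    ∀ u : Fin n, (u : ℕ) < j → (v, u) ∈ g.arena.E →
      F u ⊆ S ∧ g.Good W u (c ∪ g.colours u) (F u)

namespace ReachSPGame.Distributed

variable {n t : ℕ} {g : ReachSPGame (Fin n) t} {W S S₁ S₂ : Set (Set ℕ)} {v : Fin n} {c : Set ℕ}
  {j : ℕ}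

theorem good (ho : g.arena.owner v = 1) (h : g.Distributed W v c n S) : g.Good W v c S := by
  obtain ⟨F, h₁, h₂⟩ := h
  refine .one F ho (fun p hp => ?_) (fun u he => (h₂ u u.2 he).1) fun u he => (h₂ u u.2 he).2
  obtain ⟨u, -, hu⟩ := h₁ p hp
  exact ⟨u, hu⟩

theorem zero : g.Distributed W v c 0 ∅ :=
  ⟨fun _ => ∅, by simp, fun u hu => absurd hu (by omega)⟩

theorem succ_of_not_mem (h : g.Distributed W v c j S)
    (hj : ∀ u : Fin n, (u : ℕ) = j → (v, u) ∉ g.arena.E) : g.Distributed W v c (j + 1) S := by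
  obtain ⟨F, h₁, h₂⟩ := h
  refine ⟨F, fun p hp => ?_, fun u hu he => h₂ u ?_ he⟩
  · obtain ⟨u, hu, h⟩ := h₁ p hp
    exact ⟨u, by omega, h⟩
  · have : (u : ℕ) ≠ j := fun h => hj u h he
    omega

/-- The family may be redefined at u because the hypothesis on `S₂` constrains it only below u. -/
theorem succ {u : Fin n} (hu : (v, u) ∈ g.arena.E) (h₁ : g.Good W u (c ∪ g.colours u) S₁)
    (h₂ : g.Distributed W v c u S₂) : g.Distributed W v c (u + 1) (S₁ ∪ S₂) := by
  obtain ⟨F, h₃, h₄⟩ := h₂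
  refine ⟨update F u S₁, fun p hp => ?_, fun u' hu' he => ?_⟩
  · rcases hp with hp | hp
    · exact ⟨u, by omega, hu, by simpa using hp⟩
    · obtain ⟨u', hu', he, hp⟩ := h₃ p hp
      refine ⟨u', by omega, he, ?_⟩
      rwa [update_of_ne (by rintro rfl; omega)]
  · by_cases h : u' = u
    · subst h
      simp only [update_self]
      exact ⟨Set.subset_union_left, h₁⟩
    · rw [update_of_ne h]
      have h' : (u' : ℕ) ≠ u := fun h' => h (Fin.ext h')
      obtain ⟨h₅, h₆⟩ := h₄ u' (by omega) he
      exact ⟨h₅.trans Set.subset_union_right, h₆⟩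

end ReachSPGame.Distributed

/-! ### Correctness of the fixed point for good sets. -/

namespace SPSProgram

open FOFormula ReachSPInstance

/-- Binary coding is applied twice, to the sets of colours and to the sets of their codes; this
double exponential determines the size of the domain. -/
theorem exists_bitSets {k : ℕ} {S : Set (Set ℕ)} (hS : ∀ p ∈ S, p ⊆ Set.Iio k) :
    ∃ m < 2 ^ 2 ^ k, bitSets m = S := by
  obtain ⟨m, hm, hb⟩ := exists_testBit_iff (2 ^ k) fun i => bitSet i ∈ S
  refine ⟨m, hm, Set.ext fun p => ⟨?_, fun hp => ?_⟩⟩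
  · rintro ⟨i, hi, rfl⟩
    exact ((hb i).1 hi).2
  · obtain ⟨i, hi, hb'⟩ := exists_testBit_iff k (· ∈ p)
    have : p = bitSet i := by
      ext a
      rw [mem_bitSet, hb']
      exact ⟨fun ha => ⟨hS p hp ha, ha⟩, fun ha => ha.2⟩
    subst this
    exact bitSet_mem_bitSets.2 ((hb i).2 ⟨hi, hp⟩)

theorem subset_of_mem_bitSets {k m : ℕ} (hm : m < 2 ^ 2 ^ k) {p : Set ℕ} (hp : p ∈ bitSets m) :
    p ⊆ Set.Iio k := by
  obtain ⟨i, hi, rfl⟩ := hp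
  exact fun a ha => lt_of_testBit (lt_of_testBit hm hi) ha

theorem bitSets_eq_union {a b c : ℕ} (h : bitSets c = bitSets a ∪ bitSets b) (i : ℕ) :
    c.testBit i = true ↔ a.testBit i = true ∨ b.testBit i = true := by
  rw [← bitSet_mem_bitSets, h, Set.mem_union, bitSet_mem_bitSets, bitSet_mem_bitSets]

theorem union_bitSets {a b c : ℕ}
    (h : ∀ i, c.testBit i = true ↔ a.testBit i = true ∨ b.testBit i = true) :
    bitSets c = bitSets a ∪ bitSets b := by
  ext p
  simp only [bitSets, Set.mem_union, Set.mem_ofPred_eq, h]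
  constructor
  · rintro ⟨m, h | h, rfl⟩
    · exact Or.inl ⟨m, h, rfl⟩
    · exact Or.inr ⟨m, h, rfl⟩
  · rintro (⟨m, h, rfl⟩ | ⟨m, h, rfl⟩)
    · exact ⟨m, Or.inl h, rfl⟩
    · exact ⟨m, Or.inr h, rfl⟩

namespace Correct

variable {I : ReachSPInstance} {N : ℕ} {ρ : RelStore}

/-- The invariant treats both meanings of the index at once: 0 for `Good`, and j + 1 for the
distribution among the successors smaller than j. Soundness needs no bound on S apart from the
domain. -/
theorem good_of_goodR (h : Correct I N ρ) {W v c S : ℕ} (hW : W < N) (hv : v < I.n)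
    (hc : c < 2 ^ (I.t + 1)) (hr : ρ goodR [W, v, c, 0, S]) :
    I.game.Good (bitSets W) ⟨v, hv⟩ (bitSet c) (bitSets S) := by
  have hnt := h.n_add_t_lt
  have hp := h.two_pow_lt
  obtain ⟨-, h₂⟩ := h.solved (.iterate goodR goodF) (List.mem_of_getElem? (i := 18) rfl)
  refine (h₂ (fun l => ∀ v c i S (hv : v < I.n), c < 2 ^ (I.t + 1) → l = [W, v, c, i, S] →
    (i = 0 → I.game.Good (bitSets W) ⟨v, hv⟩ (bitSet c) (bitSets S)) ∧
    ∀ j, i = j + 1 → I.game.Distributed (bitSets W) ⟨v, hv⟩ (bitSet c) j (bitSets S))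
    ?_ _ hr v c 0 S hv hc rfl).1 rfl
  clear hr hv hc v c S
  rintro R hR _ - hlt hh v c i S hv hc rfl
  simp only [List.mem_cons, List.not_mem_nil, or_false, forall_eq_or_imp, forall_eq] at hlt
  obtain ⟨-, hvN, hcN, hi, hS⟩ := hlt
  simp [goodF, Holds, holds_or, holds_all, holds_imp] at hh
  rw [h.ownR_iff hv, zeroR_iff h.solved hi, h.loseR_iff hW hv hc] at hh
  rcases hh with ⟨rfl, hall, hl⟩ | ⟨rfl, ho, u, hu, c', hc', he, hs, hr⟩ |
    ⟨rfl, ho, n, hn, hn', i', hi', hs, hr⟩ | ⟨z, hz, hz', hs, hall⟩ |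
    ⟨j, hj, hj', j', hj₁, hs, ⟨he, hr⟩ |
      ⟨he, S₁, hS₁, S₂, hS₂, c', hc', z, hz, hz', hst, hun, hr₁, hr₂⟩⟩
  · refine ⟨fun _ => .leaf ?_ hl, fun j hj => by omega⟩
    rintro _ ⟨m, hm, rfl⟩
    have hmN : m < N := by
      by_contra hmN
      rw [testBit_eq_false_of_lt hS (not_lt.1 hmN)] at hm
      exact absurd hm (by simp)
    exact (subR_iff h.solved hmN hcN).1 (hall m hmN ((bitR_iff h.solved hS hmN).2 hm))
  · refine ⟨fun _ => ?_, fun j hj => by omega⟩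
    rw [h.edgeR_iff (by omega) hu] at he
    obtain ⟨_, hu', he⟩ := he
    rw [h.stepR_iff (by omega) hu' hc'] at hs
    refine .zero (by omega) he ?_
    rw [← hs]
    exact (hR [W, u, c', 0, S] rfl (by simp [hu, hc', hW, hS, hi]) hr u c' 0 S hu'
      (lt_of_step hc hs) rfl).1 rfl
  · refine ⟨fun _ => ?_, fun j hj => by omega⟩
    rw [h.isnR_iff hn] at hn'
    rw [succR_iff h.solved hn hi'] at hs
    subst hn' hs
    exact ReachSPGame.Distributed.good ho ((hR _ rfl (by simp [hvN, hcN, hW, hS, hi']) hr v c _ S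
      hv hc rfl).2 _ rfl)
  · rw [zeroR_iff h.solved hz] at hz'
    rw [succR_iff h.solved hz hi] at hs
    subst hz' hs
    refine ⟨fun hi => by omega, fun j hj => ?_⟩
    obtain rfl : j = 0 := by omega
    have : bitSets S = ∅ := by
      refine Set.eq_empty_iff_forall_notMem.2 ?_
      rintro _ ⟨m, hm, rfl⟩
      by_cases hmN : m < N
      · exact hall m hmN ((bitR_iff h.solved hS hmN).2 hm)
      · rw [testBit_eq_false_of_lt hS (not_lt.1 hmN)] at hm
        exact absurd hm (by simp)
    rw [this]
    exact .zero
  · rw [twoR_iff h.solved hj hi] at hj'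
    rw [succR_iff h.solved hj₁ hi] at hs
    subst hj'
    obtain rfl : j' = j + 1 := by omega
    refine ⟨fun hi => by omega, fun k hk => ?_⟩
    obtain rfl : k = j + 1 := by omega
    refine .succ_of_not_mem ((hR _ rfl (by simp [hvN, hcN, hW, hS, hj₁]) hr v c _ S hv hc rfl).2 _
      rfl) ?_
    rintro u rfl hu
    exact he ((h.edgeR_iff hvN hj).2 ⟨hv, u.2, hu⟩)
  · rw [twoR_iff h.solved hj hi] at hj'
    rw [succR_iff h.solved hj₁ hi] at hs
    subst hj'
    obtain rfl : j' = j + 1 := by omega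
    refine ⟨fun hi => by omega, fun k hk => ?_⟩
    obtain rfl : k = j + 1 := by omega
    rw [h.edgeR_iff hvN hj] at he
    obtain ⟨_, hu', he⟩ := he
    rw [zeroR_iff h.solved hz] at hz'
    rw [h.stepR_iff hcN hu' hc'] at hst
    rw [unionR_iff h.solved hS₁ hS₂ hS] at hun
    subst hz'
    rw [union_bitSets hun]
    refine .succ he ?_ ((hR _ rfl (by simp [hvN, hcN, hW, hS₂, hj₁]) hr₂ v c _ S₂ hv hc rfl).2 _
      rfl)
    rw [← hst]
    exact (hR _ rfl (by simp [hj, hc', hW, hS₁, hz]) hr₁ j c' 0 S₁ hu' (lt_of_step hc hst) rfl).1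
      rfl

/-- All sets of obligations in the derivation are subsets of the initial one, so they consist of
subsets of {0, …, t} and have codes in the domain. This is where the bound on S is used. -/
theorem goodR_of_good (h : Correct I N ρ) {W : ℕ} (hW : W < N) {v : Fin I.n} {s : Set ℕ}
    {P : Set (Set ℕ)} (hg : I.game.Good (bitSets W) v s P) {c S : ℕ} (hc : c < 2 ^ (I.t + 1))
    (hcs : bitSet c = s) (hS : S < 2 ^ 2 ^ (I.t + 1)) (hSP : bitSets S = P) :
    ρ goodR [W, v, c, 0, S] := by
  have hnt := h.n_add_t_lt
  have hp := h.two_pow_lt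
  have hp' := h.two_pow_le
  have hdef := (h.solved (.iterate goodR goodF) (List.mem_of_getElem? (i := 18) rfl)).1
  induction hg generalizing c S with
  | @leaf v s P hP hl =>
    subst hcs hSP
    refine hdef _ rfl (by simp; omega) ?_
    simp [goodF, Holds, holds_or, holds_all, holds_imp]
    refine Or.inl ⟨(zeroR_iff h.solved (by omega)).2 rfl, fun m hm hb => ?_, fun hl' =>
      hl ((h.loseR_iff hW v.2 hc).1 hl')⟩
    rw [bitR_iff h.solved (by omega) hm] at hb
    exact (subR_iff h.solved hm (by omega)).2 (hP _ ⟨m, hb, rfl⟩)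
  | @zero v s P u ho he _ ih =>
    subst hcs hSP
    obtain ⟨c', hc', hs⟩ := exists_step hc u
    refine hdef _ rfl (by simp; omega) ?_
    simp [goodF, Holds, holds_or, holds_all, holds_imp]
    refine Or.inr (Or.inl ⟨(zeroR_iff h.solved (by omega)).2 rfl, ?_, u, by omega, c', by omega,
      (h.edgeR_iff (by omega) (by omega)).2 ⟨v.2, u.2, he⟩,
      (h.stepR_iff (by omega) u.2 (by omega)).2 hs, ih hc' hs hS rfl⟩)
    rw [h.ownR_iff v.2]
    change ¬ I.game.arena.owner v = 1
    omega
  | @one v s P F ho hcov hF _ ih =>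
    subst hcs hSP
    -- Here `S'` codes the union of the `F u` over the successors u < j. At j = n it is the whole
    -- set of obligations, since these are covered by the sets `F u` and contain them.
    have key : ∀ j ≤ I.n, ∀ S' < 2 ^ 2 ^ (I.t + 1),
        bitSets S' = {p | ∃ u : Fin I.n, (u : ℕ) < j ∧ (v, u) ∈ I.game.arena.E ∧ p ∈ F u} →
        ρ goodR [W, v, c, j + 1, S'] := by
      intro j
      induction j with
      | zero =>
        intro _ S' hS' he
        refine hdef _ rfl (by simp; omega) ?_
        simp [goodF, Holds, holds_or, holds_all, holds_imp]
        refine Or.inr (Or.inr (Or.inr (Or.inl ⟨0, by omega, (zeroR_iff h.solved (by omega)).2 rfl,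
          (succR_iff h.solved (by omega) (by omega)).2 rfl, fun m hm hb => ?_⟩)))
        rw [bitR_iff h.solved (by omega) hm, ← bitSet_mem_bitSets, he] at hb
        obtain ⟨u, hu, -⟩ := hb
        omega
      | succ j ihj =>
        intro hj S' hS' he
        refine hdef _ rfl (by simp; omega) ?_
        simp [goodF, Holds, holds_or, holds_all, holds_imp]
        refine Or.inr (Or.inr (Or.inr (Or.inr ⟨j, by omega,
          (twoR_iff h.solved (by omega) (by omega)).2 rfl, j + 1, by omega,
          (succR_iff h.solved (by omega) (by omega)).2 rfl, ?_⟩)))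
        rw [h.edgeR_iff (by omega) (by omega)]
        have hE : (∃ (hv : (v : ℕ) < I.n) (hu : j < I.n), (⟨v, hv⟩, ⟨j, hu⟩) ∈ I.game.arena.E) ↔
            (v, ⟨j, hj⟩) ∈ I.game.arena.E := ⟨fun ⟨_, _, h⟩ => h, fun h => ⟨v.2, hj, h⟩⟩
        rw [hE]
        have hlt : ∀ u : Fin I.n, (u : ℕ) < j + 1 ↔ (u : ℕ) < j ∨ u = ⟨j, hj⟩ := by
          intro u
          rw [Fin.ext_iff]
          change _ ↔ _ ∨ (u : ℕ) = j
          omega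
        by_cases hvj : (v, ⟨j, hj⟩) ∈ I.game.arena.E
        · obtain ⟨S₁, hS₁, hb₁⟩ := exists_bitSets (k := I.t + 1) (S := F ⟨j, hj⟩)
            fun p hp => subset_of_mem_bitSets hS (hF _ hvj hp)
          obtain ⟨S₂, hS₂, hb₂⟩ := exists_bitSets (k := I.t + 1)
            (S := {p | ∃ u : Fin I.n, (u : ℕ) < j ∧ (v, u) ∈ I.game.arena.E ∧ p ∈ F u})
            fun p ⟨u, _, hu, hp⟩ => subset_of_mem_bitSets hS (hF _ hu hp)
          obtain ⟨c', hc', hs⟩ := exists_step hc ⟨j, hj⟩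
          refine Or.inr ⟨hvj, S₁, by omega, S₂, by omega, c', by omega, 0, by omega,
            (zeroR_iff h.solved (by omega)).2 rfl,
            (h.stepR_iff (by omega) hj (by omega)).2 hs,
            (unionR_iff h.solved (by omega) (by omega) (by omega)).2
              (bitSets_eq_union ?_), ih _ hvj hc' hs hS₁ hb₁, ihj (by omega) S₂ hS₂ hb₂⟩
          rw [hb₁, hb₂, he]
          ext p
          constructor
          · rintro ⟨u, hu, hvu, hp⟩
            rcases (hlt u).1 hu with hu | rfl
            · exact Or.inr ⟨u, hu, hvu, hp⟩
            · exact Or.inl hp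
          · rintro (hp | ⟨u, hu, h⟩)
            · exact ⟨⟨j, hj⟩, by simp, hvj, hp⟩
            · exact ⟨u, by omega, h⟩
        · refine Or.inl ⟨hvj, ihj (by omega) S' hS' ?_⟩
          rw [he]
          ext p
          constructor
          · rintro ⟨u, hu, hvu, hp⟩
            rcases (hlt u).1 hu with hu | rfl
            · exact ⟨u, hu, hvu, hp⟩
            · exact absurd hvu hvj
          · rintro ⟨u, hu, h⟩
            exact ⟨u, by omega, h⟩
    refine hdef _ rfl (by simp; omega) ?_
    simp [goodF, Holds, holds_or, holds_all, holds_imp]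
    refine Or.inr (Or.inr (Or.inl ⟨(zeroR_iff h.solved (by omega)).2 rfl, (h.ownR_iff v.2).2 ho,
      I.n, by omega, (h.isnR_iff (by omega)).2 rfl, I.n + 1, by omega,
      (succR_iff h.solved (by omega) (by omega)).2 rfl, key I.n le_rfl S hS ?_⟩))
    ext p
    constructor
    · intro hp
      obtain ⟨u, hu, hpu⟩ := hcov p hp
      exact ⟨u, u.2, hu, hpu⟩
    · rintro ⟨u, -, hu, hpu⟩
      exact hF u hu hpu

/-- The guess W is also the initial set of obligations. Any W below N is acceptable for soundness;
for completeness `hasSolution_iff` yields one whose members are subsets of {0, …, t}, and this one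
has a code below 2^2^(t+1). -/
theorem resR_iff (h : Correct I N ρ) : ρ resR [] ↔ I.game.toSPGame.HasSolution := by
  have hnt := h.n_add_t_lt
  have hp := h.two_pow_lt
  have hp' := h.two_pow_le
  have key : ∀ v, (I.rows[1]?.getD []).getD v Bool.false = true ↔ v = I.game.arena.init := by
    intro v
    rw [rows, List.getElem?_cons_succ, List.getElem?_cons_zero, Option.getD_some, getD_bits]
    simp only [Finset.mem_singleton, Fin.ext_iff, exists_prop, and_iff_right_iff_imp]
    rintro rfl
    exact I.game.arena.init.2
  rw [h.solved (.define resR resF) (List.mem_of_getElem? (i := 19) rfl) [] rfl (by simp)]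
  simp [resF, Holds, holds_all, holds_iff]
  constructor
  · rintro ⟨W, hW, v, hv, c, hc, z, hz, hz', o, ho, hs, hf, hcol, hr⟩
    rw [zeroR_iff h.solved hz] at hz'
    subst hz'
    rw [succR_iff h.solved hz ho] at hs
    subst hs
    rw [h.fieldR_iff ho hv, key] at hf
    obtain ⟨-, rfl⟩ := hf
    have hb : bitSet c = I.game.colours I.game.arena.init := by
      ext i
      by_cases hi : i < N
      · have := hcol i hi
        rwa [bitR_iff h.solved hc hi, h.colR_iff (Fin.is_lt _) hi] at this
      · rw [mem_bitSet, testBit_eq_false_of_lt hc (not_lt.1 hi)]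
        refine ⟨fun h => absurd h (by simp), fun h => ?_⟩
        have := I.game.le_of_mem_colours h
        omega
    have hc' : c < 2 ^ (I.t + 1) := by
      refine lt_two_pow_of_testBit fun i hi => ?_
      rw [← mem_bitSet, hb] at hi
      exact Nat.lt_succ_of_le (I.game.le_of_mem_colours hi)
    have := h.good_of_goodR hW (Fin.is_lt _) hc' hr
    rw [hb] at this
    exact I.game.hasSolution_of_good this
  · intro hsol
    obtain ⟨P, hP, hg⟩ := I.game.hasSolution_iff.1 hsol
    obtain ⟨W, hW, rfl⟩ := exists_bitSets (k := I.t + 1) (S := P)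
      fun p hp i hi => Nat.lt_succ_of_le (hP p hp hi)
    obtain ⟨c, hc, hb⟩ := exists_testBit_iff (I.t + 1) (· ∈ I.game.colours I.game.arena.init)
    have hb' : ∀ i, c.testBit i = true ↔ i ∈ I.game.colours I.game.arena.init := fun i =>
      (hb i).trans ⟨fun h => h.2, fun h => ⟨Nat.lt_succ_of_le (I.game.le_of_mem_colours h), h⟩⟩
    refine ⟨W, by omega, I.game.arena.init, by omega, c, by omega, 0, by omega,
      (zeroR_iff h.solved (by omega)).2 rfl, 1, by omega,
      (succR_iff h.solved (by omega) (by omega)).2 rfl,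
      (h.fieldR_iff (by omega) (by omega)).2 ⟨Fin.is_lt _, (key _).2 rfl⟩, fun i hi => ?_,
      h.goodR_of_good (by omega) hg hc (Set.ext hb') hW rfl⟩
    rw [bitR_iff h.solved (by omega) hi, h.colR_iff (Fin.is_lt _) hi]
    exact hb' i

end Correct

theorem correct_foldl_apply (I : ReachSPInstance) :
    Correct I (I.encode.length * 2 ^ 2 ^ (I.t + 1))
      (instrs.foldl (fun ρ J => J.apply arity (I.encode.length * 2 ^ 2 ^ (I.t + 1)) ρ)
        (StackProg.inputRel I.encode)) where
  solved := RelInstr.solved_foldl_apply stratified_instrs _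
  size := rfl
  input i := by
    rw [RelInstr.foldl_apply_of_lt stratified_instrs _ (by norm_num)]
    simp [StackProg.inputRel]

end SPSProgram

/-! ### The computable time bound, and the conclusion. -/

theorem Primrec.pow_const_left (a : ℕ) : Primrec fun n : ℕ => a ^ n := by
  have h := Primrec.nat_rec₁ (f := fun _ y => y * a) 1
    (Primrec.nat_mul.comp Primrec.snd (Primrec.const a))
  refine h.of_eq fun n => ?_
  induction n with
  | zero => rfl
  | succ n ih => rw [pow_succ, ← ih]

theorem Primrec.pow_const_right (e : ℕ) : Primrec fun n : ℕ => n ^ e := by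
  induction e with
  | zero => simpa using Primrec.const 1
  | succ e ih => simpa only [pow_succ] using! Primrec.nat_mul.comp ih Primrec.id

theorem computable_two_mul_two_pow_two_pow (e : ℕ) :
    Computable fun t : ℕ => 2 * (2 ^ 2 ^ (t + 1)) ^ e :=
  (Primrec.nat_mul.comp (Primrec.const 2) ((Primrec.pow_const_right e).comp
    ((Primrec.pow_const_left 2).comp ((Primrec.pow_const_left 2).comp Primrec.succ)))).to_comp

theorem theorem1 :
    InFPT ReachSPInstance.encode ReachSPInstance.t ReachSPInstance.SPS := by
  classical
  obtain ⟨e, he⟩ := StackProg.exec_decider SPSProgram.arity SPSProgram.instrs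
    SPSProgram.wf_instrs (m := 21) (r := resR) (by norm_num) SPSProgram.target_lt rfl rfl
  refine ⟨(StackProg.decider SPSProgram.arity SPSProgram.instrs 21 resR).machineAux, _, e,
    computable_two_mul_two_pow_two_pow e, fun I => ?_⟩
  have hx := he I.n I.t _ I.encode _ I.encode_eq rfl
  refine ⟨_, (decide_eq_true_iff).trans (SPSProgram.correct_foldl_apply I).resR_iff, ?_⟩
  have hpos : 0 < I.encode.length := by rw [ReachSPInstance.length_encode]; omega
  have hT : 0 < (I.encode.length * 2 ^ 2 ^ (I.t + 1)) ^ e := by positivity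
  -- The factor 2 in the bound pays for the final halting step: N ^ e ≤ 2 * N ^ e - 1.
  have h := (hx.weaken (T₁ := 2 * (I.encode.length * 2 ^ 2 ^ (I.t + 1)) ^ e - 1)
    (by omega)).outputs
  rw [show 2 * (I.encode.length * 2 ^ 2 ^ (I.t + 1)) ^ e - 1 + 1 =
    2 * (2 ^ 2 ^ (I.t + 1)) ^ e * I.encode.length ^ e by
      rw [Nat.sub_add_cancel (by omega), mul_pow]; ring] at h
  exact h
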